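/- Let $\mathbb D_-=\{z\in\mathbb C:|z|>1\}$ and let $\Sigma'$ be the class of univalent maps $\phi:\mathbb D_-\to\mathbb D_-$ with $\phi(\infty)=\infty$ and $\phi'(\infty)=\lim_{z\to\infty}\phi(z)/z\in\mathbb R\setminus\{0\}$. For $\phi\in\Sigma'$ write $\phi_\theta(z)=e^{i\theta}\phi(e^{-i\theta}z)$ and let $K_n\phi(z)=\sqrt[n]{\phi(z^n)}$ be the Koebe $n$-root transform (the holomorphic branch whose derivative at infinity is the principal $n$-th root of $\phi'(\infty)$). Fix $\phi\in\Sigma'$, an integer $k\ge 2$ and $t\in\mathbb R$. The random conformal snowflake is $f=\lim_n f_n$, where $f_0=\phi_{\theta_0}$, $f_n=f_{n-1}\circ K_{k^n}\phi_{\theta_n}$, and $\theta_0,\theta_1,\dots$ are independent and uniformly distributed on the circle. Its average integral means spectrum is $$\bar\beta(t)=\inf\Big\{\beta\in\mathbb R:\int_1(r-1)^{\beta-1}\int_0^{2\pi}\mathbb E\big[|f'(re^{i\theta})|^t\big]\,d\theta\,dr<\infty\Big\},$$ where $\int_1$ means integration over $(1,1+\delta)$ for some $\delta>0$. Let $\psi=\phi^{-1}:\phi(\mathbb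 D_-)\to\mathbb D_-$ and, for functions on $(1,\infty)$, put $$Qf(r)=k\int_{-\pi}^{\pi}f(|\psi(re^{i\theta})|^k)\,|\psi^{k-1}(re^{i\theta})\psi'(re^{i\theta})|^{2-t}\,\frac{d\theta}{2\pi}$$ (points $re^{i\theta}\notin\phi(\mathbb D_-)$ do not contribute) and $$P\nu(r)=r^{1-\frac{(k-1)t}{k}}\int_0^{2\pi}\nu(|\phi(r^{1/k}e^{i\theta})|)\,\frac{|\phi'(r^{1/k}e^{i\theta})|^t}{|\phi(r^{1/k}e^{i\theta})|}\,\frac{d\theta}{2\pi}.$$ Let $R>1$ and $D_R=\{1<|z|<R\}$ be such that $D_R\subset\psi^k(D_R)=\{\psi(z)^k:z\in D_R\cap\phi(\mathbb D_-)\}$. For a function $\nu$ on $[1,R]$ let $P_R\nu$ be $P$ applied to the extension of $\nu$ by zero, and similarly $Q_R$. Then: 1. For all measurable $f,\nu\ge 0$ (values and integrals in $[0,\infty]$), $\int_1^\infty Qf\,\nu\,dr=\int_1^\infty f\,P\nu\,dr$. 2. For all measurable $f,\nu\ge 0$, $\int_1^R Q_Rf\,\nu\,dr=\int_1^R f\,P_R\nu\,dr$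 and $\int_1^R Qf\,\nu\,dr\ge\int_1^R f\,P_R\nu\,dr$. 3. If moreover $\phi(\{u:1<|u|<R^{1/k}\})\subset D_R$ (that is, $\psi^k|_{D_R}$ covers $D_R$ with all $k$ sheets), then $P_R\nu=P\nu$ on $(1,R)$ for every $\nu\ge0$. 4. For every bounded measurable $\nu:[1,R]\to(0,\infty)$, $$\bar\beta(t)\ \ge\ \inf_{1<r<R}\frac{\log\big(P_R\nu(r)/\nu(r)\big)}{\log k}$$ (with $\log 0=-\infty$); in particular this holds with the infimum taken over $[1,R]$ when $P_R\nu$ is defined at the end points. 5. If $\lambda\in\mathbb C$ is an eigenvalue of $P_R$, i.e. $P_R\nu=\lambda\nu$ a.e. on $[1,R]$ for some bounded measurable $\nu:[1,R]\to\mathbb C$ that is not a.e. zero, then $\bar\beta(t)\ge\log|\lambda|/\log k$. In particular $\bar\beta(t)\ge\log\lambda/\log k$ for the maximal eigenvalue $\lambda$. -/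

import Mathlib

open MeasureTheory Filter Topology Set Bornology
open scoped ENNReal

noncomputable section

namespace Snowflake

/-- The exterior `𝔻₋ = {z : 1 < |z|}` of the closed unit disc. -/
def extDisk : Set ℂ := {z | 1 < ‖z‖}

/-- The annulus `D_R = {z : 1 < |z| < R}`. -/
def annulus (R : ℝ) : Set ℂ := {z | 1 < ‖z‖ ∧ ‖z‖ < R}

/-- The class `Σ'`: univalent maps `φ : 𝔻₋ → 𝔻₋` with `φ(∞) = ∞` and real `φ'(∞)`,
i.e. `φ(z) = b z + O(1)` at infinity with `b` real (and nonzero, by univalence at `∞`).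
Only the values of `φ` on `𝔻₋` matter. -/
structure IsSigmaPrime (φ : ℂ → ℂ) : Prop where
  differentiableOn : DifferentiableOn ℂ φ extDisk
  injOn : InjOn φ extDisk
  mapsTo : MapsTo φ extDisk extDisk
  exists_real_deriv_infty :
    ∃ b : ℝ, b ≠ 0 ∧ Tendsto (fun z : ℂ => φ z / z) (cobounded ℂ) (𝓝 (b : ℂ))

/-- The derivative at infinity `φ'(∞) = lim φ(z) / z`. -/
def derivInfty (φ : ℂ → ℂ) : ℂ := limUnder (cobounded ℂ) (fun z : ℂ => φ z / z)

/-- The Koebe `n`-root transform `(K_n φ)(z) = φ(z ^ n) ^ (1 / n)`: the holomorphic branch on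
`𝔻₋` whose derivative at infinity is the principal `n`-th root of `φ'(∞)` (the positive root
if `φ'(∞) > 0`).  These properties determine it uniquely on `𝔻₋`. -/
def rootTransform (n : ℕ) (φ : ℂ → ℂ) : ℂ → ℂ :=
  Classical.epsilon fun h : ℂ → ℂ =>
    DifferentiableOn ℂ h extDisk ∧ (∀ z ∈ extDisk, h z ^ n = φ (z ^ n)) ∧
      Tendsto (fun z : ℂ => h z / z) (cobounded ℂ) (𝓝 (derivInfty φ ^ (1 / (n : ℂ))))

/-- The rotation `φ_θ(z) = e^{iθ} φ(z e^{-iθ})`; the angle is measured in full turns, so that it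
is a point of `ℝ / ℤ`. -/
def rot (φ : ℂ → ℂ) (θ : UnitAddCircle) (z : ℂ) : ℂ :=
  (AddCircle.toCircle θ : ℂ) * φ (z * (AddCircle.toCircle (-θ) : ℂ))

/-- `f_0 = φ_{θ_0}` and `f_{n+1} = f_n ∘ K_{k^{n+1}} φ_{θ_{n+1}}`. -/
def snowflakeApprox (φ : ℂ → ℂ) (k : ℕ) (θ : ℕ → UnitAddCircle) : ℕ → ℂ → ℂ
  | 0 => rot φ (θ 0)
  | n + 1 => snowflakeApprox φ k θ n ∘ rootTransform (k ^ (n + 1)) (rot φ (θ (n + 1)))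

/-- The conformal snowflake `f = lim f_n` with building block `φ` and rotations `θ_n`. -/
def snowflake (φ : ℂ → ℂ) (k : ℕ) (θ : ℕ → UnitAddCircle) (z : ℂ) : ℂ :=
  limUnder atTop fun n => snowflakeApprox φ k θ n z

/-- The law of the rotations of the random snowflake: independent and uniform. -/
def angleLaw : Measure (ℕ → UnitAddCircle) :=
  Measure.infinitePi fun _ : ℕ => (AddCircle.haarAddCircle : Measure UnitAddCircle)

/-- The integral `∫_1^{1+δ} (r-1)^{β-1} ∫_0^{2π} 𝔼 |f'(r e^{iθ})|^t dθ dr`. -/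
def meanIntegral (φ : ℂ → ℂ) (k : ℕ) (t β δ : ℝ) : ℝ≥0∞ :=
  ∫⁻ r in Ioo (1 : ℝ) (1 + δ), ENNReal.ofReal ((r - 1) ^ (β - 1)) *
    ∫⁻ x in Ioc (0 : ℝ) (2 * Real.pi),
      ∫⁻ θ, ‖deriv (snowflake φ k θ) (circleMap 0 r x)‖ₑ ^ t ∂angleLaw

/-- The average integral means spectrum `β̄(t)` of the random snowflake: the infimum of the `β`
for which `∫_1 (r-1)^{β-1} ∫_0^{2π} 𝔼 |f'(r e^{iθ})|^t dθ dr` is finite near `r = 1`. -/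
def avgSpectrum (φ : ℂ → ℂ) (k : ℕ) (t : ℝ) : EReal :=
  sInf ((fun β : ℝ => (β : EReal)) '' {β : ℝ | ∃ δ > 0, meanIntegral φ k t β δ < ∞})

/-- The inverse `ψ = φ⁻¹ : φ(𝔻₋) → 𝔻₋`. -/
def inv (φ : ℂ → ℂ) : ℂ → ℂ := Function.invFunOn φ extDisk

/-- The operator
`Q f(r) = k ∫_{-π}^{π} f(|ψ^k(r e^{iθ})|) |ψ^{k-1}(r e^{iθ}) ψ'(r e^{iθ})|^{2-t} dθ / 2π`
on nonnegative functions; points outside the domain `φ(𝔻₋)` of `ψ` do not contribute. -/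
def opQ (φ : ℂ → ℂ) (k : ℕ) (t : ℝ) (f : ℝ → ℝ≥0∞) (r : ℝ) : ℝ≥0∞ :=
  ∫⁻ x in {x : ℝ | x ∈ Ioc (-Real.pi) Real.pi ∧ circleMap 0 r x ∈ φ '' extDisk},
    ENNReal.ofReal (k * ‖inv φ (circleMap 0 r x) ^ (k - 1) *
        deriv (inv φ) (circleMap 0 r x)‖ ^ (2 - t) / (2 * Real.pi)) *
      f (‖inv φ (circleMap 0 r x) ^ k‖)

/-- The point `r^{1/k} e^{iθ}`. -/
def rootPt (k : ℕ) (r x : ℝ) : ℂ := circleMap 0 (r ^ (1 / (k : ℝ))) x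

/-- The density `r^{1-(k-1)t/k} |φ'(u)|^t / |φ(u)| / 2π` at `u = r^{1/k} e^{iθ}`. -/
def weightP (φ : ℂ → ℂ) (k : ℕ) (t r x : ℝ) : ℝ :=
  r ^ (1 - ((k : ℝ) - 1) * t / k) *
    (‖deriv φ (rootPt k r x)‖ ^ t / ‖φ (rootPt k r x)‖) / (2 * Real.pi)

/-- The operator
`P ν(r) = r^{1-(k-1)t/k} ∫_0^{2π} ν(|φ(u)|) |φ'(u)|^t / |φ(u)| dθ / 2π`, `u = r^{1/k} e^{iθ}`,
on nonnegative functions. -/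
def opP (φ : ℂ → ℂ) (k : ℕ) (t : ℝ) (ν : ℝ → ℝ≥0∞) (r : ℝ) : ℝ≥0∞ :=
  ∫⁻ x in Ioc (0 : ℝ) (2 * Real.pi),
    ENNReal.ofReal (weightP φ k t r x) * ν ‖φ (rootPt k r x)‖

/-- The same operator `P` on complex-valued functions. -/
def opPC (φ : ℂ → ℂ) (k : ℕ) (t : ℝ) (ν : ℝ → ℂ) (r : ℝ) : ℂ :=
  ∫ x in Ioc (0 : ℝ) (2 * Real.pi), (weightP φ k t r x : ℂ) * ν ‖φ (rootPt k r x)‖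

/-- `lam` is an eigenvalue of `P` on `[1, R]`: there is a bounded measurable function `ν` on
`[1, R]`, not almost everywhere zero, with `P ν = lam ν` almost everywhere on `[1, R]`.  The
operator acts on a function on `[1, R]` through its extension by zero. -/
def IsEigenvalueOn (φ : ℂ → ℂ) (k : ℕ) (t R : ℝ) (lam : ℂ) : Prop :=
  ∃ ν : ℝ → ℂ, Measurable ν ∧ (∃ C : ℝ, ∀ r ∈ Icc 1 R, ‖ν r‖ ≤ C) ∧
    (¬ ∀ᵐ r ∂volume.restrict (Icc 1 R), ν r = 0) ∧
    ∀ᵐ r ∂volume.restrict (Icc 1 R), opPC φ k t ((Icc 1 R).indicator ν) r = lam * ν r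

end Snowflake

end

noncomputable section

namespace Snowflake

/-! Adjointness is a change of variables: both pairings equal one area integral of `f (‖z‖ ^ k) * ν
‖φ z‖` over the exterior disc, computed by polar coordinates in the `z`-plane for `P`
(`lintegral_mul_opP`) and in the `φ z`-plane for `Q` (`lintegral_opQ_mul`).

The spectral bounds rest on self-similarity. The snowflake is `f = φ_{θ₀} ∘ g`, where `g(z) ^ k =
f̃(z ^ k)` and `f̃` is a snowflake independent of `θ₀`. Averaging `ν(|f|) |f|⁻¹ |f'|^t` over `θ₀`
therefore replaces `ν` by `P ν` and `z` by `z ^ k` (`IsLogOf.moment_eq`). Integrated against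
`r^(t-1) (log r)^(β-1)`, this becomes the exact scaling `I_{Pν}(ρ ^ k) = k ^ β I_ν(ρ)`
(`IsLogOf.momentIntegral_pow`). If `ν` is bounded, `P ν ≥ λ ν` with `λ > k ^ β`, and the spectral
integral converges at `β`, then `λ I_ν ≤ k ^ β I_ν < ∞` near `1`, so `I_ν = 0`, first near `1` and
then everywhere.

It remains to see that such a `ν` is zero a.e. on `(1, ∞)`. Vanishing moments give `ν(|f|) = 0`
a.e., hence `ν = 0` above some radius, since `|f|` takes all large values and the relevant null sets
are carried to null sets. Let `a` be the least radius above which every function with vanishing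
moments vanishes. This class of functions is invariant under `P`, so minimality of `a` gives `|φ| ≥
a` on `|u| ^ k = a` (`exists_repels_vanishAbove`), and the maximum principle for `z ^ k / φ` gives
`|φ| ≥ x` on `|u| ^ k = x` for all smaller `x` (`Repels.of_le`). Below a radius `x` above which `ν`
vanishes, `P ν` then sees `ν` only through the points with `r ≤ |φ| ≤ x`. Their mass stays below
`λ`, so `ν` vanishes a little further down (`IsLogOf.exists_lt_vanishAbove`), and the descent can
stop only at `1`. The exceptional case is `φ(z) = c z`, where this mass can equal `1`; there
convergence forces `β ≥ 0`, hence `λ > 1`.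

Test functions are subsolutions after extension by zero, and an eigenfunction gives one through `|λ|
|ν| = |P ν| ≤ P |ν|`. -/

/-! ### The exterior disc and logarithms of maps of class `Σ'` -/

theorem isOpen_extDisk : IsOpen extDisk := isOpen_lt continuous_const continuous_norm

theorem extDisk_ne_zero {z : ℂ} (hz : z ∈ extDisk) : z ≠ 0 := by
  rintro rfl
  simp only [extDisk, mem_ofPred_eq, norm_zero] at hz
  linarith

theorem inv_mem_ball_of_mem_extDisk {z : ℂ} (hz : z ∈ extDisk) : z⁻¹ ∈ Metric.ball (0 : ℂ) 1 := by
  rw [mem_ball_zero_iff, norm_inv]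
  exact inv_lt_one_of_one_lt₀ hz

theorem inv_mem_extDisk {u : ℂ} (hu : u ∈ Metric.ball (0 : ℂ) 1) (h0 : u ≠ 0) :
    u⁻¹ ∈ extDisk := by
  rw [extDisk, mem_ofPred_eq, norm_inv]
  exact one_lt_inv_iff₀.2 ⟨norm_pos_iff.2 h0, by simpa using hu⟩

/-- The exterior of a disc is the image of a half-plane under the exponential map. -/
theorem isPreconnected_norm_gt {ρ : ℝ} (hρ : 0 < ρ) : IsPreconnected {z : ℂ | ρ < ‖z‖} := by
  have : {z : ℂ | ρ < ‖z‖} = Complex.exp '' {s | Real.log ρ < s.re} := by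
    ext z
    constructor
    · intro hz
      have hz0 : z ≠ 0 := norm_pos_iff.1 (hρ.trans hz)
      refine ⟨Complex.log z, ?_, Complex.exp_log hz0⟩
      rw [mem_ofPred_eq, Complex.log_re]
      exact Real.log_lt_log hρ hz
    · rintro ⟨s, hs, rfl⟩
      rw [mem_ofPred_eq, Complex.norm_exp, ← Real.exp_log hρ]
      exact Real.exp_lt_exp.2 hs
  rw [this]
  exact (convex_halfSpace_re_gt _).isPreconnected.image _ Complex.continuous_exp.continuousOn

theorem isPreconnected_extDisk : IsPreconnected extDisk := isPreconnected_norm_gt one_pos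

/-- A nowhere vanishing holomorphic function on the unit disc has a holomorphic logarithm. -/
theorem exists_log_on_ball {H : ℂ → ℂ} (hH : DifferentiableOn ℂ H (Metric.ball 0 1))
    (h0 : ∀ u ∈ Metric.ball (0 : ℂ) 1, H u ≠ 0) :
    ∃ l : ℂ → ℂ, DifferentiableOn ℂ l (Metric.ball 0 1) ∧ l 0 = Complex.log (H 0) ∧
      ∀ u ∈ Metric.ball (0 : ℂ) 1, Complex.exp (l u) = H u := by
  -- The logarithm is the primitive of `H' / H` normalised at `0`; then `H e^{-l}` has zero
  -- derivative.
  have hd : DifferentiableOn ℂ (fun u => deriv H u / H u) (Metric.ball 0 1) :=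
    (hH.deriv Metric.isOpen_ball).div hH h0
  obtain ⟨l, hl0, hl⟩ := hd.isExactOn_ball.with_val_at 0 (Complex.log (H 0))
  refine ⟨l, fun u hu => (hl u hu).differentiableAt.differentiableWithinAt, hl0, fun u hu => ?_⟩
  have hHd : ∀ u ∈ Metric.ball (0 : ℂ) 1, HasDerivAt H (deriv H u) u := fun u hu =>
    (hH.differentiableAt (Metric.isOpen_ball.mem_nhds hu)).hasDerivAt
  have hder : ∀ u ∈ Metric.ball (0 : ℂ) 1,
      HasDerivAt (fun u => H u * Complex.exp (-l u)) 0 u := by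
    intro u hu
    convert! (hHd u hu).mul (hl u hu).neg.cexp using 1
    field_simp [h0 u hu]
    ring
  have h00 : (0 : ℂ) ∈ Metric.ball (0 : ℂ) 1 := by simp
  have hconst := Metric.isOpen_ball.is_const_of_deriv_eq_zero
    (convex_ball (0 : ℂ) 1).isPreconnected
    (fun u hu => (hder u hu).differentiableAt.differentiableWithinAt)
    (fun u hu => (hder u hu).deriv) hu h00
  simp only [hl0, Complex.exp_neg, Complex.exp_log (h0 0 h00)] at hconst
  rw [mul_inv_cancel₀ (h0 0 h00)] at hconst
  rw [← div_eq_mul_inv, div_eq_one_iff_eq (Complex.exp_ne_zero _)] at hconst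
  exact hconst.symm

/-- The logarithm of `u φ(1/u)` on the unit disc. -/
structure IsLogOf (φ : ℂ → ℂ) (l : ℂ → ℂ) (b : ℂ) : Prop where
  ne_zero : b ≠ 0
  differentiableOn : DifferentiableOn ℂ l (Metric.ball 0 1)
  map_zero : l 0 = Complex.log b
  re_nonneg : ∀ u ∈ Metric.ball (0 : ℂ) 1, 0 ≤ (l u).re
  eq_exp : ∀ z ∈ extDisk, φ z = z * Complex.exp (l z⁻¹)
  tendsto : Tendsto (fun z : ℂ => φ z / z) (cobounded ℂ) (𝓝 b)

/-- In the coordinate `u = 1/z` the function `u φ(1/u)` has a removable singularity at `0` with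
nonzero value `b`, and no zeros in the disc, so it has a logarithm. The sign of the real part is the
Schwarz lemma for `u ↦ 1 / φ(1/u)`, which fixes `0` and maps the disc into the closed disc. -/
theorem IsSigmaPrime.exists_isLogOf {φ : ℂ → ℂ} (hφ : IsSigmaPrime φ) :
    ∃ l b, IsLogOf φ l b := by
  obtain ⟨b, hb, ht⟩ := hφ.exists_real_deriv_infty
  have hb' : (b : ℂ) ≠ 0 := by exact_mod_cast hb
  set H : ℂ → ℂ := Function.update (fun u => u * φ u⁻¹) 0 (b : ℂ) with hHdef
  have hH0 : H 0 = b := by simp [hHdef]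
  have hH1 : ∀ u, u ≠ 0 → H u = u * φ u⁻¹ := fun u hu => by simp [hHdef, hu]
  have hφ0 : ∀ z ∈ extDisk, φ z ≠ 0 := fun z hz => extDisk_ne_zero (hφ.mapsTo hz)
  have hcont : Tendsto (fun u : ℂ => u * φ u⁻¹) (𝓝[≠] 0) (𝓝 (b : ℂ)) := by
    refine (ht.comp (tendsto_inv₀_nhdsNE_zero)).congr fun u => ?_
    simp [div_eq_mul_inv, mul_comm]
  have hcontAt : ContinuousAt H 0 := continuousAt_update_same.2 hcont
  have hball : Metric.ball (0 : ℂ) 1 ∈ 𝓝 (0 : ℂ) := Metric.ball_mem_nhds _ one_pos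
  have hd : DifferentiableOn ℂ H (Metric.ball 0 1) := by
    rw [← Complex.differentiableOn_compl_singleton_and_continuousAt_iff hball]
    refine ⟨?_, hcontAt⟩
    have : DifferentiableOn ℂ (fun u => u * φ u⁻¹) (Metric.ball 0 1 \ {0}) := by
      refine differentiableOn_id.mul (hφ.differentiableOn.comp
        (differentiableOn_inv.mono fun u hu => hu.2) fun u hu => inv_mem_extDisk hu.1 hu.2)
    exact this.congr fun u hu => hH1 u hu.2
  have hne : ∀ u ∈ Metric.ball (0 : ℂ) 1, H u ≠ 0 := by
    intro u hu
    by_cases h : u = 0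
    · rw [h, hH0]; exact hb'
    · rw [hH1 u h]; exact mul_ne_zero h (hφ0 _ (inv_mem_extDisk hu h))
  obtain ⟨l, hld, hl0, hl⟩ := exists_log_on_ball hd hne
  have hG : DifferentiableOn ℂ (fun u => u / H u) (Metric.ball 0 1) :=
      differentiableOn_id.div hd hne
  have hGmaps : MapsTo (fun u => u / H u) (Metric.ball 0 1) (Metric.closedBall 0 1) := by
    intro u hu
    by_cases h : u = 0
    · simp [h]
    · have h1 := hφ.mapsTo (inv_mem_extDisk hu h)
      simp only [extDisk, mem_ofPred_eq] at h1
      simp only [mem_closedBall_zero_iff, hH1 u h, norm_div, norm_mul]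
      rw [div_le_one (by positivity)]
      nlinarith [norm_pos_iff.2 h]
  have hre' : ∀ u ∈ Metric.ball (0 : ℂ) 1, u ≠ 0 → 0 ≤ (l u).re := by
    intro u hu h
    have h1 := Complex.norm_le_norm_of_mapsTo_ball hG hGmaps (by simp) (mem_ball_zero_iff.1 hu)
    have h2 : 0 < ‖u‖ := norm_pos_iff.2 h
    have h3 : 0 < ‖H u‖ := norm_pos_iff.2 (hne u hu)
    rw [norm_div, div_le_iff₀ h3] at h1
    have h4 : 1 ≤ ‖H u‖ := by nlinarith
    rw [← hl u hu, Complex.norm_exp] at h4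
    exact Real.one_le_exp_iff.1 h4
  refine ⟨l, b, hb', hld, by rw [hl0, hH0], fun u hu => ?_, fun z hz => ?_, ht⟩
  -- The Schwarz bound divides by `‖u‖`, so the centre is reached by continuity.
  · by_cases h : u = 0
    · rw [h]
      have hc : Tendsto (fun u => (l u).re) (𝓝[≠] 0) (𝓝 (l 0).re) :=
        (Complex.continuous_re.continuousAt.comp
          (hld.continuousOn.continuousAt hball)).tendsto.mono_left nhdsWithin_le_nhds
      refine ge_of_tendsto hc ?_
      filter_upwards [self_mem_nhdsWithin, mem_nhdsWithin_of_mem_nhds hball] with u h0 hu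
      exact hre' u hu h0
    · exact hre' u hu h
  · have hz0 := extDisk_ne_zero hz
    rw [hl _ (inv_mem_ball_of_mem_extDisk hz), hH1 _ (inv_ne_zero hz0), inv_inv, ← mul_assoc,
      mul_inv_cancel₀ hz0, one_mul]

/-! ### Univalent maps have no critical points -/

/-- An injective holomorphic function has nonvanishing derivative. -/
theorem deriv_ne_zero_of_injOn {f : ℂ → ℂ} {U : Set ℂ} (hU : IsOpen U)
    (hf : DifferentiableOn ℂ f U) (hinj : InjOn f U) {z₀ : ℂ} (hz : z₀ ∈ U) :
    deriv f z₀ ≠ 0 := by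
  intro hd
  have hfa : AnalyticAt ℂ f z₀ := hf.analyticAt (hU.mem_nhds hz)
  have hga : AnalyticAt ℂ (fun z => f z - f z₀) z₀ := hfa.sub analyticAt_const
  have hfin : analyticOrderAt (fun z => f z - f z₀) z₀ ≠ ⊤ := by
    rw [Ne, analyticOrderAt_eq_top]
    intro h
    have h1 : ∀ᶠ z in 𝓝[≠] z₀, z = z₀ := by
      filter_upwards [mem_nhdsWithin_of_mem_nhds h,
        mem_nhdsWithin_of_mem_nhds (hU.mem_nhds hz)] with z h2 h3
      exact hinj h3 hz (sub_eq_zero.1 h2)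
    have h2 : ∀ᶠ z in 𝓝[≠] z₀, False := by
      filter_upwards [h1, self_mem_nhdsWithin] with z h3 h4 using h4 h3
    exact h2.exists.elim fun _ h => h
  obtain ⟨n, hn⟩ := ENat.ne_top_iff_exists.1 hfin
  obtain ⟨g, hg, hg0, hfg⟩ := (hga.analyticOrderAt_eq_natCast).1 hn.symm
  -- Order `0` contradicts the vanishing of `f - f z₀` at `z₀`; order `1` makes the derivative the
  -- nonzero number `g z₀`.
  have hn2 : 2 ≤ n := by
    by_contra hlt
    have : n = 0 ∨ n = 1 := by omega
    rcases this with rfl | rfl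
    · have := hfg.self_of_nhds
      simp at this
      exact hg0 this.symm
    · have h1 : HasDerivAt (fun z => (z - z₀) ^ 1 • g z) (g z₀) z₀ := by
        have := (((hasDerivAt_id z₀).sub_const z₀).pow 1).smul hg.differentiableAt.hasDerivAt
        convert! this using 1
        simp
      have h2 := h1.congr_of_eventuallyEq hfg
      have h3 : deriv f z₀ = g z₀ := by
        have := (h2.add_const (f z₀)).deriv
        simpa using this
      exact hg0 (h3 ▸ hd)
  have hn0 : n ≠ 0 := by omega
  obtain ⟨c, hc⟩ := IsAlgClosed.exists_pow_nat_eq (g z₀) (Nat.pos_of_ne_zero hn0)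
  have hc0 : c ≠ 0 := by
    rintro rfl
    rw [zero_pow hn0] at hc
    exact hg0 hc.symm
  -- A local `n`-th root of `g`: it turns `f - f z₀` into `F ^ n` with `F` a local biholomorphism at
  -- `z₀`.
  set h : ℂ → ℂ := fun z => c * Complex.exp (Complex.log (g z / g z₀) / n)
  have hn0' : (n : ℂ) ≠ 0 := by exact_mod_cast hn0
  have hpow : ∀ᶠ z in 𝓝 z₀, h z ^ n = g z := by
    filter_upwards [hg.continuousAt.eventually_ne hg0] with z hz
    simp only [h, mul_pow, hc, ← Complex.exp_nat_mul]
    rw [mul_div_cancel₀ _ hn0', Complex.exp_log (div_ne_zero hz hg0), mul_div_cancel₀ _ hg0]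
  have hha : AnalyticAt ℂ h z₀ := by
    refine analyticAt_const.mul (((hg.div_const).clog ?_).div_const).cexp
    simp [div_self hg0]
  have hh0 : h z₀ = c := by simp [h, div_self hg0]
  set F : ℂ → ℂ := fun z => (z - z₀) * h z
  have hFa : AnalyticAt ℂ F z₀ := (analyticAt_id.sub analyticAt_const).mul hha
  have hFd : deriv F z₀ = c := by
    have := (((hasDerivAt_id z₀).sub_const z₀).mul hha.differentiableAt.hasDerivAt).deriv
    simp at this
    rw [← hh0]
    convert! this using 1
  have hFstrict : HasStrictDerivAt F c z₀ := hFd ▸ hFa.hasStrictDerivAt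
  have hmap := hFstrict.map_nhds_eq hc0
  have hF0 : F z₀ = 0 := by simp [F]
  rw [hF0] at hmap
  have hgood : ∀ᶠ z in 𝓝 z₀, z ∈ U ∧ f z - f z₀ = F z ^ n := by
    filter_upwards [hU.mem_nhds hz, hpow, hfg] with z h1 h2 h3
    refine ⟨h1, ?_⟩
    rw [h3, mul_pow, h2, smul_eq_mul]
  have himg : F '' {z | z ∈ U ∧ f z - f z₀ = F z ^ n} ∈ 𝓝 (0 : ℂ) := by
    rw [← hmap]; exact image_mem_map hgood
  obtain ⟨ε, hε, hball⟩ := Metric.mem_nhds_iff.1 himg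
  -- The `F`-preimages of `ε/2` and `ω ε/2` are distinct but have equal `F ^ n`, against
  -- injectivity.
  obtain ⟨ω, hω⟩ : ∃ ω : ℂ, IsPrimitiveRoot ω n := ⟨_, Complex.isPrimitiveRoot_exp n hn0⟩
  have hωn : ‖ω‖ = 1 := hω.norm'_eq_one hn0
  have he : ‖((ε / 2 : ℝ) : ℂ)‖ = ε / 2 := by
    rw [Complex.norm_real, Real.norm_of_nonneg (by positivity)]
  obtain ⟨z₁, ⟨hz₁, e₁⟩, hz₁'⟩ := hball (show ((ε / 2 : ℝ) : ℂ) ∈ _ by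
    rw [mem_ball_zero_iff, he]; linarith)
  obtain ⟨z₂, ⟨hz₂, e₂⟩, hz₂'⟩ := hball (show ω * ((ε / 2 : ℝ) : ℂ) ∈ _ by
    rw [mem_ball_zero_iff, norm_mul, hωn, he]; linarith)
  have heq : f z₁ = f z₂ := by
    have : f z₁ - f z₀ = f z₂ - f z₀ := by
      rw [e₁, e₂, hz₁', hz₂', mul_pow, hω.pow_eq_one, one_mul]
    simpa using this
  have := hinj hz₁ hz₂ heq
  rw [this, hz₂'] at hz₁'
  have hε0 : ((ε / 2 : ℝ) : ℂ) ≠ 0 := by exact_mod_cast (by positivity : ε / 2 ≠ 0)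
  have hω1 : ω = 1 := by
    have := mul_right_cancel₀ hε0 (hz₁'.trans (one_mul _).symm)
    exact this
  exact hω.ne_one (by omega) hω1

/-! ### Rotations and root transforms in terms of the logarithm -/

/-- The conditions see `l` only on the disc, so it may be cut off outside. Global measurability is
what later makes the snowflake jointly measurable in the angles and the point. -/
theorem IsSigmaPrime.exists_measurable_isLogOf {φ : ℂ → ℂ} (hφ : IsSigmaPrime φ) :
    ∃ l b, IsLogOf φ l b ∧ Measurable l := by
  obtain ⟨l, b, h⟩ := hφ.exists_isLogOf
  have heq : EqOn ((Metric.ball (0 : ℂ) 1).indicator l) l (Metric.ball 0 1) :=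
    eqOn_indicator
  refine ⟨(Metric.ball (0 : ℂ) 1).indicator l, b, ⟨h.ne_zero, h.differentiableOn.congr heq,
    ?_, fun u hu => ?_, fun z hz => ?_, h.tendsto⟩, ?_⟩
  · rw [heq (by simp), h.map_zero]
  · rw [heq hu]; exact h.re_nonneg u hu
  · rw [heq (inv_mem_ball_of_mem_extDisk hz)]; exact h.eq_exp z hz
  · classical
    rw [← piecewise_eq_indicator]
    exact h.differentiableOn.continuousOn.measurable_piecewise continuousOn_const
      Metric.isOpen_ball.measurableSet

/-- Conjugating by a rotation only rotates the argument of the logarithm; the derivative at infinity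
is unchanged. -/
theorem IsLogOf.rot {φ l : ℂ → ℂ} {b : ℂ} (h : IsLogOf φ l b) (θ : UnitAddCircle) :
    IsLogOf (rot φ θ) (fun u => l ((AddCircle.toCircle θ : ℂ) * u)) b := by
  have hc : ‖(AddCircle.toCircle θ : ℂ)‖ = 1 := Circle.norm_coe _
  have hc0 : (AddCircle.toCircle θ : ℂ) ≠ 0 := Circle.coe_ne_zero _
  have hcc : (AddCircle.toCircle (-θ) : ℂ) = (AddCircle.toCircle θ : ℂ)⁻¹ := by
    rw [AddCircle.toCircle_neg, Circle.coe_inv]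
  have hball : ∀ u ∈ Metric.ball (0 : ℂ) 1,
      (AddCircle.toCircle θ : ℂ) * u ∈ Metric.ball (0 : ℂ) 1 := by
    intro u hu
    simpa [hc] using hu
  refine ⟨h.ne_zero, h.differentiableOn.comp (by fun_prop) hball, by simp [h.map_zero],
    fun u hu => h.re_nonneg _ (hball u hu), fun z hz => ?_, ?_⟩
  · have hz' : z * (AddCircle.toCircle (-θ) : ℂ) ∈ extDisk := by
      rw [extDisk, mem_ofPred_eq, norm_mul, Circle.norm_coe, mul_one]
      exact hz
    rw [Snowflake.rot, h.eq_exp _ hz', hcc, mul_inv, inv_inv, ← mul_assoc, ← mul_assoc,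
      mul_comm _ z, mul_assoc z, mul_inv_cancel₀ hc0, mul_one, mul_comm z⁻¹]
  · have h1 : Tendsto (fun z : ℂ => z * (AddCircle.toCircle (-θ) : ℂ)) (cobounded ℂ)
        (cobounded ℂ) := tendsto_mul_right_cobounded (Circle.coe_ne_zero _)
    refine (h.tendsto.comp h1).congr fun z => ?_
    simp only [Function.comp, Snowflake.rot, hcc]
    rw [div_mul_eq_div_div, div_inv_eq_mul, mul_comm, mul_div_assoc]

theorem mul_inv_pow_mem_ball {c z : ℂ} (hc : ‖c‖ = 1) (hz : z ∈ extDisk) {m : ℕ} (hm : 1 ≤ m) :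
    c * (z ^ m)⁻¹ ∈ Metric.ball (0 : ℂ) 1 := by
  rw [mem_ball_zero_iff, norm_mul, hc, one_mul, norm_inv, norm_pow]
  exact inv_lt_one_of_one_lt₀ (one_lt_pow₀ hz (by omega))

/-- The branch of the `m`-th root transform of a rotation by `c` of the map with logarithm `l`. -/
def rootMap (l : ℂ → ℂ) (m : ℕ) (c z : ℂ) : ℂ := z * Complex.exp (l (c * (z ^ m)⁻¹) / m)

theorem differentiableOn_rootMap {l : ℂ → ℂ} (hl : DifferentiableOn ℂ l (Metric.ball 0 1))
    {m : ℕ} (hm : 1 ≤ m) {c : ℂ} (hc : ‖c‖ = 1) : DifferentiableOn ℂ (rootMap l m c) extDisk := by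
  have h1 : DifferentiableOn ℂ (fun z : ℂ => c * (z ^ m)⁻¹) extDisk :=
    (DifferentiableOn.inv (by fun_prop)
      fun z hz => pow_ne_zero _ (extDisk_ne_zero hz)).const_mul c
  exact differentiableOn_id.mul
    ((hl.comp h1 fun z hz => mul_inv_pow_mem_ball hc hz hm).div_const _).cexp

theorem rootMap_pow {l : ℂ → ℂ} {m : ℕ} (hm : 1 ≤ m) (c z : ℂ) :
    rootMap l m c z ^ m = z ^ m * Complex.exp (l (c * (z ^ m)⁻¹)) := by
  have : (m : ℂ) ≠ 0 := by exact_mod_cast (by omega : m ≠ 0)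
  rw [rootMap, mul_pow, ← Complex.exp_nat_mul, mul_div_cancel₀ _ this]

/-- Root transforms compose: the transform of degree `m k` is a `k`-th root of the one of degree `m`
at `z ^ k`. This is the source of the self-similarity. -/
theorem rootMap_mul_pow {l : ℂ → ℂ} {m k : ℕ} (hk : 1 ≤ k) (c z : ℂ) :
    rootMap l (m * k) c z ^ k = rootMap l m c (z ^ k) := by
  have : (k : ℂ) ≠ 0 := by exact_mod_cast (by omega : k ≠ 0)
  rw [rootMap, rootMap, mul_pow, ← Complex.exp_nat_mul, ← pow_mul, mul_comm k m, Nat.cast_mul]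
  congr 2
  field_simp

/-- The explicit branch shows that the choice defining `rootTransform` has a witness. The quotient
of the chosen branch by the explicit one is continuous with values in the finite set of `m`-th roots
of unity, hence constant on the connected exterior, and the normalisation at infinity makes it `1`.
-/
theorem IsLogOf.rootTransform_eq {φ l : ℂ → ℂ} {b : ℂ} (h : IsLogOf φ l b) {m : ℕ} (hm : 1 ≤ m)
    {z : ℂ} (hz : z ∈ extDisk) : rootTransform m φ z = rootMap l m 1 z := by
  have hm0 : (m : ℂ) ≠ 0 := by exact_mod_cast (by omega : m ≠ 0)
  have hbp : b ^ (1 / (m : ℂ)) = Complex.exp (l 0 / m) := by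
    rw [Complex.cpow_def_of_ne_zero h.ne_zero, h.map_zero, mul_one_div]
  have hderiv : derivInfty φ = b := h.tendsto.limUnder_eq
  have hext : ∀ᶠ z : ℂ in cobounded ℂ, z ∈ extDisk := by
    have := tendsto_norm_cobounded_atTop (E := ℂ)
    exact this.eventually (eventually_gt_atTop 1)
  have hball : Metric.ball (0 : ℂ) 1 ∈ 𝓝 (0 : ℂ) := Metric.ball_mem_nhds _ one_pos
  have hlim : Tendsto (fun z : ℂ => rootMap l m 1 z / z) (cobounded ℂ)
      (𝓝 (b ^ (1 / (m : ℂ)))) := by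
    rw [hbp]
    have h1 : Tendsto (fun z : ℂ => 1 * (z ^ m)⁻¹) (cobounded ℂ) (𝓝 0) := by
      simp only [one_mul, ← inv_pow]
      simpa [zero_pow (by omega : m ≠ 0)] using (tendsto_inv₀_cobounded (α := ℂ)).pow m
    have h2 : Tendsto (fun z : ℂ => Complex.exp (l (1 * (z ^ m)⁻¹) / m)) (cobounded ℂ)
        (𝓝 (Complex.exp (l 0 / m))) :=
      Complex.continuous_exp.continuousAt.tendsto.comp
        (((h.differentiableOn.continuousOn.continuousAt hball).tendsto.comp h1).div_const _)
    refine h2.congr' ?_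
    filter_upwards [hext] with z hz
    rw [rootMap, mul_div_cancel_left₀ _ (extDisk_ne_zero hz)]
  have hex : ∃ h : ℂ → ℂ, DifferentiableOn ℂ h extDisk ∧
      (∀ z ∈ extDisk, h z ^ m = φ (z ^ m)) ∧
      Tendsto (fun z : ℂ => h z / z) (cobounded ℂ) (𝓝 (derivInfty φ ^ (1 / (m : ℂ)))) := by
    refine ⟨rootMap l m 1, differentiableOn_rootMap h.differentiableOn hm (by simp),
      fun z hz => ?_, by rw [hderiv]; exact hlim⟩
    have hzm : z ^ m ∈ extDisk := by
      rw [extDisk, mem_ofPred_eq, norm_pow]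
      exact one_lt_pow₀ hz (by omega)
    rw [rootMap_pow hm, one_mul, h.eq_exp _ hzm]
  obtain ⟨h1, h2, h3⟩ := Classical.epsilon_spec hex
  change DifferentiableOn ℂ (rootTransform m φ) extDisk at h1
  change ∀ z ∈ extDisk, rootTransform m φ z ^ m = φ (z ^ m) at h2
  change Tendsto (fun z : ℂ => rootTransform m φ z / z) _ _ at h3
  have hne : ∀ z ∈ extDisk, rootMap l m 1 z ≠ 0 := fun z hz =>
    mul_ne_zero (extDisk_ne_zero hz) (Complex.exp_ne_zero _)
  have hpow : ∀ z ∈ extDisk, (rootTransform m φ z / rootMap l m 1 z) ^ m = 1 := by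
    intro z hz
    have hzm : z ^ m ∈ extDisk := by
      rw [extDisk, mem_ofPred_eq, norm_pow]
      exact one_lt_pow₀ hz (by omega)
    have hh := rootMap_pow (l := l) hm 1 z
    rw [div_pow, h2 z hz, hh, one_mul, h.eq_exp _ hzm, div_self]
    exact mul_ne_zero (pow_ne_zero _ (extDisk_ne_zero hz)) (Complex.exp_ne_zero _)
  have hT : ({w : ℂ | w ^ m = 1}).Finite := by
    refine (Polynomial.nthRoots m (1 : ℂ)).toFinset.finite_toSet.subset fun w hw => ?_
    simpa [Polynomial.mem_nthRoots (by omega : 0 < m)] using hw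
  have hcont : ContinuousOn (fun z => rootTransform m φ z / rootMap l m 1 z) extDisk :=
    h1.continuousOn.div
      (differentiableOn_rootMap h.differentiableOn hm (by simp)).continuousOn hne
  have hratio : Tendsto (fun z : ℂ => rootTransform m φ z / rootMap l m 1 z) (cobounded ℂ)
      (𝓝 1) := by
    rw [hderiv] at h3
    have hb0 : b ^ (1 / (m : ℂ)) ≠ 0 := by rw [hbp]; exact Complex.exp_ne_zero _
    have := h3.div hlim hb0
    rw [div_self hb0] at this
    refine this.congr' ?_
    filter_upwards [hext] with z hz
    exact div_div_div_cancel_right₀ (extDisk_ne_zero hz) _ _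
  have hconst : ∀ w ∈ extDisk, rootTransform m φ w / rootMap l m 1 w =
      rootTransform m φ z / rootMap l m 1 z := fun w hw =>
    isPreconnected_extDisk.constant_of_mapsTo hT.isDiscrete hcont (fun z hz => hpow z hz) hw hz
  have h1 : rootTransform m φ z / rootMap l m 1 z = 1 := by
    refine tendsto_nhds_unique (tendsto_const_nhds.congr' ?_) hratio
    filter_upwards [hext] with w hw using (hconst w hw).symm
  exact (div_eq_one_iff_eq (hne z hz)).1 h1

theorem IsLogOf.rootTransform_rot_eq {φ l : ℂ → ℂ} {b : ℂ} (h : IsLogOf φ l b) {m : ℕ}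
    (hm : 1 ≤ m) (θ : UnitAddCircle) {z : ℂ} (hz : z ∈ extDisk) :
    rootTransform m (Snowflake.rot φ θ) z = rootMap l m (AddCircle.toCircle θ) z := by
  rw [(h.rot θ).rootTransform_eq hm hz, rootMap, rootMap, one_mul]

theorem IsLogOf.rot_eq {φ l : ℂ → ℂ} {b : ℂ} (h : IsLogOf φ l b) (θ : UnitAddCircle) {z : ℂ}
    (hz : z ∈ extDisk) : Snowflake.rot φ θ z = rootMap l 1 (AddCircle.toCircle θ) z := by
  rw [(h.rot θ).eq_exp z hz, rootMap, pow_one, Nat.cast_one, div_one]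

/-! ### Compositions of root transforms -/

/-- Compositions of root transforms of degrees `m, m k, m k², …`. -/
def rootComp (l : ℂ → ℂ) (k : ℕ) (c : ℕ → ℂ) (m : ℕ) : ℕ → ℂ → ℂ
  | 0 => rootMap l m (c 0)
  | n + 1 => rootComp l k c m n ∘ rootMap l (m * k ^ (n + 1)) (c (n + 1))

/-- The limit of the compositions of root transforms. -/
def rootLim (l : ℂ → ℂ) (k : ℕ) (c : ℕ → ℂ) (m : ℕ) (z : ℂ) : ℂ :=
  limUnder atTop fun n => rootComp l k c m n z

theorem norm_rootMap {l : ℂ → ℂ} (m : ℕ) (c z : ℂ) :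
    ‖rootMap l m c z‖ = ‖z‖ * Real.exp ((l (c * (z ^ m)⁻¹)).re / m) := by
  rw [rootMap, norm_mul, Complex.norm_exp, Complex.div_natCast_re]

theorem le_norm_rootMap {l : ℂ → ℂ} (hl : ∀ u ∈ Metric.ball (0 : ℂ) 1, 0 ≤ (l u).re) {m : ℕ}
    (hm : 1 ≤ m) {c : ℂ} (hc : ‖c‖ = 1) {z : ℂ} (hz : z ∈ extDisk) :
    ‖z‖ ≤ ‖rootMap l m c z‖ := by
  rw [norm_rootMap]
  refine le_mul_of_one_le_right (norm_nonneg _) (Real.one_le_exp ?_)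
  exact div_nonneg (hl _ (mul_inv_pow_mem_ball hc hz hm)) (Nat.cast_nonneg _)

theorem rootMap_mapsTo {l : ℂ → ℂ} (hl : ∀ u ∈ Metric.ball (0 : ℂ) 1, 0 ≤ (l u).re) {m : ℕ}
    (hm : 1 ≤ m) {c : ℂ} (hc : ‖c‖ = 1) : MapsTo (rootMap l m c) extDisk extDisk :=
  fun _ hz => lt_of_lt_of_le hz (le_norm_rootMap hl hm hc hz)

theorem exists_norm_le_of_differentiableOn_ball {l : ℂ → ℂ}
    (hl : DifferentiableOn ℂ l (Metric.ball 0 1)) {ρ : ℝ} (hρ : 1 < ρ) :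
    ∃ B : ℝ, 0 ≤ B ∧ ∀ u : ℂ, ‖u‖ ≤ ρ⁻¹ → ‖l u‖ ≤ B := by
  have hsub : Metric.closedBall (0 : ℂ) ρ⁻¹ ⊆ Metric.ball 0 1 :=
    Metric.closedBall_subset_ball (inv_lt_one_of_one_lt₀ hρ)
  obtain ⟨B, hB⟩ := (isCompact_closedBall (0 : ℂ) ρ⁻¹).exists_bound_of_continuousOn
    (hl.continuousOn.mono hsub)
  exact ⟨max B 0, le_max_right _ _,
    fun u hu => (hB u (by simpa using hu)).trans (le_max_left _ _)⟩

theorem norm_mul_inv_pow_le {c z : ℂ} (hc : ‖c‖ = 1) {ρ : ℝ} (hρ : 1 < ρ) (hz : ρ ≤ ‖z‖) {m : ℕ}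
    (hm : 1 ≤ m) : ‖c * (z ^ m)⁻¹‖ ≤ ρ⁻¹ := by
  rw [norm_mul, hc, one_mul, norm_inv, norm_pow]
  exact inv_anti₀ (by linarith) (hz.trans (le_self_pow₀ (hρ.le.trans hz) (by omega)))

theorem norm_rootMap_le {l : ℂ → ℂ} {ρ B : ℝ} (hρ : 1 < ρ)
    (hB : ∀ u : ℂ, ‖u‖ ≤ ρ⁻¹ → ‖l u‖ ≤ B) {m : ℕ} (hm : 1 ≤ m) {c : ℂ} (hc : ‖c‖ = 1) {z : ℂ}
    (hz : ρ ≤ ‖z‖) : ‖rootMap l m c z‖ ≤ ‖z‖ * Real.exp (B / m) := by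
  rw [norm_rootMap]
  have := (Complex.re_le_norm _).trans (hB _ (norm_mul_inv_pow_le hc hρ hz hm))
  gcongr

/-- The exponent in `rootMap` is `O(1/m)`, so a transform of high degree is close to the identity;
this drives the geometric convergence of the compositions. -/
theorem norm_rootMap_sub_le {l : ℂ → ℂ} {ρ B : ℝ} (hρ : 1 < ρ) (hB0 : 0 ≤ B)
    (hB : ∀ u : ℂ, ‖u‖ ≤ ρ⁻¹ → ‖l u‖ ≤ B) {m : ℕ} (hm : 1 ≤ m) {c : ℂ} (hc : ‖c‖ = 1) {z : ℂ}
    (hz : ρ ≤ ‖z‖) : ‖rootMap l m c z - z‖ ≤ ‖z‖ * (B * Real.exp B) / m := by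
  have h1 := hB _ (norm_mul_inv_pow_le hc hρ hz hm)
  have hm' : (1 : ℝ) ≤ m := by exact_mod_cast hm
  set w := l (c * (z ^ m)⁻¹) / (m : ℂ) with hw
  have h2 : ‖w‖ ≤ B / m := by
    rw [hw, norm_div, Complex.norm_natCast]
    gcongr
  have h3 : ‖w‖ ≤ B := h2.trans (div_le_self hB0 hm')
  have h4 := Complex.norm_exp_sub_sum_le_norm_mul_exp w 1
  simp only [Finset.range_one, Finset.sum_singleton, pow_zero, Nat.factorial_zero, Nat.cast_one,
    div_one, pow_one] at h4
  have h5 : rootMap l m c z - z = z * (Complex.exp w - 1) := by rw [rootMap]; ring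
  rw [h5, norm_mul, mul_div_assoc]
  refine mul_le_mul_of_nonneg_left (h4.trans ?_) (norm_nonneg _)
  rw [mul_div_right_comm]
  exact mul_le_mul h2 (Real.exp_le_exp.2 h3) (Real.exp_nonneg _) (by positivity)

theorem inv_mul_pow_le {m k : ℕ} (hm : 1 ≤ m) (hk : 2 ≤ k) (n : ℕ) :
    ((m * k ^ n : ℕ) : ℝ)⁻¹ ≤ (2 ^ n)⁻¹ := by
  refine inv_anti₀ (by positivity) ?_
  have : 2 ^ n ≤ m * k ^ n := by
    calc 2 ^ n ≤ k ^ n := Nat.pow_le_pow_left hk n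
      _ ≤ m * k ^ n := Nat.le_mul_of_pos_left _ hm
  exact_mod_cast this

theorem one_le_mul_pow {m k : ℕ} (hm : 1 ≤ m) (hk : 2 ≤ k) (n : ℕ) : 1 ≤ m * k ^ n :=
  Nat.one_le_iff_ne_zero.2 (Nat.mul_ne_zero (by omega) (pow_ne_zero _ (by omega)))

section

variable {l : ℂ → ℂ} {k m : ℕ} {c : ℕ → ℂ}

theorem differentiableOn_rootComp (hl : DifferentiableOn ℂ l (Metric.ball 0 1))
    (hre : ∀ u ∈ Metric.ball (0 : ℂ) 1, 0 ≤ (l u).re) (hk : 2 ≤ k) (hm : 1 ≤ m)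
    (hc : ∀ n, ‖c n‖ = 1) (n : ℕ) : DifferentiableOn ℂ (rootComp l k c m n) extDisk := by
  induction n with
  | zero => exact differentiableOn_rootMap hl hm (hc 0)
  | succ n ih =>
    exact ih.comp (differentiableOn_rootMap hl (one_le_mul_pow hm hk _) (hc _))
      (rootMap_mapsTo hre (one_le_mul_pow hm hk _) (hc _))

theorem le_norm_rootComp (hre : ∀ u ∈ Metric.ball (0 : ℂ) 1, 0 ≤ (l u).re) (hk : 2 ≤ k)
    (hm : 1 ≤ m) (hc : ∀ n, ‖c n‖ = 1) (n : ℕ) {z : ℂ} (hz : z ∈ extDisk) :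
    ‖z‖ ≤ ‖rootComp l k c m n z‖ := by
  induction n generalizing z with
  | zero => exact le_norm_rootMap hre hm (hc 0) hz
  | succ n ih =>
    exact (le_norm_rootMap hre (one_le_mul_pow hm hk _) (hc _) hz).trans
      (ih (rootMap_mapsTo hre (one_le_mul_pow hm hk _) (hc _) hz))

/-- The factor of index `j` stretches by at most `exp (B / 2 ^ j)`, and `2 - 2⁻ⁿ` is the sum of
`2⁻ʲ` for `j ≤ n`. -/
theorem norm_rootComp_le (hre : ∀ u ∈ Metric.ball (0 : ℂ) 1, 0 ≤ (l u).re) (hk : 2 ≤ k)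
    (hm : 1 ≤ m) (hc : ∀ n, ‖c n‖ = 1) {ρ B : ℝ} (hρ : 1 < ρ) (hB0 : 0 ≤ B)
    (hB : ∀ u : ℂ, ‖u‖ ≤ ρ⁻¹ → ‖l u‖ ≤ B) (n : ℕ) {z : ℂ} (hz : ρ ≤ ‖z‖) :
    ‖rootComp l k c m n z‖ ≤ ‖z‖ * Real.exp (B * (2 - (2 ^ n)⁻¹)) := by
  induction n generalizing z with
  | zero =>
    refine (norm_rootMap_le hρ hB hm (hc 0) hz).trans ?_
    have : B / m ≤ B * (2 - (2 ^ 0)⁻¹) := by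
      norm_num
      exact div_le_self hB0 (by exact_mod_cast hm)
    gcongr
  | succ n ih =>
    have hM := one_le_mul_pow hm hk (n + 1)
    have hz1 : z ∈ extDisk := lt_of_lt_of_le hρ hz
    refine (ih (hz.trans (le_norm_rootMap hre hM (hc (n + 1)) hz1))).trans ?_
    refine (mul_le_mul_of_nonneg_right (norm_rootMap_le hρ hB hM (hc (n + 1)) hz)
      (Real.exp_nonneg _)).trans ?_
    rw [mul_assoc, ← Real.exp_add]
    have h1 := mul_le_mul_of_nonneg_left (inv_mul_pow_le hm hk (n + 1)) hB0
    rw [← div_eq_mul_inv] at h1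
    have h2 : ((2 : ℝ) ^ n)⁻¹ = 2 * (2 ^ (n + 1))⁻¹ := by
      rw [pow_succ]; field_simp
    have h3 : B / ((m * k ^ (n + 1) : ℕ) : ℝ) + B * (2 - (2 ^ n)⁻¹) ≤
        B * (2 - (2 ^ (n + 1))⁻¹) := by
      rw [h2]; linarith
    gcongr

theorem norm_rootComp_le_two (hre : ∀ u ∈ Metric.ball (0 : ℂ) 1, 0 ≤ (l u).re) (hk : 2 ≤ k)
    (hm : 1 ≤ m) (hc : ∀ n, ‖c n‖ = 1) {ρ B : ℝ} (hρ : 1 < ρ) (hB0 : 0 ≤ B)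
    (hB : ∀ u : ℂ, ‖u‖ ≤ ρ⁻¹ → ‖l u‖ ≤ B) (n : ℕ) {z : ℂ} (hz : ρ ≤ ‖z‖) :
    ‖rootComp l k c m n z‖ ≤ ‖z‖ * Real.exp (B * 2) := by
  refine (norm_rootComp_le hre hk hm hc hρ hB0 hB n hz).trans ?_
  have : (0 : ℝ) ≤ (2 ^ n)⁻¹ := by positivity
  gcongr
  linarith

/-- The new innermost factor moves `z` by `O(2⁻ⁿ)`, and the earlier composition is Lipschitz near
`z` by a Schwarz estimate on a disc where it is uniformly bounded. The constant depends on neither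
the degree nor the rotations. -/
theorem exists_dist_rootComp_le (hl : DifferentiableOn ℂ l (Metric.ball 0 1))
    (hre : ∀ u ∈ Metric.ball (0 : ℂ) 1, 0 ≤ (l u).re) (hk : 2 ≤ k) {ρ : ℝ} (hρ : 1 < ρ) (M : ℝ) :
    ∃ C : ℝ, ∀ m : ℕ, 1 ≤ m → ∀ c : ℕ → ℂ, (∀ n, ‖c n‖ = 1) → ∀ z : ℂ, ρ ≤ ‖z‖ → ‖z‖ ≤ M →
      ∀ n, dist (rootComp l k c m n z) (rootComp l k c m (n + 1) z) ≤ C / 2 / 2 ^ n := by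
  -- Halfway to the unit circle, so that the disc of radius `ρ - σ` about `z` stays in `‖w‖ ≥ σ >
  -- 1`.
  set σ := (1 + ρ) / 2 with hσ
  have hσ1 : 1 < σ := by rw [hσ]; linarith
  set d := ρ - σ with hd
  have hd0 : 0 < d := by rw [hd, hσ]; linarith
  obtain ⟨B, hB0, hB⟩ := exists_norm_le_of_differentiableOn_ball hl hσ1
  set A := (M + d) * Real.exp (B * 2) with hA
  refine ⟨2 * A / d * (M * (B * Real.exp B)), fun m hm c hc z hz hzM n => ?_⟩
  have hM0 : 0 ≤ M := (norm_nonneg z).trans hzM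
  have hA0 : 0 ≤ A := by positivity
  have hMn := one_le_mul_pow hm hk (n + 1)
  have hball : ∀ w ∈ Metric.ball z d, σ ≤ ‖w‖ ∧ ‖w‖ ≤ M + d := by
    intro w hw
    rw [Metric.mem_ball, dist_eq_norm] at hw
    have h1 := norm_sub_norm_le z w
    have h2 := norm_sub_norm_le w z
    rw [norm_sub_rev] at h1
    constructor <;> linarith
  have hbd : ∀ w ∈ Metric.ball z d, ‖rootComp l k c m n w‖ ≤ A := by
    intro w hw
    refine (norm_rootComp_le_two hre hk hm hc hσ1 hB0 hB n (hball w hw).1).trans ?_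
    exact mul_le_mul_of_nonneg_right (hball w hw).2 (Real.exp_nonneg _)
  have hzz : z ∈ Metric.ball z d := Metric.mem_ball_self hd0
  set w := rootMap l (m * k ^ (n + 1)) (c (n + 1)) z with hw
  have hcomp : rootComp l k c m (n + 1) z = rootComp l k c m n w := rfl
  have hwz : dist w z ≤ M * (B * Real.exp B) * (2 ^ (n + 1))⁻¹ := by
    rw [dist_eq_norm]
    refine (norm_rootMap_sub_le hσ1 hB0 hB hMn (hc _) (hball z hzz).1).trans ?_
    rw [div_eq_mul_inv]
    exact mul_le_mul (mul_le_mul_of_nonneg_right hzM (by positivity))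
      (inv_mul_pow_le hm hk (n + 1)) (by positivity) (by positivity)
  have hkey : dist (rootComp l k c m n z) (rootComp l k c m (n + 1) z) ≤
      2 * A / d * dist w z := by
    rw [dist_comm, hcomp]
    by_cases hwb : w ∈ Metric.ball z d
    · refine Complex.dist_le_div_mul_dist_of_mapsTo_ball
        ((differentiableOn_rootComp hl hre hk hm hc n).mono
          fun v hv => lt_of_lt_of_le hσ1 (hball v hv).1) (fun v hv => ?_) hwb
      rw [Metric.mem_closedBall]
      refine (dist_le_norm_add_norm _ _).trans ?_
      linarith [hbd v hv, hbd z hzz]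
    -- If the displaced point leaves the disc, the trivial bound `2 A` is already at most `(2 A / d)
    -- * dist w z`.
    · rw [Metric.mem_ball, not_lt] at hwb
      have h1 : dist (rootComp l k c m n w) (rootComp l k c m n z) ≤ 2 * A := by
        refine (dist_le_norm_add_norm _ _).trans ?_
        have h2 : ‖rootComp l k c m (n + 1) z‖ ≤ A :=
          (norm_rootComp_le_two hre hk hm hc hσ1 hB0 hB (n + 1) (hball z hzz).1).trans
            (mul_le_mul_of_nonneg_right (hball z hzz).2 (Real.exp_nonneg _))
        rw [hcomp] at h2
        linarith [hbd z hzz]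
      refine h1.trans ?_
      rw [div_mul_eq_mul_div, le_div_iff₀ hd0]
      exact mul_le_mul_of_nonneg_left hwb (by positivity)
  refine hkey.trans ((mul_le_mul_of_nonneg_left hwz (by positivity)).trans_eq ?_)
  rw [pow_succ]
  field_simp

theorem tendsto_rootComp (hl : DifferentiableOn ℂ l (Metric.ball 0 1))
    (hre : ∀ u ∈ Metric.ball (0 : ℂ) 1, 0 ≤ (l u).re) (hk : 2 ≤ k) (hm : 1 ≤ m)
    (hc : ∀ n, ‖c n‖ = 1) {z : ℂ} (hz : z ∈ extDisk) :
    Tendsto (fun n => rootComp l k c m n z) atTop (𝓝 (rootLim l k c m z)) := by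
  obtain ⟨C, hC⟩ := exists_dist_rootComp_le hl hre hk (ρ := ‖z‖) hz ‖z‖
  exact (cauchySeq_of_le_geometric_two (hC m hm c hc z le_rfl le_rfl)).tendsto_limUnder

theorem tendstoLocallyUniformlyOn_rootComp (hl : DifferentiableOn ℂ l (Metric.ball 0 1))
    (hre : ∀ u ∈ Metric.ball (0 : ℂ) 1, 0 ≤ (l u).re) (hk : 2 ≤ k) (hm : 1 ≤ m)
    (hc : ∀ n, ‖c n‖ = 1) :
    TendstoLocallyUniformlyOn (rootComp l k c m) (rootLim l k c m) atTop extDisk := by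
  rw [Metric.tendstoLocallyUniformlyOn_iff]
  intro ε hε z hz
  set ρ := (1 + ‖z‖) / 2
  have hz1 : 1 < ‖z‖ := hz
  obtain ⟨C, hC⟩ := exists_dist_rootComp_le hl hre hk (ρ := ρ) (by simp only [ρ]; linarith)
    (‖z‖ + 1)
  refine ⟨{w | ρ < ‖w‖ ∧ ‖w‖ < ‖z‖ + 1}, mem_nhdsWithin_of_mem_nhds
    (((isOpen_lt continuous_const continuous_norm).inter
      (isOpen_lt continuous_norm continuous_const)).mem_nhds ⟨?_, ?_⟩), ?_⟩
  · simp only [mem_ofPred_eq, ρ]; linarith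
  · simp
  have ht : Tendsto (fun n : ℕ => C / 2 ^ n) atTop (𝓝 0) := by
    have := (tendsto_pow_atTop_nhds_zero_of_lt_one (r := (2 : ℝ)⁻¹) (by norm_num)
      (by norm_num)).const_mul C
    simpa [div_eq_mul_inv] using this
  filter_upwards [ht.eventually_lt_const hε] with n hn w hw
  have hw1 : w ∈ extDisk := by
    refine lt_trans ?_ hw.1
    simp only [ρ]; linarith
  rw [dist_comm]
  exact (dist_le_of_le_geometric_two_of_tendsto (hC m hm c hc w hw.1.le hw.2.le)
    (tendsto_rootComp hl hre hk hm hc hw1) n).trans_lt hn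

theorem differentiableOn_rootLim (hl : DifferentiableOn ℂ l (Metric.ball 0 1))
    (hre : ∀ u ∈ Metric.ball (0 : ℂ) 1, 0 ≤ (l u).re) (hk : 2 ≤ k) (hm : 1 ≤ m)
    (hc : ∀ n, ‖c n‖ = 1) : DifferentiableOn ℂ (rootLim l k c m) extDisk :=
  (tendstoLocallyUniformlyOn_rootComp hl hre hk hm hc).differentiableOn
    (Eventually.of_forall fun n => differentiableOn_rootComp hl hre hk hm hc n) isOpen_extDisk

theorem le_norm_rootLim (hl : DifferentiableOn ℂ l (Metric.ball 0 1))
    (hre : ∀ u ∈ Metric.ball (0 : ℂ) 1, 0 ≤ (l u).re) (hk : 2 ≤ k) (hm : 1 ≤ m)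
    (hc : ∀ n, ‖c n‖ = 1) {z : ℂ} (hz : z ∈ extDisk) : ‖z‖ ≤ ‖rootLim l k c m z‖ :=
  ge_of_tendsto (tendsto_rootComp hl hre hk hm hc hz).norm
    (Eventually.of_forall fun n => le_norm_rootComp hre hk hm hc n hz)

theorem exists_norm_rootLim_le (hl : DifferentiableOn ℂ l (Metric.ball 0 1))
    (hre : ∀ u ∈ Metric.ball (0 : ℂ) 1, 0 ≤ (l u).re) (hk : 2 ≤ k) (hm : 1 ≤ m) {ρ : ℝ}
    (hρ : 1 < ρ) : ∃ A : ℝ, ∀ c : ℕ → ℂ, (∀ n, ‖c n‖ = 1) → ∀ z : ℂ, ρ ≤ ‖z‖ →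
      ‖rootLim l k c m z‖ ≤ ‖z‖ * A := by
  obtain ⟨B, hB0, hB⟩ := exists_norm_le_of_differentiableOn_ball hl hρ
  refine ⟨Real.exp (B * 2), fun c hc z hz => ?_⟩
  exact le_of_tendsto (tendsto_rootComp hl hre hk hm hc (lt_of_lt_of_le hρ hz)).norm
    (Eventually.of_forall fun n => norm_rootComp_le_two hre hk hm hc hρ hB0 hB n hz)

/-- The recursive definition adds innermost factors, whereas the averaging acts on the outermost
one; here that one is peeled off, leaving shifted rotations and degrees starting at `m * k`. -/
theorem rootComp_succ_eq (n : ℕ) (z : ℂ) : rootComp l k c m (n + 1) z =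
    rootMap l m (c 0) (rootComp l k (fun i => c (i + 1)) (m * k) n z) := by
  induction n generalizing z with
  | zero => simp [rootComp]
  | succ n ih =>
    have h1 : rootComp l k c m (n + 1 + 1) z =
      rootComp l k c m (n + 1) (rootMap l (m * k ^ (n + 2)) (c (n + 2)) z) := rfl
    rw [h1, ih]
    simp only [rootComp, Function.comp]
    rw [mul_assoc m k, ← pow_succ']

theorem rootComp_mul_pow (hk : 1 ≤ k) (n : ℕ) (z : ℂ) :
    rootComp l k c (m * k) n z ^ k = rootComp l k c m n (z ^ k) := by
  induction n generalizing z with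
  | zero => exact rootMap_mul_pow hk _ _
  | succ n ih =>
    simp only [rootComp, Function.comp]
    rw [ih, mul_right_comm, rootMap_mul_pow hk]

theorem rootLim_eq (hl : DifferentiableOn ℂ l (Metric.ball 0 1))
    (hre : ∀ u ∈ Metric.ball (0 : ℂ) 1, 0 ≤ (l u).re) (hk : 2 ≤ k) (hm : 1 ≤ m)
    (hc : ∀ n, ‖c n‖ = 1) {z : ℂ} (hz : z ∈ extDisk) :
    rootLim l k c m z =
      rootMap l m (c 0) (rootLim l k (fun i => c (i + 1)) (m * k) z) := by
  have hmk : 1 ≤ m * k := Nat.mul_pos hm (by omega)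
  have h1 := (tendsto_rootComp hl hre hk hm hc hz).comp (tendsto_add_atTop_nat 1)
  have h2 := tendsto_rootComp hl hre hk hmk (fun n => hc (n + 1)) hz
  have h3 : rootLim l k (fun i => c (i + 1)) (m * k) z ∈ extDisk :=
    lt_of_lt_of_le hz (le_norm_rootLim hl hre hk hmk (fun n => hc (n + 1)) hz)
  have h4 := ((differentiableOn_rootMap hl hm (hc 0)).continuousOn.continuousAt
    (isOpen_extDisk.mem_nhds h3)).tendsto.comp h2
  refine tendsto_nhds_unique h1 (h4.congr fun n => ?_)
  exact (rootComp_succ_eq n z).symm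

/-- Together with `rootLim_eq` this is the self-similarity: after removal of the outer block, the
rest is a `k`-th root of a limit of the original type. -/
theorem rootLim_mul_pow (hl : DifferentiableOn ℂ l (Metric.ball 0 1))
    (hre : ∀ u ∈ Metric.ball (0 : ℂ) 1, 0 ≤ (l u).re) (hk : 2 ≤ k) (hm : 1 ≤ m)
    (hc : ∀ n, ‖c n‖ = 1) {z : ℂ} (hz : z ∈ extDisk) :
    rootLim l k c (m * k) z ^ k = rootLim l k c m (z ^ k) := by
  have hmk : 1 ≤ m * k := Nat.mul_pos hm (by omega)
  have hzk : z ^ k ∈ extDisk := by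
    rw [extDisk, mem_ofPred_eq, norm_pow]
    exact one_lt_pow₀ hz (by omega)
  refine tendsto_nhds_unique ((tendsto_rootComp hl hre hk hmk hc hz).pow k)
    ((tendsto_rootComp hl hre hk hm hc hzk).congr fun n => ?_)
  exact (rootComp_mul_pow (by omega) n z).symm

end

/-! ### The snowflake as a limit -/

/-- The rotations as a sequence of unimodular numbers. -/
def rotSeq (θ : ℕ → UnitAddCircle) (n : ℕ) : ℂ := AddCircle.toCircle (θ n)

theorem norm_rotSeq (θ : ℕ → UnitAddCircle) (n : ℕ) : ‖rotSeq θ n‖ = 1 := Circle.norm_coe _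

theorem IsLogOf.snowflakeApprox_eq {φ l : ℂ → ℂ} {b : ℂ} (h : IsLogOf φ l b) {k : ℕ}
    (hk : 2 ≤ k) (θ : ℕ → UnitAddCircle) (n : ℕ) {z : ℂ} (hz : z ∈ extDisk) :
    snowflakeApprox φ k θ n z = rootComp l k (rotSeq θ) 1 n z := by
  induction n generalizing z with
  | zero => exact h.rot_eq _ hz
  | succ n ih =>
    have hkn : 1 ≤ k ^ (n + 1) := Nat.one_le_iff_ne_zero.2 (pow_ne_zero _ (by omega))
    simp only [snowflakeApprox, rootComp, Function.comp, one_mul]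
    rw [h.rootTransform_rot_eq hkn _ hz]
    exact ih (rootMap_mapsTo h.re_nonneg hkn (norm_rotSeq θ (n + 1)) hz)

theorem IsLogOf.snowflake_eq {φ l : ℂ → ℂ} {b : ℂ} (h : IsLogOf φ l b) {k : ℕ} (hk : 2 ≤ k)
    (θ : ℕ → UnitAddCircle) {z : ℂ} (hz : z ∈ extDisk) :
    snowflake φ k θ z = rootLim l k (rotSeq θ) 1 z := by
  simp only [snowflake, rootLim, h.snowflakeApprox_eq hk θ _ hz]

/-! ### Measurability -/

theorem measurable_rotSeq : Measurable rotSeq := by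
  refine measurable_pi_lambda _ fun n => ?_
  exact (continuous_subtype_val.comp AddCircle.continuous_toCircle).measurable.comp
    (measurable_pi_apply n)

theorem measurable_rootMap {l : ℂ → ℂ} (hl : Measurable l) (m : ℕ) :
    Measurable fun p : ℂ × ℂ => rootMap l m p.1 p.2 := by
  unfold rootMap
  fun_prop

theorem measurable_rootComp {l : ℂ → ℂ} (hl : Measurable l) (k m n : ℕ) :
    Measurable fun p : (ℕ → ℂ) × ℂ => rootComp l k p.1 m n p.2 := by
  induction n with
  | zero =>
    have h : Measurable fun p : (ℕ → ℂ) × ℂ => (p.1 0, p.2) :=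
      ((measurable_pi_apply 0).comp measurable_fst).prodMk measurable_snd
    exact (measurable_rootMap hl m).comp h
  | succ n ih =>
    have h : Measurable fun p : (ℕ → ℂ) × ℂ => (p.1 (n + 1), p.2) :=
      ((measurable_pi_apply (n + 1)).comp measurable_fst).prodMk measurable_snd
    exact ih.comp (measurable_fst.prodMk ((measurable_rootMap hl _).comp h))

theorem measurable_rootLim {l : ℂ → ℂ} (hl : Measurable l) (k m : ℕ) :
    Measurable fun p : (ℕ → UnitAddCircle) × ℂ => rootLim l k (rotSeq p.1) m p.2 := by
  refine (StronglyMeasurable.limUnder fun n => ?_).measurable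
  exact ((measurable_rootComp hl k m n).comp
    ((measurable_rotSeq.comp measurable_fst).prodMk measurable_snd)).stronglyMeasurable

/-- A jointly measurable version of the derivative of the limit. -/
def rootLimDeriv (l : ℂ → ℂ) (k m : ℕ) (θ : ℕ → UnitAddCircle) (z : ℂ) : ℂ :=
  limUnder atTop fun n : ℕ => ((n : ℂ) + 1) *
    (rootLim l k (rotSeq θ) m (z + ((n : ℂ) + 1)⁻¹) - rootLim l k (rotSeq θ) m z)

theorem measurable_rootLimDeriv {l : ℂ → ℂ} (hl : Measurable l) (k m : ℕ) :
    Measurable fun p : (ℕ → UnitAddCircle) × ℂ => rootLimDeriv l k m p.1 p.2 := by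
  refine (StronglyMeasurable.limUnder fun n => Measurable.stronglyMeasurable ?_).measurable
  exact (((measurable_rootLim hl k m).comp
    (measurable_fst.prodMk (measurable_snd.add_const _))).sub
    (measurable_rootLim hl k m)).const_mul _

theorem rootLimDeriv_eq {l : ℂ → ℂ} (hl : DifferentiableOn ℂ l (Metric.ball 0 1))
    (hre : ∀ u ∈ Metric.ball (0 : ℂ) 1, 0 ≤ (l u).re) {k m : ℕ} (hk : 2 ≤ k) (hm : 1 ≤ m)
    (θ : ℕ → UnitAddCircle) {z : ℂ} (hz : z ∈ extDisk) :
    rootLimDeriv l k m θ z = deriv (rootLim l k (rotSeq θ) m) z := by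
  refine Tendsto.limUnder_eq ?_
  have hd := ((differentiableOn_rootLim hl hre hk hm (norm_rotSeq θ)).differentiableAt
    (isOpen_extDisk.mem_nhds hz)).hasDerivAt
  have ht := hasDerivAt_iff_tendsto_slope_zero.1 hd
  have hn : Tendsto (fun n : ℕ => ((n : ℂ) + 1)⁻¹) atTop (𝓝[≠] 0) := by
    refine tendsto_nhdsWithin_iff.2 ⟨?_, Eventually.of_forall fun n => ?_⟩
    · simpa [one_div] using tendsto_one_div_add_atTop_nhds_zero_nat (𝕜 := ℂ)
    · exact inv_ne_zero (by exact_mod_cast Nat.succ_ne_zero n)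
  refine (ht.comp hn).congr fun n => ?_
  simp

/-! ### Integration in polar coordinates and over circles -/

theorem setLIntegral_Ioc_periodic {F : ℝ → ℝ≥0∞} {T : ℝ} (hT : 0 < T)
    (hF : Function.Periodic F T) (a b : ℝ) :
    ∫⁻ x in Ioc a (a + T), F x = ∫⁻ x in Ioc b (b + T), F x := by
  have : Fact (0 < T) := ⟨hT⟩
  have h : ∀ c, ∫⁻ x in Ioc c (c + T), F x = ∫⁻ x : AddCircle T, hF.lift x := fun c => by
    rw [← AddCircle.lintegral_preimage T c]
    simp only [Function.Periodic.lift_coe]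
  rw [h a, h b]

theorem setLIntegral_Ioc_neg_pi {F : ℝ → ℝ≥0∞} (hF : Function.Periodic F (2 * Real.pi)) :
    ∫⁻ x in Ioc (-Real.pi) Real.pi, F x = ∫⁻ x in Ioc 0 (2 * Real.pi), F x := by
  have := setLIntegral_Ioc_periodic Real.two_pi_pos hF (-Real.pi) 0
  rwa [zero_add, show -Real.pi + 2 * Real.pi = Real.pi by ring] at this

/-- Multiplication by `k` preserves the measure of the circle. This handles the angles under `z ↦ z
^ k`. -/
theorem setLIntegral_Ioc_nat_mul {F : ℝ → ℝ≥0∞} (hF : Function.Periodic F (2 * Real.pi))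
    (hFm : Measurable F) {k : ℕ} (hk : 2 ≤ k) :
    ∫⁻ x in Ioc 0 (2 * Real.pi), F (k * x) = ∫⁻ x in Ioc 0 (2 * Real.pi), F x := by
  have : Fact (0 < 2 * Real.pi) := ⟨Real.two_pi_pos⟩
  have hlm : Measurable hF.lift := by
    refine measurable_from_quotient.2 ?_
    exact hFm
  have hmp := (AddCircle.ergodic_nsmul (T := 2 * Real.pi) (n := k)
    (by omega)).toMeasurePreserving
  have h1 := hmp.lintegral_comp hlm
  have h2 := AddCircle.lintegral_preimage (2 * Real.pi) 0 hF.lift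
  have h3 := AddCircle.lintegral_preimage (2 * Real.pi) 0 (fun y => hF.lift (k • y))
  rw [← h2, ← h3, zero_add] at h1
  simpa only [← AddCircle.coe_nsmul, Function.Periodic.lift_coe, nsmul_eq_mul] using h1

theorem periodic_comp_circleMap {α : Type*} (G : ℂ → α) (s : ℝ) :
    Function.Periodic (fun x => G (circleMap 0 s x)) (2 * Real.pi) := fun x => by
  simp only [periodic_circleMap 0 s x]

theorem polarCoord_symm_eq_circleMap (p : ℝ × ℝ) :
    Complex.polarCoord.symm p = circleMap 0 p.1 p.2 := by
  rw [Complex.polarCoord_symm_apply, circleMap_zero, Complex.exp_mul_I]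
  simp

theorem measurable_circleMap : Measurable fun p : ℝ × ℝ => circleMap 0 p.1 p.2 := by
  unfold circleMap
  fun_prop

theorem lintegral_eq_polar {G : ℂ → ℝ≥0∞} (hG : Measurable G) :
    ∫⁻ z, G z = ∫⁻ s in Ioi (0 : ℝ), ENNReal.ofReal s *
      ∫⁻ x in Ioc 0 (2 * Real.pi), G (circleMap 0 s x) := by
  rw [← Complex.lintegral_comp_polarCoord_symm, show polarCoord.target =
    Ioi (0 : ℝ) ×ˢ Ioo (-Real.pi) Real.pi from rfl,
    Measure.volume_eq_prod, ← Measure.prod_restrict, lintegral_prod]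
  · refine lintegral_congr fun s => ?_
    simp only [polarCoord_symm_eq_circleMap, smul_eq_mul]
    rw [lintegral_const_mul, setLIntegral_congr Ioo_ae_eq_Ioc,
      setLIntegral_Ioc_neg_pi (periodic_comp_circleMap G s)]
    exact hG.comp (continuous_circleMap 0 s).measurable
  · simp only [polarCoord_symm_eq_circleMap, smul_eq_mul]
    exact ((measurable_fst.ennreal_ofReal).mul (hG.comp measurable_circleMap)).aemeasurable

/-- Measurability is asked only of the cut-off function, because `φ` and its inverse are arbitrary
off their domains. -/
theorem setLIntegral_eq_polar {G : ℂ → ℝ≥0∞} {D : Set ℂ} (hD : MeasurableSet D)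
    (hDs : D ⊆ extDisk) (hG : Measurable (D.indicator G)) :
    ∫⁻ z in D, G z = ∫⁻ s in Ioi (1 : ℝ), ENNReal.ofReal s *
      ∫⁻ x in Ioc 0 (2 * Real.pi), D.indicator G (circleMap 0 s x) := by
  rw [← lintegral_indicator hD, lintegral_eq_polar hG]
  rw [← lintegral_indicator measurableSet_Ioi, ← lintegral_indicator measurableSet_Ioi]
  refine lintegral_congr fun s => ?_
  by_cases hs1 : s ∈ Ioi (1 : ℝ)
  · rw [indicator_of_mem hs1, indicator_of_mem (Ioi_subset_Ioi zero_le_one hs1)]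
  rw [indicator_of_notMem hs1]
  by_cases hs0 : s ∈ Ioi (0 : ℝ)
  swap
  · rw [indicator_of_notMem hs0]
  rw [indicator_of_mem hs0]
  have h0 : ∀ x, D.indicator G (circleMap 0 s x) = 0 := fun x => by
    refine indicator_of_notMem (fun hx => ?_) _
    have h1 := hDs hx
    rw [extDisk, mem_ofPred_eq, norm_circleMap_zero] at h1
    rw [abs_of_pos hs0] at h1
    exact hs1 h1
  simp [h0]

theorem circleMap_mem_extDisk {s : ℝ} (hs : 1 < s) (x : ℝ) : circleMap 0 s x ∈ extDisk := by
  rw [extDisk, mem_ofPred_eq, norm_circleMap_zero, abs_of_pos (by linarith)]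
  exact hs

/-- Fubini for the exceptional set: its area is a polar integral, so almost every circle meets it in
a null set. `ae_of_polar` is the converse. -/
theorem ae_polar {p : ℂ → Prop} {ρ : ℝ} (hρ : 1 ≤ ρ) (hp : MeasurableSet {z | p z})
    (h : ∀ᵐ z : ℂ, ρ < ‖z‖ → p z) :
    ∀ᵐ s : ℝ, ρ < s → ∀ᵐ x ∂(volume.restrict (Ioc 0 (2 * Real.pi))), p (circleMap 0 s x) := by
  set A : Set ℂ := {z | ρ < ‖z‖} ∩ {z | p z}ᶜ with hA
  have hAm : MeasurableSet A := (measurableSet_lt measurable_const measurable_norm).inter hp.compl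
  have hAe : A ⊆ extDisk := fun z hz => lt_of_le_of_lt hρ hz.1
  have hA0 : volume A = 0 := by
    refine measure_mono_null (fun z hz => ?_) h
    simp only [hA, mem_inter_iff, mem_ofPred_eq, mem_compl_iff] at hz ⊢
    tauto
  have h1 := setLIntegral_eq_polar hAm hAe (G := 1) ((measurable_one).indicator hAm)
  simp only [Pi.one_apply, lintegral_one, Measure.restrict_apply_univ, hA0] at h1
  have hm : Measurable (A.indicator (1 : ℂ → ℝ≥0∞)) := measurable_one.indicator hAm
  have h2 : Measurable fun s : ℝ => ENNReal.ofReal s *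
      ∫⁻ x in Ioc 0 (2 * Real.pi), A.indicator (1 : ℂ → ℝ≥0∞) (circleMap 0 s x) :=
    ENNReal.measurable_ofReal.mul (hm.comp measurable_circleMap).lintegral_prod_right'
  have h3 := (lintegral_eq_zero_iff h2).1 h1.symm
  rw [EventuallyEq, ae_restrict_iff' measurableSet_Ioi] at h3
  filter_upwards [h3] with s hs hρs
  have hs1 : 1 < s := lt_of_le_of_lt hρ hρs
  have h4 := hs hs1
  simp only [Pi.zero_apply, mul_eq_zero, ENNReal.ofReal_eq_zero] at h4
  have h5 := h4.resolve_left (by linarith)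
  have hmc : Measurable fun x => A.indicator (1 : ℂ → ℝ≥0∞) (circleMap 0 s x) :=
    hm.comp (continuous_circleMap 0 s).measurable
  filter_upwards [(lintegral_eq_zero_iff hmc).1 h5] with x hx
  by_contra hpx
  have : circleMap 0 s x ∈ A := by
    refine ⟨?_, hpx⟩
    rw [mem_ofPred_eq, norm_circleMap_zero, abs_of_pos (by linarith)]
    exact hρs
  simp [this] at hx

theorem ae_of_polar {p : ℂ → Prop} {ρ : ℝ} (hρ : 1 ≤ ρ) (hp : MeasurableSet {z | p z})
    (h : ∀ᵐ s : ℝ, ρ < s → ∀ᵐ x ∂(volume.restrict (Ioc 0 (2 * Real.pi))), p (circleMap 0 s x)) :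
    ∀ᵐ z : ℂ, ρ < ‖z‖ → p z := by
  set A : Set ℂ := {z | ρ < ‖z‖} ∩ {z | p z}ᶜ with hA
  have hAm : MeasurableSet A := (measurableSet_lt measurable_const measurable_norm).inter hp.compl
  have hAe : A ⊆ extDisk := fun z hz => lt_of_le_of_lt hρ hz.1
  have h1 := setLIntegral_eq_polar hAm hAe (G := 1) ((measurable_one).indicator hAm)
  simp only [Pi.one_apply, lintegral_one, Measure.restrict_apply_univ] at h1
  have hA0 : volume A = 0 := by
    rw [h1, lintegral_eq_zero_iff']
    · rw [EventuallyEq, ae_restrict_iff' measurableSet_Ioi]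
      filter_upwards [h] with s hs hs1
      have hs1' : 1 < s := hs1
      have : ∫⁻ x in Ioc 0 (2 * Real.pi), A.indicator (1 : ℂ → ℝ≥0∞) (circleMap 0 s x) = 0 := by
        by_cases hρs : ρ < s
        · have hmc : Measurable fun x => A.indicator (1 : ℂ → ℝ≥0∞) (circleMap 0 s x) :=
            (measurable_one.indicator hAm).comp (continuous_circleMap 0 s).measurable
          rw [lintegral_eq_zero_iff hmc]
          filter_upwards [hs hρs] with x hx
          exact indicator_of_notMem (fun hh => hh.2 hx) _
        · have : ∀ x, A.indicator (1 : ℂ → ℝ≥0∞) (circleMap 0 s x) = 0 := fun x => by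
            refine indicator_of_notMem (fun hh => hρs ?_) _
            have := hh.1
            rwa [mem_ofPred_eq, norm_circleMap_zero, abs_of_pos (by linarith)] at this
          simp [this]
      simp [this]
    · exact (ENNReal.measurable_ofReal.mul ((measurable_one.indicator hAm).comp
        measurable_circleMap).lintegral_prod_right').aemeasurable
  refine measure_mono_null (fun z hz => ?_) hA0
  simp only [hA, mem_inter_iff, mem_ofPred_eq, mem_compl_iff] at hz ⊢
  tauto

/-- The average over a random rotation is an average over a circle. -/
theorem lintegral_haar_toCircle_neg_mul (G : ℂ → ℝ≥0∞) (w : ℂ) :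
    ∫⁻ a : UnitAddCircle, G ((AddCircle.toCircle (-a) : ℂ) * w) ∂AddCircle.haarAddCircle =
      ENNReal.ofReal (1 / (2 * Real.pi)) *
        ∫⁻ x in Ioc 0 (2 * Real.pi), G (circleMap 0 ‖w‖ x) := by
  -- The argument of `w` is absorbed by the invariance of Haar measure.
  obtain ⟨α, hα⟩ : ∃ α : UnitAddCircle, w = ‖w‖ * (AddCircle.toCircle α : ℂ) := by
    by_cases hw : w = 0
    · exact ⟨0, by simp [hw]⟩
    obtain ⟨α, hα⟩ := (AddCircle.homeomorphCircle (T := 1) one_ne_zero).surjective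
      (Circle.exp (Complex.arg w))
    refine ⟨α, ?_⟩
    rw [AddCircle.homeomorphCircle_apply] at hα
    rw [hα, Circle.coe_exp, Complex.norm_mul_exp_arg_mul_I]
  have h1 : ∀ a : UnitAddCircle, (AddCircle.toCircle (-a) : ℂ) * w =
      ‖w‖ * (AddCircle.toCircle (α - a) : ℂ) := fun a => by
    conv_lhs => rw [hα]
    rw [sub_eq_add_neg, AddCircle.toCircle_add, Circle.coe_mul]
    ring
  simp only [h1]
  have h2 := lintegral_sub_left_eq_self (μ := (AddCircle.haarAddCircle : Measure UnitAddCircle))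
    (fun b : UnitAddCircle => G (‖w‖ * (AddCircle.toCircle b : ℂ))) α
  rw [h2]
  have h3 : (AddCircle.haarAddCircle : Measure UnitAddCircle) = volume := by
    rw [AddCircle.volume_eq_smul_haarAddCircle]
    simp
  rw [h3, ← UnitAddCircle.lintegral_preimage 0]
  have h4 : ∀ x : ℝ, (‖w‖ : ℂ) * (AddCircle.toCircle (x : UnitAddCircle) : ℂ) =
      circleMap 0 ‖w‖ (2 * Real.pi * x) := fun x => by
    rw [AddCircle.toCircle_apply_mk, Circle.coe_exp, circleMap_zero]
    simp
  simp only [h4, zero_add]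
  have h5 : Ioc 0 (2 * Real.pi) = (fun x : ℝ => 2 * Real.pi * x) '' Ioc 0 1 := by
    rw [image_mul_left_Ioc Real.two_pi_pos]
    simp
  rw [h5, lintegral_image_eq_lintegral_abs_deriv_mul measurableSet_Ioc
    (f' := fun _ => 2 * Real.pi)
    (fun x _ => by simpa using ((hasDerivAt_id x).const_mul (2 * Real.pi)).hasDerivWithinAt)
    ((mul_right_injective₀ Real.two_pi_pos.ne').injOn), lintegral_const_mul',
    ← mul_assoc, ← ENNReal.ofReal_mul (by positivity), abs_of_pos Real.two_pi_pos,
    one_div_mul_cancel Real.two_pi_pos.ne', ENNReal.ofReal_one, one_mul]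
  exact ENNReal.ofReal_ne_top

/-- The substitution `r = s ^ k`. -/
theorem setLIntegral_Ioi_pow {k : ℕ} (hk : 1 ≤ k) (h : ℝ → ℝ≥0∞) :
    ∫⁻ r in Ioi (1 : ℝ), h r =
      ∫⁻ s in Ioi (1 : ℝ), ENNReal.ofReal (k * s ^ (k - 1)) * h (s ^ k) := by
  have hk0 : k ≠ 0 := by omega
  have himg : (fun s : ℝ => s ^ k) '' Ioi 1 = Ioi 1 := by
    ext r
    constructor
    · rintro ⟨s, hs, rfl⟩
      exact one_lt_pow₀ (mem_Ioi.1 hs) hk0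
    · intro hr
      have hr' : (1 : ℝ) < r := hr
      exact ⟨r ^ (k : ℝ)⁻¹, Real.one_lt_rpow hr' (by positivity),
        Real.rpow_inv_natCast_pow (by linarith) hk0⟩
  conv_lhs => rw [← himg]
  rw [lintegral_image_eq_lintegral_abs_deriv_mul measurableSet_Ioi
    (fun x _ => (hasDerivAt_pow k x).hasDerivWithinAt)
    (fun x hx y hy hxy => (pow_left_inj₀ (zero_le_one.trans (le_of_lt hx))
      (zero_le_one.trans (le_of_lt hy)) hk0).1 hxy)]
  refine setLIntegral_congr_fun measurableSet_Ioi fun s hs => ?_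
  have : (1 : ℝ) < s := hs
  simp only [abs_of_nonneg (show 0 ≤ (k : ℝ) * s ^ (k - 1) by positivity)]

theorem abs_det_restrictScalars (d : ℂ) :
    |((ContinuousLinearMap.toSpanSingleton ℂ d).restrictScalars ℝ : ℂ →L[ℝ] ℂ).det| =
      ‖d‖ ^ 2 := by
  have : ((ContinuousLinearMap.toSpanSingleton ℂ d).restrictScalars ℝ : ℂ →L[ℝ] ℂ).det =
      ‖d‖ ^ 2 := by
    simp [ContinuousLinearMap.det, LinearMap.det_restrictScalars,
      Algebra.norm_complex_eq, Complex.normSq_eq_norm_sq]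
  rw [this, abs_of_nonneg (by positivity)]

/-- Change of variables for an injective holomorphic map. -/
theorem lintegral_image_eq_of_injOn {f : ℂ → ℂ} {U : Set ℂ} (hU : MeasurableSet U)
    (hd : ∀ z ∈ U, DifferentiableAt ℂ f z) (hf : InjOn f U) (g : ℂ → ℝ≥0∞) :
    ∫⁻ w in f '' U, g w = ∫⁻ z in U, ENNReal.ofReal (‖deriv f z‖ ^ 2) * g (f z) := by
  rw [lintegral_image_eq_lintegral_abs_det_fderiv_mul volume hU
    (f' := fun z => (ContinuousLinearMap.toSpanSingleton ℂ (deriv f z)).restrictScalars ℝ)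
    (fun z hz => ((hd z hz).hasDerivAt.hasFDerivAt.restrictScalars ℝ).hasFDerivWithinAt) hf]
  simp only [abs_det_restrictScalars]

/-! ### The adjointness of `P` and `Q` -/

theorem IsSigmaPrime.differentiableAt {φ : ℂ → ℂ} (hφ : IsSigmaPrime φ) {z : ℂ}
    (hz : z ∈ extDisk) : DifferentiableAt ℂ φ z :=
  hφ.differentiableOn.differentiableAt (isOpen_extDisk.mem_nhds hz)

theorem IsSigmaPrime.deriv_ne_zero {φ : ℂ → ℂ} (hφ : IsSigmaPrime φ) {z : ℂ} (hz : z ∈ extDisk) :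
    deriv φ z ≠ 0 :=
  deriv_ne_zero_of_injOn isOpen_extDisk hφ.differentiableOn hφ.injOn hz

theorem IsSigmaPrime.hasStrictDerivAt {φ : ℂ → ℂ} (hφ : IsSigmaPrime φ) {z : ℂ}
    (hz : z ∈ extDisk) : HasStrictDerivAt φ (deriv φ z) z :=
  (hφ.differentiableOn.analyticAt (isOpen_extDisk.mem_nhds hz)).hasStrictDerivAt

theorem IsSigmaPrime.le_norm {φ : ℂ → ℂ} (hφ : IsSigmaPrime φ) {z : ℂ} (hz : z ∈ extDisk) :
    ‖z‖ ≤ ‖φ z‖ := by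
  obtain ⟨l, b, hl⟩ := hφ.exists_isLogOf
  rw [hl.eq_exp z hz, norm_mul, Complex.norm_exp]
  exact le_mul_of_one_le_right (norm_nonneg _)
    (Real.one_le_exp (hl.re_nonneg _ (inv_mem_ball_of_mem_extDisk hz)))

theorem IsSigmaPrime.isOpen_image {φ : ℂ → ℂ} (hφ : IsSigmaPrime φ) : IsOpen (φ '' extDisk) := by
  rw [isOpen_iff_mem_nhds]
  rintro _ ⟨z, hz, rfl⟩
  rw [← (hφ.hasStrictDerivAt hz).map_nhds_eq (hφ.deriv_ne_zero hz)]
  exact image_mem_map (isOpen_extDisk.mem_nhds hz)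

theorem IsSigmaPrime.inv_apply {φ : ℂ → ℂ} (hφ : IsSigmaPrime φ) {z : ℂ} (hz : z ∈ extDisk) :
    inv φ (φ z) = z :=
  hφ.injOn.leftInvOn_invFunOn hz

theorem IsSigmaPrime.hasStrictDerivAt_inv {φ : ℂ → ℂ} (hφ : IsSigmaPrime φ) {z : ℂ}
    (hz : z ∈ extDisk) :
    HasStrictDerivAt (inv φ) (deriv φ z)⁻¹ (φ z) := by
  refine (hφ.hasStrictDerivAt hz).to_local_left_inverse (hφ.deriv_ne_zero hz) ?_
  filter_upwards [isOpen_extDisk.mem_nhds hz] with w hw using hφ.inv_apply hw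

theorem IsSigmaPrime.continuousOn_inv {φ : ℂ → ℂ} (hφ : IsSigmaPrime φ) :
    ContinuousOn (inv φ) (φ '' extDisk) := by
  rintro _ ⟨z, hz, rfl⟩
  exact (hφ.hasStrictDerivAt_inv hz).hasDerivAt.continuousAt.continuousWithinAt

theorem IsSigmaPrime.measurable_indicator {φ : ℂ → ℂ} (hφ : IsSigmaPrime φ) :
    Measurable (extDisk.indicator φ) := by
  classical
  rw [← piecewise_eq_indicator]
  exact hφ.differentiableOn.continuousOn.measurable_piecewise continuousOn_const
    isOpen_extDisk.measurableSet

theorem IsSigmaPrime.measurable_indicator_inv {φ : ℂ → ℂ} (hφ : IsSigmaPrime φ) :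
    Measurable ((φ '' extDisk).indicator (inv φ)) := by
  classical
  rw [← piecewise_eq_indicator]
  exact hφ.continuousOn_inv.measurable_piecewise continuousOn_const
    hφ.isOpen_image.measurableSet


theorem rootPt_pow {k : ℕ} (hk : 1 ≤ k) {s : ℝ} (hs : 0 ≤ s) (x : ℝ) :
    rootPt k (s ^ k) x = circleMap 0 s x := by
  rw [rootPt, one_div, Real.pow_rpow_inv_natCast hs (by omega)]

theorem norm_rootPt {k : ℕ} {r : ℝ} (hr : 0 ≤ r) (x : ℝ) :
    ‖rootPt k r x‖ = r ^ (1 / (k : ℝ)) := by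
  rw [rootPt, norm_circleMap_zero, abs_of_nonneg (by positivity)]

theorem rootPt_mem_extDisk {k : ℕ} (hk : 1 ≤ k) {r : ℝ} (hr : 1 < r) (x : ℝ) :
    rootPt k r x ∈ extDisk :=
  circleMap_mem_extDisk (Real.one_lt_rpow hr (by positivity)) x

theorem norm_rootPt_pow {k : ℕ} (hk : 1 ≤ k) {r : ℝ} (hr : 0 ≤ r) (x : ℝ) :
    ‖rootPt k r x‖ ^ k = r := by
  rw [norm_rootPt hr, one_div, Real.rpow_inv_natCast_pow hr (by omega)]

/-- The density of the bilinear form of `P` with respect to the area. -/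
def areaWeight (φ : ℂ → ℂ) (k : ℕ) (t : ℝ) (z : ℂ) : ℝ :=
  k * (‖z‖ ^ (((k : ℝ) - 1) * (2 - t)) * ‖deriv φ z‖ ^ t) / (‖φ z‖ * (2 * Real.pi))

/-- With `r = s ^ k` the powers of `s` agree: `(k - 1) + (k - (k - 1) t) = 1 + (k - 1)(2 - t)`. The
extra `s` on the right is the polar Jacobian. -/
theorem mul_weightP_pow {φ : ℂ → ℂ} {k : ℕ} (hk : 1 ≤ k) (t : ℝ) {s : ℝ} (hs : 1 < s) (x : ℝ) :
    k * s ^ (k - 1) * weightP φ k t (s ^ k) x = s * areaWeight φ k t (circleMap 0 s x) := by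
  have hs0 : 0 < s := by linarith
  have hk0 : (k : ℝ) ≠ 0 := by positivity
  have h1 : (s ^ k) ^ (1 - ((k : ℝ) - 1) * t / k) = s ^ ((k : ℝ) - (k - 1) * t) := by
    rw [← Real.rpow_natCast, ← Real.rpow_mul hs0.le]
    congr 1
    field_simp
  have h2 : s ^ (k - 1) = s ^ ((k : ℝ) - 1) := by
    rw [← Real.rpow_natCast, Nat.cast_sub hk, Nat.cast_one]
  have h3 : s ^ ((k : ℝ) - 1) * s ^ ((k : ℝ) - (k - 1) * t) =
      s * s ^ (((k : ℝ) - 1) * (2 - t)) := by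
    conv_rhs => rw [← Real.rpow_one s, ← Real.rpow_mul hs0.le]
    rw [← Real.rpow_add hs0, ← Real.rpow_add hs0]
    congr 1
    ring
  rw [weightP, areaWeight, rootPt_pow hk hs0.le, h1, norm_circleMap_zero, abs_of_pos hs0, h2]
  calc _ = k * (s ^ ((k : ℝ) - 1) * s ^ ((k : ℝ) - (k - 1) * t)) *
        (‖deriv φ (circleMap 0 s x)‖ ^ t / ‖φ (circleMap 0 s x)‖) / (2 * Real.pi) := by ring
    _ = _ := by rw [h3]; ring

theorem weightP_nonneg {φ : ℂ → ℂ} {k : ℕ} {t r : ℝ} (hr : 0 ≤ r) (x : ℝ) :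
    0 ≤ weightP φ k t r x := by
  unfold weightP
  positivity

theorem IsSigmaPrime.areaWeight_pos {φ : ℂ → ℂ} (hφ : IsSigmaPrime φ) {k : ℕ} (hk : 1 ≤ k)
    {t : ℝ} {z : ℂ} (hz : z ∈ extDisk) : 0 < areaWeight φ k t z := by
  have h1 : 0 < ‖z‖ := norm_pos_iff.2 (extDisk_ne_zero hz)
  have h2 : 0 < ‖deriv φ z‖ := norm_pos_iff.2 (hφ.deriv_ne_zero hz)
  have h3 : 0 < ‖φ z‖ := h1.trans_le (hφ.le_norm hz)
  unfold areaWeight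
  positivity

theorem measurable_areaTerm {φ : ℂ → ℂ} (hφ : IsSigmaPrime φ) (k : ℕ) (t : ℝ)
    {f ν : ℝ → ℝ≥0∞} (hf : Measurable f) (hν : Measurable ν) :
    Measurable (extDisk.indicator fun z =>
      ENNReal.ofReal (areaWeight φ k t z) * (f (‖z‖ ^ k) * ν ‖φ z‖)) := by
  have h1 := hφ.measurable_indicator
  have h2 := measurable_deriv φ
  have : (extDisk.indicator fun z =>
      ENNReal.ofReal (areaWeight φ k t z) * (f (‖z‖ ^ k) * ν ‖φ z‖)) =
      extDisk.indicator fun z =>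
        ENNReal.ofReal (k * (‖z‖ ^ (((k : ℝ) - 1) * (2 - t)) * ‖deriv φ z‖ ^ t) /
          (‖extDisk.indicator φ z‖ * (2 * Real.pi))) *
          (f (‖z‖ ^ k) * ν ‖extDisk.indicator φ z‖) := by
    refine indicator_congr fun z hz => ?_
    rw [indicator_of_mem hz, areaWeight]
  rw [this]
  refine Measurable.indicator ?_ isOpen_extDisk.measurableSet
  refine Measurable.mul ?_ ((hf.comp (by fun_prop)).mul (hν.comp h1.norm))
  fun_prop

/-- Substituting `r = s ^ k` turns the radial integral and the circle integral inside `P` into polar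
coordinates on the exterior disc. -/
theorem lintegral_mul_opP {φ : ℂ → ℂ} (hφ : IsSigmaPrime φ) {k : ℕ} (hk : 1 ≤ k) (t : ℝ)
    {f ν : ℝ → ℝ≥0∞} (hf : Measurable f) (hν : Measurable ν) :
    ∫⁻ r in Ioi (1 : ℝ), f r * opP φ k t ν r =
      ∫⁻ z in extDisk, ENNReal.ofReal (areaWeight φ k t z) * (f (‖z‖ ^ k) * ν ‖φ z‖) := by
  have hm := measurable_areaTerm hφ k t hf hν
  rw [setLIntegral_eq_polar isOpen_extDisk.measurableSet Subset.rfl hm, setLIntegral_Ioi_pow hk]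
  refine setLIntegral_congr_fun measurableSet_Ioi fun s hs => ?_
  have hs1 : (1 : ℝ) < s := hs
  have hs0 : (0 : ℝ) ≤ s := by linarith
  have hmem := circleMap_mem_extDisk hs1
  have hnorm : ∀ x, ‖circleMap 0 s x‖ = s := fun x => by
    rw [norm_circleMap_zero, abs_of_nonneg hs0]
  simp only [indicator_of_mem (hmem _), hnorm, opP, rootPt_pow hk hs0]
  have hm' : Measurable fun x : ℝ => ENNReal.ofReal (areaWeight φ k t (circleMap 0 s x)) *
      ν ‖φ (circleMap 0 s x)‖ := by
    have h := (measurable_areaTerm hφ k t (measurable_const (a := (1 : ℝ≥0∞))) hν).comp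
      (continuous_circleMap 0 s).measurable
    have h2 : (fun x : ℝ => ENNReal.ofReal (areaWeight φ k t (circleMap 0 s x)) *
      ν ‖φ (circleMap 0 s x)‖) = (extDisk.indicator fun z =>
        ENNReal.ofReal (areaWeight φ k t z) * (1 * ν ‖φ z‖)) ∘ circleMap 0 s := by
      funext x
      simp only [Function.comp, indicator_of_mem (hmem x), one_mul]
    rw [h2]
    exact h
  have hrw : ∀ x : ℝ, ENNReal.ofReal (areaWeight φ k t (circleMap 0 s x)) *
      (f (s ^ k) * ν ‖φ (circleMap 0 s x)‖) =
      f (s ^ k) * (ENNReal.ofReal (areaWeight φ k t (circleMap 0 s x)) *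
      ν ‖φ (circleMap 0 s x)‖) := fun x => by ring
  simp only [hrw]
  rw [lintegral_const_mul _ hm', mul_left_comm, mul_left_comm (ENNReal.ofReal s)]
  congr 1
  rw [← lintegral_const_mul' _ _ ENNReal.ofReal_ne_top,
    ← lintegral_const_mul' _ _ ENNReal.ofReal_ne_top]
  refine lintegral_congr fun x => ?_
  rw [← mul_assoc, ← mul_assoc, ← ENNReal.ofReal_mul (by positivity),
    ← ENNReal.ofReal_mul hs0, mul_weightP_pow hk t hs1]

/-- Polar coordinates in the image plane followed by `w = φ z`: the Jacobian `|φ'|²` combines with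
`|ψ'|^(2-t) = |φ'|^(t-2)` to give `|φ'|^t`. -/
theorem lintegral_opQ_mul {φ : ℂ → ℂ} (hφ : IsSigmaPrime φ) {k : ℕ} (hk : 1 ≤ k) (t : ℝ)
    {f ν : ℝ → ℝ≥0∞} (hf : Measurable f) (hν : Measurable ν) :
    ∫⁻ r in Ioi (1 : ℝ), opQ φ k t f r * ν r =
      ∫⁻ z in extDisk, ENNReal.ofReal (areaWeight φ k t z) * (f (‖z‖ ^ k) * ν ‖φ z‖) := by
  have hUm := hφ.isOpen_image.measurableSet
  have hUs : φ '' extDisk ⊆ extDisk := hφ.mapsTo.image_subset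
  set q : ℂ → ℝ≥0∞ := fun w => ENNReal.ofReal (k * ‖inv φ w ^ (k - 1) *
        deriv (inv φ) w‖ ^ (2 - t) / (2 * Real.pi)) * f (‖inv φ w ^ k‖) with hq
  have hqm : Measurable ((φ '' extDisk).indicator q) := by
    have h1 := hφ.measurable_indicator_inv
    have h2 := measurable_deriv (inv φ)
    have : (φ '' extDisk).indicator q = (φ '' extDisk).indicator fun w =>
        ENNReal.ofReal (k * ‖(φ '' extDisk).indicator (inv φ) w ^ (k - 1) *
          deriv (inv φ) w‖ ^ (2 - t) / (2 * Real.pi)) *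
          f (‖(φ '' extDisk).indicator (inv φ) w ^ k‖) := by
      refine indicator_congr fun z hz => ?_
      rw [indicator_of_mem hz]
    rw [this]
    refine Measurable.indicator (Measurable.mul ?_ (hf.comp (h1.pow_const k).norm)) hUm
    fun_prop
  -- The pairing is with `dr`, not `r dr`; dividing by `‖w‖` cancels the polar Jacobian.
  set G : ℂ → ℝ≥0∞ := fun w => q w * (ν ‖w‖ * (ENNReal.ofReal ‖w‖)⁻¹) with hG
  have hGm : Measurable ((φ '' extDisk).indicator G) := by
    have h : (φ '' extDisk).indicator G = fun w =>
        (φ '' extDisk).indicator q w * (ν ‖w‖ * (ENNReal.ofReal ‖w‖)⁻¹) := by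
      funext w
      rw [hG, indicator_mul_left]
    rw [h]
    exact hqm.mul ((hν.comp measurable_norm).mul (measurable_norm.ennreal_ofReal.inv))
  have h1 : ∫⁻ r in Ioi (1 : ℝ), opQ φ k t f r * ν r = ∫⁻ w in φ '' extDisk, G w := by
    rw [setLIntegral_eq_polar hUm hUs hGm]
    refine setLIntegral_congr_fun measurableSet_Ioi fun s hs => ?_
    have hs1 : (1 : ℝ) < s := hs
    have hs0 : (0 : ℝ) < s := by linarith
    have hnorm : ∀ x, ‖circleMap 0 s x‖ = s := fun x => by
      rw [norm_circleMap_zero, abs_of_pos hs0]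
    have h2 : ∀ x, (φ '' extDisk).indicator G (circleMap 0 s x) =
        (ν s * (ENNReal.ofReal s)⁻¹) * (φ '' extDisk).indicator q (circleMap 0 s x) := fun x => by
      rw [hG, indicator_mul_left, hnorm, mul_comm]
    simp only [h2]
    have hqs : Measurable fun x => (φ '' extDisk).indicator q (circleMap 0 s x) :=
      hqm.comp (continuous_circleMap 0 s).measurable
    rw [lintegral_const_mul _ hqs, ← mul_assoc, mul_comm (ν s), ← mul_assoc,
      ENNReal.mul_inv_cancel (by simpa using hs0) ENNReal.ofReal_ne_top, one_mul, mul_comm,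
      ← setLIntegral_Ioc_neg_pi (periodic_comp_circleMap _ s)]
    congr 1
    have hset : {x : ℝ | x ∈ Ioc (-Real.pi) Real.pi ∧ circleMap 0 s x ∈ φ '' extDisk} =
        (circleMap 0 s ⁻¹' (φ '' extDisk)) ∩ Ioc (-Real.pi) Real.pi := by
      ext x
      exact and_comm
    have hpre : MeasurableSet (circleMap 0 s ⁻¹' (φ '' extDisk)) :=
      (continuous_circleMap 0 s).measurable hUm
    rw [opQ, hset, ← setLIntegral_indicator hpre]
    rfl
  rw [h1, lintegral_image_eq_of_injOn isOpen_extDisk.measurableSet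
    (fun z hz => hφ.differentiableAt hz) hφ.injOn]
  refine setLIntegral_congr_fun isOpen_extDisk.measurableSet fun z hz => ?_
  have hz0 : 0 < ‖z‖ := norm_pos_iff.2 (extDisk_ne_zero hz)
  have hd0 : 0 < ‖deriv φ z‖ := norm_pos_iff.2 (hφ.deriv_ne_zero hz)
  have hφ0 : 0 < ‖φ z‖ := hz0.trans_le (hφ.le_norm hz)
  simp only [hG, hq, hφ.inv_apply hz, (hφ.hasStrictDerivAt_inv hz).hasDerivAt.deriv, norm_mul,
    norm_pow, norm_inv]
  have h3 : (‖z‖ ^ (k - 1) * ‖deriv φ z‖⁻¹) ^ (2 - t) =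
      ‖z‖ ^ (((k : ℝ) - 1) * (2 - t)) * (‖deriv φ z‖ ^ t / ‖deriv φ z‖ ^ 2) := by
    rw [Real.mul_rpow (by positivity) (by positivity), Real.inv_rpow hd0.le,
      ← Real.rpow_neg hd0.le, ← Real.rpow_natCast ‖z‖, ← Real.rpow_mul hz0.le, Nat.cast_sub hk,
      Nat.cast_one, ← Real.rpow_natCast ‖deriv φ z‖ 2, ← Real.rpow_sub hd0]
    congr 2
    push_cast
    ring
  have h4 : ENNReal.ofReal (‖deriv φ z‖ ^ 2) * (ENNReal.ofReal (k * (‖z‖ ^ (k - 1) *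
      ‖deriv φ z‖⁻¹) ^ (2 - t) / (2 * Real.pi)) * (ENNReal.ofReal ‖φ z‖)⁻¹) =
      ENNReal.ofReal (areaWeight φ k t z) := by
    rw [← ENNReal.ofReal_inv_of_pos hφ0, ← ENNReal.ofReal_mul (by positivity),
      ← ENNReal.ofReal_mul (by positivity), h3, areaWeight]
    congr 1
    field_simp
  rw [← h4]
  ring

/-- `P` and `Q` are formally adjoint. -/
theorem opQ_opP_adjoint {φ : ℂ → ℂ} (hφ : IsSigmaPrime φ) {k : ℕ} (hk : 1 ≤ k) (t : ℝ)
    {f ν : ℝ → ℝ≥0∞} (hf : Measurable f) (hν : Measurable ν) :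
    ∫⁻ r in Ioi (1 : ℝ), opQ φ k t f r * ν r = ∫⁻ r in Ioi (1 : ℝ), f r * opP φ k t ν r := by
  rw [lintegral_opQ_mul hφ hk t hf hν, lintegral_mul_opP hφ hk t hf hν]

theorem setLIntegral_Icc_eq_indicator_right {F ν : ℝ → ℝ≥0∞} (R : ℝ) :
    ∫⁻ r in Icc 1 R, F r * ν r = ∫⁻ r in Ioi (1 : ℝ), F r * (Icc 1 R).indicator ν r := by
  have h1 : ∀ r, F r * (Icc 1 R).indicator ν r = (Icc 1 R).indicator (fun r => F r * ν r) r :=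
    fun r => by rw [indicator_mul_right]
  simp only [h1]
  rw [setLIntegral_congr Ioi_ae_eq_Ici, setLIntegral_indicator measurableSet_Icc,
    inter_eq_left.2 Icc_subset_Ici_self]

theorem opQ_opP_adjoint_indicator {φ : ℂ → ℂ} (hφ : IsSigmaPrime φ) {k : ℕ} (hk : 1 ≤ k)
    (t R : ℝ) {f ν : ℝ → ℝ≥0∞} (hf : Measurable f) (hν : Measurable ν) :
    ∫⁻ r in Icc 1 R, opQ φ k t ((Icc 1 R).indicator f) r * ν r =
      ∫⁻ r in Icc 1 R, f r * opP φ k t ((Icc 1 R).indicator ν) r := by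
  have h2 : ∫⁻ r in Icc 1 R, f r * opP φ k t ((Icc 1 R).indicator ν) r =
      ∫⁻ r in Ioi (1 : ℝ), (Icc 1 R).indicator f r * opP φ k t ((Icc 1 R).indicator ν) r := by
    simp only [mul_comm (f _), mul_comm ((Icc 1 R).indicator f _)]
    exact setLIntegral_Icc_eq_indicator_right R
  rw [setLIntegral_Icc_eq_indicator_right, h2]
  exact opQ_opP_adjoint hφ hk t (hf.indicator measurableSet_Icc) (hν.indicator measurableSet_Icc)

theorem opQ_mono {φ : ℂ → ℂ} {k : ℕ} {t : ℝ} {f g : ℝ → ℝ≥0∞} (h : f ≤ g) (r : ℝ) :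
    opQ φ k t f r ≤ opQ φ k t g r :=
  lintegral_mono fun _ => mul_le_mul_right (h _) _

theorem opP_indicator_eq {φ : ℂ → ℂ} {k : ℕ} (hk : 1 ≤ k) {t R : ℝ}
    (h : ∀ u ∈ extDisk, ‖u‖ ^ k < R → φ u ∈ annulus R) (ν : ℝ → ℝ≥0∞) {r : ℝ}
    (hr : r ∈ Ioo 1 R) : opP φ k t ((Icc 1 R).indicator ν) r = opP φ k t ν r := by
  refine lintegral_congr fun x => ?_
  have h1 := h _ (rootPt_mem_extDisk hk hr.1 x)
    (by rw [norm_rootPt_pow hk (by linarith [hr.1])]; exact hr.2)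
  have h2 : ‖φ (rootPt k r x)‖ ∈ Icc 1 R := ⟨h1.1.le, h1.2.le⟩
  rw [indicator_of_mem h2]

/-! ### The law of the rotations -/

/-- Prepend an angle to a sequence of angles. -/
def consAngle (a : UnitAddCircle) (θ : ℕ → UnitAddCircle) : ℕ → UnitAddCircle
  | 0 => a
  | n + 1 => θ n

instance : IsProbabilityMeasure angleLaw := by unfold angleLaw; infer_instance

theorem measurable_consAngle :
    Measurable fun p : UnitAddCircle × (ℕ → UnitAddCircle) => consAngle p.1 p.2 := by
  refine measurable_pi_lambda _ fun n => ?_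
  cases n with
  | zero => exact measurable_fst
  | succ n => exact (measurable_pi_apply n).comp measurable_snd

/-- A product measure is determined by finite cylinders. Prepending a coordinate splits such a
cylinder into a product. -/
theorem map_consAngle :
    Measure.map (fun p : UnitAddCircle × (ℕ → UnitAddCircle) => consAngle p.1 p.2)
      ((AddCircle.haarAddCircle : Measure UnitAddCircle).prod angleLaw) = angleLaw := by
  classical
  refine Measure.eq_infinitePi _ fun s t ht => ?_
  obtain ⟨N, hN⟩ : ∃ N, s ⊆ Finset.range (N + 1) := by
    obtain ⟨N, hN⟩ := s.exists_nat_subset_range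
    exact ⟨N, hN.trans (Finset.range_mono (Nat.le_succ N))⟩
  -- Padding with the whole circle makes the index set an initial segment, for which the shift is
  -- transparent.
  set t' : ℕ → Set UnitAddCircle := fun i => if i ∈ s then t i else univ with ht'
  have htm : ∀ i, MeasurableSet (t' i) := fun i => by
    simp only [ht']; split_ifs; exacts [ht i, MeasurableSet.univ]
  have hpi : (s : Set ℕ).pi t = ((Finset.range (N + 1) : Finset ℕ) : Set ℕ).pi t' := by
    ext θ
    simp only [Set.mem_pi, Finset.mem_coe, ht']
    constructor
    · intro h i _
      split_ifs with hi
      exacts [h i hi, mem_univ _]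
    · intro h i hi
      simpa [hi] using h i (hN hi)
  have hprod : ∏ i ∈ s, (AddCircle.haarAddCircle : Measure UnitAddCircle) (t i) =
      ∏ i ∈ Finset.range (N + 1), (AddCircle.haarAddCircle : Measure UnitAddCircle) (t' i) := by
    rw [← Finset.prod_subset hN (f := fun i =>
      (AddCircle.haarAddCircle : Measure UnitAddCircle) (t' i))]
    · exact Finset.prod_congr rfl fun i hi => by simp [ht', hi]
    · intro i _ hi
      simp [ht', hi]
  have hpre : (fun p : UnitAddCircle × (ℕ → UnitAddCircle) => consAngle p.1 p.2) ⁻¹'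
      (((Finset.range (N + 1) : Finset ℕ) : Set ℕ).pi t') =
      t' 0 ×ˢ (((Finset.range N : Finset ℕ) : Set ℕ).pi fun i => t' (i + 1)) := by
    ext ⟨a, θ⟩
    simp only [mem_preimage, Set.mem_pi, Finset.mem_coe, Finset.mem_range, mem_prod]
    constructor
    · intro h
      exact ⟨h 0 (by omega), fun i hi => h (i + 1) (by omega)⟩
    · rintro ⟨h0, h1⟩ i hi
      cases i with
      | zero => exact h0
      | succ i => exact h1 i (by omega)
  rw [hpi, hprod, Measure.map_apply measurable_consAngle, hpre, Measure.prod_prod,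
    angleLaw, Measure.infinitePi_pi _ (fun i _ => htm (i + 1)), Finset.prod_range_succ', mul_comm]
  exact MeasurableSet.pi (Finset.countable_toSet _) fun i _ => htm i

/-- The outermost angle is averaged first, with all the others frozen. -/
theorem lintegral_angleLaw {X : (ℕ → UnitAddCircle) → ℝ≥0∞} (hX : Measurable X) :
    ∫⁻ θ, X θ ∂angleLaw =
      ∫⁻ θ, ∫⁻ a, X (consAngle a θ) ∂AddCircle.haarAddCircle ∂angleLaw := by
  conv_lhs => rw [← map_consAngle]
  rw [lintegral_map hX measurable_consAngle, lintegral_prod_symm]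
  exact (hX.comp measurable_consAngle).aemeasurable

/-! ### Weighted moments of the derivative of the snowflake -/

/-- The quantity `ν(|f|) |f|⁻¹ |f'|^t` at the point `z`. -/
def momentTerm (l : ℂ → ℂ) (k : ℕ) (t : ℝ) (ν : ℝ → ℝ≥0∞) (θ : ℕ → UnitAddCircle) (z : ℂ) :
    ℝ≥0∞ :=
  ν ‖rootLim l k (rotSeq θ) 1 z‖ * (ENNReal.ofReal ‖rootLim l k (rotSeq θ) 1 z‖)⁻¹ *
    ‖rootLimDeriv l k 1 θ z‖ₑ ^ t

/-- The expectation of `ν(|f|) |f|⁻¹ |f'|^t` at the point `z`. -/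
def moment (l : ℂ → ℂ) (k : ℕ) (t : ℝ) (ν : ℝ → ℝ≥0∞) (z : ℂ) : ℝ≥0∞ :=
  ∫⁻ θ, momentTerm l k t ν θ z ∂angleLaw

theorem measurable_momentTerm {l : ℂ → ℂ} (hl : Measurable l) (k : ℕ) (t : ℝ)
    {ν : ℝ → ℝ≥0∞} (hν : Measurable ν) :
    Measurable fun p : (ℕ → UnitAddCircle) × ℂ => momentTerm l k t ν p.1 p.2 := by
  have h1 := measurable_rootLim hl k 1
  have h2 := measurable_rootLimDeriv hl k 1
  exact ((hν.comp h1.norm).mul h1.norm.ennreal_ofReal.inv).mul (h2.enorm.pow_const t)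

theorem measurable_moment {l : ℂ → ℂ} (hl : Measurable l) (k : ℕ) (t : ℝ)
    {ν : ℝ → ℝ≥0∞} (hν : Measurable ν) : Measurable (moment l k t ν) :=
  (measurable_momentTerm hl k t hν).lintegral_prod_left'

/-- `P ν` restricted to `(1, ∞)`. -/
def opPExt (φ : ℂ → ℂ) (k : ℕ) (t : ℝ) (ν : ℝ → ℝ≥0∞) : ℝ → ℝ≥0∞ :=
  (Ioi (1 : ℝ)).indicator (opP φ k t ν)

theorem opPExt_apply {φ : ℂ → ℂ} {k : ℕ} {t : ℝ} {ν : ℝ → ℝ≥0∞} {r : ℝ} (hr : 1 < r) :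
    opPExt φ k t ν r = opP φ k t ν r := indicator_of_mem hr _

/-- Nothing is known about `φ` off the exterior disc, so a jointly measurable kernel is built from
its cut-off and agrees with the true one for `r > 1`. -/
theorem measurable_weightP_mul {φ : ℂ → ℂ} (hφ : IsSigmaPrime φ) {k : ℕ} (hk : 1 ≤ k) (t : ℝ)
    {ν : ℝ → ℝ≥0∞} (hν : Measurable ν) :
    ∃ W : ℝ × ℝ → ℝ≥0∞, Measurable W ∧ ∀ r, 1 < r → ∀ x,
      W (r, x) = ENNReal.ofReal (weightP φ k t r x) * ν ‖φ (rootPt k r x)‖ := by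
  have hroot : Measurable fun p : ℝ × ℝ => rootPt k p.1 p.2 := by
    unfold rootPt circleMap
    fun_prop
  have h1 := hφ.measurable_indicator.comp hroot
  have h2 := (measurable_deriv φ).comp hroot
  refine ⟨fun p => ENNReal.ofReal (p.1 ^ (1 - ((k : ℝ) - 1) * t / k) *
    (‖deriv φ (rootPt k p.1 p.2)‖ ^ t / ‖extDisk.indicator φ (rootPt k p.1 p.2)‖) /
      (2 * Real.pi)) * ν ‖extDisk.indicator φ (rootPt k p.1 p.2)‖, ?_, fun r hr x => ?_⟩
  · refine Measurable.mul (Measurable.ennreal_ofReal ?_) (hν.comp h1.norm)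
    exact ((measurable_fst.pow_const _).mul ((h2.norm.pow_const t).div h1.norm)).div_const _
  · simp only [indicator_of_mem (rootPt_mem_extDisk hk hr x)]
    rfl

theorem measurable_opPExt {φ : ℂ → ℂ} (hφ : IsSigmaPrime φ) {k : ℕ} (hk : 1 ≤ k) (t : ℝ)
    {ν : ℝ → ℝ≥0∞} (hν : Measurable ν) : Measurable (opPExt φ k t ν) := by
  obtain ⟨W, hW, hWe⟩ := measurable_weightP_mul hφ hk t hν
  have : opPExt φ k t ν =
      (Ioi (1 : ℝ)).indicator fun r => ∫⁻ x in Ioc (0 : ℝ) (2 * Real.pi), W (r, x) := by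
    refine indicator_congr fun r hr => ?_
    simp only [hWe r hr, opP]
  rw [this]
  exact hW.lintegral_prod_right'.indicator measurableSet_Ioi

theorem enorm_rpow_eq_ofReal {w : ℂ} (hw : w ≠ 0) (t : ℝ) :
    ‖w‖ₑ ^ t = ENNReal.ofReal (‖w‖ ^ t) := by
  rw [← ofReal_norm, ENNReal.ofReal_rpow_of_pos (norm_pos_iff.2 hw)]

/-- The quantity `ν(|φ|) |φ|⁻¹ |φ'|^t` at the point `u`. -/
def blockTerm (φ : ℂ → ℂ) (t : ℝ) (ν : ℝ → ℝ≥0∞) (u : ℂ) : ℝ≥0∞ :=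
  ν ‖φ u‖ * (ENNReal.ofReal ‖φ u‖)⁻¹ * ‖deriv φ u‖ₑ ^ t

theorem measurable_indicator_blockTerm {φ : ℂ → ℂ} (hφ : IsSigmaPrime φ) (t : ℝ)
    {ν : ℝ → ℝ≥0∞} (hν : Measurable ν) : Measurable (extDisk.indicator (blockTerm φ t ν)) := by
  have h1 := hφ.measurable_indicator
  have h2 := measurable_deriv φ
  have : extDisk.indicator (blockTerm φ t ν) = extDisk.indicator fun u =>
      ν ‖extDisk.indicator φ u‖ * (ENNReal.ofReal ‖extDisk.indicator φ u‖)⁻¹ *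
        ‖deriv φ u‖ₑ ^ t := by
    refine indicator_congr fun u hu => ?_
    rw [indicator_of_mem hu, blockTerm]
  rw [this]
  exact (((hν.comp h1.norm).mul h1.norm.ennreal_ofReal.inv).mul
    (h2.enorm.pow_const t)).indicator isOpen_extDisk.measurableSet

/-- Apart from a power of the radius, `P` is the mean of `blockTerm` over the circle of radius `s`:
the form in which it emerges from averaging a random rotation. -/
theorem opP_pow_eq {φ : ℂ → ℂ} (hφ : IsSigmaPrime φ) {k : ℕ} (hk : 1 ≤ k) (t : ℝ)
    (ν : ℝ → ℝ≥0∞) {s : ℝ} (hs : 1 < s) :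
    opP φ k t ν (s ^ k) = ENNReal.ofReal ((s ^ k) ^ (1 - ((k : ℝ) - 1) * t / k)) *
      (ENNReal.ofReal (1 / (2 * Real.pi)) * ∫⁻ x in Ioc 0 (2 * Real.pi),
        blockTerm φ t ν (circleMap 0 s x)) := by
  rw [← lintegral_const_mul' _ _ ENNReal.ofReal_ne_top,
    ← lintegral_const_mul' _ _ ENNReal.ofReal_ne_top, opP]
  refine lintegral_congr fun x => ?_
  have hz := circleMap_mem_extDisk hs x
  have h1 : 0 < ‖φ (circleMap 0 s x)‖ :=
    (norm_pos_iff.2 (extDisk_ne_zero hz)).trans_le (hφ.le_norm hz)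
  rw [blockTerm, weightP, rootPt_pow hk (by linarith), enorm_rpow_eq_ofReal (hφ.deriv_ne_zero hz),
    ← ENNReal.ofReal_inv_of_pos h1, mul_assoc (ν _), ← ENNReal.ofReal_mul (by positivity),
    mul_left_comm _ (ν _), mul_left_comm _ (ν _), ← ENNReal.ofReal_mul (by positivity),
    ← ENNReal.ofReal_mul (by positivity), mul_comm]
  congr 2
  ring

section

variable {φ l : ℂ → ℂ} {b : ℂ} {k : ℕ}

theorem pow_mem_extDisk (hk : 1 ≤ k) {z : ℂ} (hz : z ∈ extDisk) : z ^ k ∈ extDisk := by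
  rw [extDisk, mem_ofPred_eq, norm_pow]
  exact one_lt_pow₀ hz (by omega)

theorem IsLogOf.rootLim_cons (h : IsLogOf φ l b) (hk : 2 ≤ k) (a : UnitAddCircle)
    (θ : ℕ → UnitAddCircle) {z : ℂ} (hz : z ∈ extDisk) :
    rootLim l k (rotSeq (consAngle a θ)) 1 z =
      Snowflake.rot φ a (rootLim l k (rotSeq θ) k z) := by
  have hg : rootLim l k (rotSeq θ) k z ∈ extDisk := lt_of_lt_of_le hz
    (le_norm_rootLim h.differentiableOn h.re_nonneg hk (by omega) (norm_rotSeq θ) hz)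
  rw [rootLim_eq h.differentiableOn h.re_nonneg hk le_rfl (norm_rotSeq _) hz, h.rot_eq a hg,
    one_mul]
  rfl

/-- Chain rule for `φ_a ∘ g`. Only moduli enter, so the outer rotation drops out and the inner one
rotates `g z`. -/
theorem IsLogOf.momentTerm_cons (h : IsLogOf φ l b) (hφ : IsSigmaPrime φ) (hk : 2 ≤ k) (t : ℝ)
    (ν : ℝ → ℝ≥0∞) (a : UnitAddCircle) (θ : ℕ → UnitAddCircle) {z : ℂ} (hz : z ∈ extDisk) :
    momentTerm l k t ν (consAngle a θ) z =
      blockTerm φ t ν ((AddCircle.toCircle (-a) : ℂ) * rootLim l k (rotSeq θ) k z) *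
        ‖deriv (rootLim l k (rotSeq θ) k) z‖ₑ ^ t := by
  have hgm : ∀ w ∈ extDisk, rootLim l k (rotSeq θ) k w ∈ extDisk := fun w hw =>
    lt_of_lt_of_le hw
      (le_norm_rootLim h.differentiableOn h.re_nonneg hk (by omega) (norm_rotSeq θ) hw)
  set g := rootLim l k (rotSeq θ) k with hg
  have hgd : DifferentiableAt ℂ g z :=
    (differentiableOn_rootLim h.differentiableOn h.re_nonneg hk (by omega)
      (norm_rotSeq θ)).differentiableAt (isOpen_extDisk.mem_nhds hz)
  have hu : g z * (AddCircle.toCircle (-a) : ℂ) ∈ extDisk := by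
    rw [extDisk, mem_ofPred_eq, norm_mul, Circle.norm_coe, mul_one]
    exact hgm z hz
  have hev : rootLim l k (rotSeq (consAngle a θ)) 1 =ᶠ[𝓝 z] fun w =>
      (AddCircle.toCircle a : ℂ) * φ (g w * (AddCircle.toCircle (-a) : ℂ)) := by
    filter_upwards [isOpen_extDisk.mem_nhds hz] with w hw
    exact h.rootLim_cons hk a θ hw
  have hder : HasDerivAt (fun w => (AddCircle.toCircle a : ℂ) *
      φ (g w * (AddCircle.toCircle (-a) : ℂ)))
      ((AddCircle.toCircle a : ℂ) * (deriv φ (g z * (AddCircle.toCircle (-a) : ℂ)) *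
        (deriv g z * (AddCircle.toCircle (-a) : ℂ)))) z :=
    ((hφ.differentiableAt hu).hasDerivAt.comp z (hgd.hasDerivAt.mul_const _)).const_mul _
  rw [momentTerm, rootLimDeriv_eq h.differentiableOn h.re_nonneg hk le_rfl _ hz, hev.deriv_eq,
    hder.deriv, hev.eq_of_nhds, mul_comm (AddCircle.toCircle (-a) : ℂ),
    blockTerm]
  simp only [norm_mul, Circle.norm_coe, one_mul, enorm_mul, mul_assoc]
  have hone : ∀ c : Circle, ‖(c : ℂ)‖ₑ = 1 := fun c => by
    rw [← ofReal_norm, Circle.norm_coe, ENNReal.ofReal_one]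
  rw [hone, hone, one_mul, mul_one, ENNReal.mul_rpow_of_ne_top enorm_ne_top enorm_ne_top]

theorem IsLogOf.norm_rootLim_pow (h : IsLogOf φ l b) (hk : 2 ≤ k)
    (θ : ℕ → UnitAddCircle) {z : ℂ} (hz : z ∈ extDisk) :
    ‖rootLim l k (rotSeq θ) 1 (z ^ k)‖ = ‖rootLim l k (rotSeq θ) k z‖ ^ k := by
  rw [← norm_pow, ← rootLim_mul_pow h.differentiableOn h.re_nonneg hk le_rfl (norm_rotSeq θ) hz,
    one_mul]

/-- Differentiate `g(z) ^ k = f̃(z ^ k)`; the factor `k` cancels. -/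
theorem IsLogOf.norm_deriv_rootLim (h : IsLogOf φ l b) (hk : 2 ≤ k)
    (θ : ℕ → UnitAddCircle) {z : ℂ} (hz : z ∈ extDisk) :
    ‖deriv (rootLim l k (rotSeq θ) k) z‖ =
      ‖deriv (rootLim l k (rotSeq θ) 1) (z ^ k)‖ *
        (‖z‖ ^ (k - 1) / ‖rootLim l k (rotSeq θ) k z‖ ^ (k - 1)) := by
  have hzk := pow_mem_extDisk (k := k) (by omega) hz
  have hgz : rootLim l k (rotSeq θ) k z ≠ 0 := extDisk_ne_zero (lt_of_lt_of_le hz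
    (le_norm_rootLim h.differentiableOn h.re_nonneg hk (by omega) (norm_rotSeq θ) hz))
  set g := rootLim l k (rotSeq θ) k with hg
  have hgd : DifferentiableAt ℂ g z :=
    (differentiableOn_rootLim h.differentiableOn h.re_nonneg hk (by omega)
      (norm_rotSeq θ)).differentiableAt (isOpen_extDisk.mem_nhds hz)
  have hfd : DifferentiableAt ℂ (rootLim l k (rotSeq θ) 1) (z ^ k) :=
    (differentiableOn_rootLim h.differentiableOn h.re_nonneg hk le_rfl
      (norm_rotSeq θ)).differentiableAt (isOpen_extDisk.mem_nhds hzk)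
  have h1 := hgd.hasDerivAt.pow k
  have h2 := hfd.hasDerivAt.comp z (hasDerivAt_pow k z)
  have hev : (fun w => g w ^ k) =ᶠ[𝓝 z] rootLim l k (rotSeq θ) 1 ∘ fun w => w ^ k := by
    filter_upwards [isOpen_extDisk.mem_nhds hz] with w hw
    have := rootLim_mul_pow h.differentiableOn h.re_nonneg hk le_rfl (norm_rotSeq θ) hw
    rw [one_mul] at this
    exact this
  have h3 := h1.unique (h2.congr_of_eventuallyEq hev)
  have h4 := congrArg norm h3
  simp only [norm_mul, norm_pow, Complex.norm_natCast] at h4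
  have hk0 : (0 : ℝ) < k := by exact_mod_cast (by omega : 0 < k)
  have hg0 : 0 < ‖g z‖ := norm_pos_iff.2 hgz
  field_simp
  have h5 : (k : ℝ) * (‖deriv g z‖ * ‖g z‖ ^ (k - 1)) =
    k * (‖deriv (rootLim l k (rotSeq θ) 1) (z ^ k)‖ * ‖z‖ ^ (k - 1)) := by
    linear_combination h4
  exact mul_left_cancel₀ hk0.ne' h5

theorem IsLogOf.lintegral_momentTerm_cons (h : IsLogOf φ l b) (hφ : IsSigmaPrime φ)
    (hk : 2 ≤ k) (t : ℝ) {ν : ℝ → ℝ≥0∞} (hν : Measurable ν) (θ : ℕ → UnitAddCircle) {z : ℂ}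
    (hz : z ∈ extDisk) :
    ∫⁻ a, momentTerm l k t ν (consAngle a θ) z ∂AddCircle.haarAddCircle =
      ENNReal.ofReal (1 / (2 * Real.pi)) * (∫⁻ x in Ioc 0 (2 * Real.pi),
        blockTerm φ t ν (circleMap 0 ‖rootLim l k (rotSeq θ) k z‖ x)) *
        ‖deriv (rootLim l k (rotSeq θ) k) z‖ₑ ^ t := by
  have hgz : 1 < ‖rootLim l k (rotSeq θ) k z‖ := lt_of_lt_of_le hz
    (le_norm_rootLim h.differentiableOn h.re_nonneg hk (by omega) (norm_rotSeq θ) hz)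
  rw [← lintegral_haar_toCircle_neg_mul, ← lintegral_mul_const]
  · exact lintegral_congr fun a => h.momentTerm_cons hφ hk t ν a θ hz
  have hc : Measurable fun a : UnitAddCircle =>
      (AddCircle.toCircle (-a) : ℂ) * rootLim l k (rotSeq θ) k z := by
    refine Measurable.mul_const ?_ _
    exact ((continuous_subtype_val.comp AddCircle.continuous_toCircle).comp
      continuous_neg).measurable
  have he : (fun a : UnitAddCircle => blockTerm φ t ν ((AddCircle.toCircle (-a) : ℂ) *
      rootLim l k (rotSeq θ) k z)) = fun a : UnitAddCircle =>
        extDisk.indicator (blockTerm φ t ν)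
          ((AddCircle.toCircle (-a) : ℂ) * rootLim l k (rotSeq θ) k z) := by
    funext a
    have hmem : (AddCircle.toCircle (-a) : ℂ) * rootLim l k (rotSeq θ) k z ∈ extDisk := by
      rw [extDisk, mem_ofPred_eq, norm_mul, Circle.norm_coe, one_mul]
      exact hgz
    rw [indicator_of_mem hmem]
  rw [he]
  exact (measurable_indicator_blockTerm hφ t hν).comp hc

/-- With `s = |g z|`, this explains the power in `P`: it appears at `r = s ^ k`, next to `(s ^
k)⁻¹`, which is the factor `|f̃|⁻¹` of the new moment. -/
theorem div_pow_rpow_eq (hk : 1 ≤ k) (t : ℝ) {x s : ℝ} (hx : 0 < x) (hs : 0 < s) :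
    (x ^ (k - 1) / s ^ (k - 1)) ^ t = x ^ (((k : ℝ) - 1) * t) *
      ((s ^ k) ^ (1 - ((k : ℝ) - 1) * t / k) * (s ^ k)⁻¹) := by
  have hk0 : (0 : ℝ) < k := by exact_mod_cast hk
  have hpow : ∀ a : ℝ, 0 < a → (a ^ (k - 1)) ^ t = a ^ (((k : ℝ) - 1) * t) := fun a ha => by
    rw [← Real.rpow_natCast a, ← Real.rpow_mul ha.le, Nat.cast_sub hk, Nat.cast_one]
  have hs1 : (s ^ k) ^ (1 - ((k : ℝ) - 1) * t / k) = s ^ k / s ^ (((k : ℝ) - 1) * t) := by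
    rw [← Real.rpow_natCast, ← Real.rpow_mul hs.le, ← Real.rpow_sub hs]
    congr 1
    field_simp
  rw [Real.div_rpow (by positivity) (by positivity), hpow _ hx, hpow _ hs, hs1]
  field_simp

/-- The one-step recursion for the moments: the outermost building block acts by `P`. -/
theorem IsLogOf.moment_eq (h : IsLogOf φ l b) (hl : Measurable l) (hφ : IsSigmaPrime φ)
    (hk : 2 ≤ k) (t : ℝ) {ν : ℝ → ℝ≥0∞} (hν : Measurable ν) {z : ℂ} (hz : z ∈ extDisk) :
    moment l k t ν z = ENNReal.ofReal (‖z‖ ^ (((k : ℝ) - 1) * t)) *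
      moment l k t (opPExt φ k t ν) (z ^ k) := by
  have hk1 : 1 ≤ k := by omega
  have hpair : Measurable fun θ : ℕ → UnitAddCircle => (θ, z) := measurable_prodMk_right
  have hmt := (measurable_momentTerm hl k t hν).comp hpair
  have hang := lintegral_angleLaw hmt
  simp only [Function.comp] at hang
  rw [moment, hang, moment, ← lintegral_const_mul' _ _ ENNReal.ofReal_ne_top]
  refine lintegral_congr fun θ => ?_
  have hzk := pow_mem_extDisk hk1 hz
  have hgz : 1 < ‖rootLim l k (rotSeq θ) k z‖ := lt_of_lt_of_le hz
    (le_norm_rootLim h.differentiableOn h.re_nonneg hk (by omega) (norm_rotSeq θ) hz)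
  have hz0 : 0 < ‖z‖ := norm_pos_iff.2 (extDisk_ne_zero hz)
  rw [h.lintegral_momentTerm_cons hφ hk t hν θ hz, momentTerm, h.norm_rootLim_pow hk θ hz,
    opPExt_apply (one_lt_pow₀ hgz (by omega)), opP_pow_eq hφ hk1 t ν hgz,
    rootLimDeriv_eq h.differentiableOn h.re_nonneg hk le_rfl _ hzk,
    ← ofReal_norm (deriv (rootLim l k (rotSeq θ) k) z), h.norm_deriv_rootLim hk θ hz,
    ENNReal.ofReal_mul (norm_nonneg _), ofReal_norm]
  generalize ‖rootLim l k (rotSeq θ) k z‖ = s at hgz ⊢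
  have hs0 : 0 < s := by linarith
  generalize ENNReal.ofReal (1 / (2 * Real.pi)) * _ = A
  rw [ENNReal.mul_rpow_of_ne_top enorm_ne_top ENNReal.ofReal_ne_top]
  generalize ‖deriv (rootLim l k (rotSeq θ) 1) (z ^ k)‖ₑ ^ t = B
  rw [ENNReal.ofReal_rpow_of_pos (by positivity), ← ENNReal.ofReal_inv_of_pos (by positivity),
    div_pow_rpow_eq hk1 t hz0 hs0, ENNReal.ofReal_mul (by positivity),
    ENNReal.ofReal_mul (by positivity)]
  ring

/-- The weighted integral `∫_1^ρ r^{t-1} (log r)^{β-1} ∫ 𝔼[ν(|f|) |f|⁻¹ |f'|^t] dθ dr`. -/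
def momentIntegral (l : ℂ → ℂ) (k : ℕ) (t β : ℝ) (ν : ℝ → ℝ≥0∞) (ρ : ℝ) : ℝ≥0∞ :=
  ∫⁻ r in Ioo (1 : ℝ) ρ, ENNReal.ofReal (r ^ (t - 1) * Real.log r ^ (β - 1)) *
    ∫⁻ x in Ioc 0 (2 * Real.pi), moment l k t ν (circleMap 0 r x)

/-- The weight is chosen so that `r = s ^ k` scales exactly: `log (s ^ k) = k log s` and
`ds`-Jacobian give `k ^ β`, and the powers of `s` match since `(k - 1) + k (t - 1) = (t - 1) + (k -
1) t`. -/
theorem IsLogOf.momentIntegral_pow (h : IsLogOf φ l b) (hl : Measurable l)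
    (hφ : IsSigmaPrime φ) (hk : 2 ≤ k) (t β : ℝ) {ν : ℝ → ℝ≥0∞} (hν : Measurable ν) {ρ : ℝ}
    (hρ : 1 < ρ) :
    momentIntegral l k t β (opPExt φ k t ν) (ρ ^ k) =
      ENNReal.ofReal ((k : ℝ) ^ β) * momentIntegral l k t β ν ρ := by
  have hk1 : 1 ≤ k := by omega
  have hk0 : (0 : ℝ) < k := by exact_mod_cast hk1
  have hset : ∀ (σ : ℝ) (H : ℝ → ℝ≥0∞), ∫⁻ r in Ioo 1 σ, H r =
      ∫⁻ r in Ioi (1 : ℝ), (Iio σ).indicator H r := fun σ H => by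
    rw [setLIntegral_indicator measurableSet_Iio, inter_comm, Ioi_inter_Iio]
  rw [momentIntegral, momentIntegral, hset, hset, setLIntegral_Ioi_pow hk1,
    ← lintegral_const_mul' _ _ ENNReal.ofReal_ne_top]
  refine setLIntegral_congr_fun measurableSet_Ioi fun s hs => ?_
  have hs1 : (1 : ℝ) < s := hs
  have hs0 : (0 : ℝ) < s := by linarith
  by_cases hsρ : s < ρ
  swap
  · have h1 : ¬ s ^ k < ρ ^ k := not_lt.2 (pow_le_pow_left₀ (by linarith) (not_lt.1 hsρ) k)
    rw [indicator_of_notMem (by exact h1), indicator_of_notMem (by exact hsρ), mul_zero, mul_zero]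
  have h1 : s ^ k < ρ ^ k := pow_lt_pow_left₀ hsρ hs0.le (by omega)
  rw [indicator_of_mem (by exact h1), indicator_of_mem (by exact hsρ)]
  have hPm := measurable_moment hl k t (measurable_opPExt hφ hk1 t hν)
  have h2 : ∫⁻ x in Ioc 0 (2 * Real.pi), moment l k t ν (circleMap 0 s x) =
      ENNReal.ofReal (s ^ (((k : ℝ) - 1) * t)) * ∫⁻ x in Ioc 0 (2 * Real.pi),
        moment l k t (opPExt φ k t ν) (circleMap 0 (s ^ k) x) := by
    rw [← setLIntegral_Ioc_nat_mul (periodic_comp_circleMap _ (s ^ k))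
      (hPm.comp (continuous_circleMap 0 (s ^ k)).measurable) hk,
      ← lintegral_const_mul' _ _ ENNReal.ofReal_ne_top]
    refine lintegral_congr fun x => ?_
    rw [h.moment_eq hl hφ hk t hν (circleMap_mem_extDisk hs1 x), norm_circleMap_zero,
      abs_of_pos hs0]
    congr 2
    simp only [circleMap_zero, mul_pow, ← Complex.exp_nat_mul]
    push_cast
    ring_nf
  rw [h2, ← mul_assoc, ← mul_assoc, ← mul_assoc]
  congr 1
  have hlog : 0 < Real.log s := Real.log_pos hs1
  rw [← ENNReal.ofReal_mul (by positivity), ← ENNReal.ofReal_mul (by positivity),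
    ← ENNReal.ofReal_mul (by positivity)]
  congr 1
  rw [Real.log_pow, Real.mul_rpow hk0.le hlog.le]
  have e1 : (k : ℝ) ^ β = k * (k : ℝ) ^ (β - 1) := by
    rw [Real.rpow_sub_one hk0.ne']
    field_simp
  have e2 : s ^ (k - 1) * (s ^ k) ^ (t - 1) = s ^ (t - 1) * s ^ (((k : ℝ) - 1) * t) := by
    rw [← Real.rpow_natCast s (k - 1), ← Real.rpow_natCast s k, ← Real.rpow_mul hs0.le,
      ← Real.rpow_add hs0, ← Real.rpow_add hs0, Nat.cast_sub hk1]
    congr 1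
    push_cast
    ring
  rw [e1]
  linear_combination (k * (k : ℝ) ^ (β - 1) * Real.log s ^ (β - 1)) * e2

end

/-! ### Moduli of values of holomorphic functions -/

theorem ae_norm_notMem {Z : Set ℝ} (hZm : MeasurableSet Z) (hZ : volume Z = 0) :
    ∀ᵐ w : ℂ, ‖w‖ ∉ Z := by
  set W : Set ℂ := norm ⁻¹' Z
  have hW : MeasurableSet W := measurable_norm hZm
  have h1 := lintegral_eq_polar (measurable_one.indicator hW)
  rw [lintegral_indicator_one hW] at h1
  suffices h : volume W = 0 from measure_eq_zero_iff_ae_notMem.1 h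
  rw [h1]
  have h2 : ∀ᵐ s ∂(volume.restrict (Ioi (0 : ℝ))), ENNReal.ofReal s *
      ∫⁻ x in Ioc 0 (2 * Real.pi), W.indicator (1 : ℂ → ℝ≥0∞) (circleMap 0 s x) = 0 := by
    rw [ae_restrict_iff' measurableSet_Ioi]
    filter_upwards [measure_eq_zero_iff_ae_notMem.1 hZ] with s hs hs0
    have : ∀ x, W.indicator (1 : ℂ → ℝ≥0∞) (circleMap 0 s x) = 0 := fun x => by
      refine indicator_of_notMem (fun hx => hs ?_) _
      simpa [W, abs_of_pos (show (0 : ℝ) < s from hs0)] using hx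
    simp [this]
  rw [lintegral_congr_ae h2, lintegral_zero]

section

variable {F : ℂ → ℂ} {ρ : ℝ}

theorem isOpen_norm_gt (ρ : ℝ) : IsOpen {z : ℂ | ρ < ‖z‖} :=
  isOpen_lt continuous_const continuous_norm

theorem ofReal_norm_gt {ρ s : ℝ} (hρ : 1 ≤ ρ) (hs : ρ < s) : ρ < ‖(s : ℂ)‖ := by
  rw [Complex.norm_real, Real.norm_of_nonneg (by linarith)]
  exact hs

theorem not_constant_of_le_norm (hρ : 1 ≤ ρ) (hF : ∀ z, ρ < ‖z‖ → ‖z‖ ≤ ‖F z‖) :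
    ¬ ∃ w, ∀ z, ρ < ‖z‖ → F z = w := by
  rintro ⟨w, hw⟩
  have h1 : ρ < ρ + ‖w‖ + 1 := by linarith [norm_nonneg w]
  have h2 := ofReal_norm_gt hρ h1
  have h3 := hF _ h2
  rw [hw _ h2, Complex.norm_real, Real.norm_of_nonneg (by linarith [norm_nonneg w])] at h3
  linarith

/-- The lower bound on the modulus excludes constants, so the zeros of the derivative are discrete
and hence null. -/
theorem ae_deriv_ne_zero (hρ : 1 ≤ ρ) (hd : DifferentiableOn ℂ F {z | ρ < ‖z‖})
    (hF : ∀ z, ρ < ‖z‖ → ‖z‖ ≤ ‖F z‖) : ∀ᵐ z : ℂ, ρ < ‖z‖ → deriv F z ≠ 0 := by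
  have hopen := isOpen_norm_gt ρ
  have hpre : IsPreconnected {z : ℂ | ρ < ‖z‖} := isPreconnected_norm_gt (by linarith)
  have hmem : ((ρ + 1 : ℝ) : ℂ) ∈ {z : ℂ | ρ < ‖z‖} := ofReal_norm_gt hρ (by linarith)
  obtain ⟨x, hx, hdx⟩ : ∃ x ∈ {z : ℂ | ρ < ‖z‖}, deriv F x ≠ 0 := by
    by_contra! hcon
    exact not_constant_of_le_norm hρ hF ⟨F ((ρ + 1 : ℝ) : ℂ), fun z hz =>
      hopen.is_const_of_deriv_eq_zero hpre hd hcon hz hmem⟩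
  have han : AnalyticOnNhd ℂ (deriv F) {z : ℂ | ρ < ‖z‖} := (hd.analyticOnNhd hopen).deriv
  have h1 := ae_restrict_le_codiscreteWithin (μ := (volume : Measure ℂ)) hopen.measurableSet
    (han.preimage_zero_mem_codiscreteWithin hdx hx ⟨⟨_, hmem⟩, hpre⟩)
  exact (ae_restrict_iff' hopen.measurableSet).1 h1

/-- The modulus of a nonconstant holomorphic function is nonsingular. -/
theorem ae_norm_comp_notMem (hρ : 1 ≤ ρ) (hd : DifferentiableOn ℂ F {z | ρ < ‖z‖})
    (hF : ∀ z, ρ < ‖z‖ → ‖z‖ ≤ ‖F z‖) {Z : Set ℝ} (hZm : MeasurableSet Z)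
    (hZ : volume Z = 0) : ∀ᵐ z : ℂ, ρ < ‖z‖ → ‖F z‖ ∉ Z := by
  classical
  have hopen := isOpen_norm_gt ρ
  have hFm : Measurable ({z : ℂ | ρ < ‖z‖}.indicator F) := by
    rw [← piecewise_eq_indicator]
    exact hd.continuousOn.measurable_piecewise continuousOn_const hopen.measurableSet
  set W : Set ℂ := norm ⁻¹' Z with hW
  have hWm : MeasurableSet W := measurable_norm hZm
  have hW0 : volume W = 0 := measure_eq_zero_iff_ae_notMem.2 (ae_norm_notMem hZm hZ)
  set A : Set ℂ := {z | ρ < ‖z‖ ∧ F z ∈ W ∧ deriv F z ≠ 0} with hA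
  have hA0 : volume A = 0 := by
    -- Near a noncritical point `F` is injective, and the integral of `|F'|²` over the preimage of a
    -- null set vanishes by change of variables.
    refine measure_null_of_locally_null A fun z₀ hz₀ => ?_
    have hst : HasStrictDerivAt F (deriv F z₀) z₀ :=
      (hd.analyticAt (hopen.mem_nhds hz₀.1)).hasStrictDerivAt
    have hev := (hst.eventually_left_inverse hz₀.2.2).and (hopen.mem_nhds hz₀.1)
    obtain ⟨V, hV, hVo, hzV⟩ := eventually_nhds_iff.1 hev
    have hinj : InjOn F V := fun x hx y hy hxy => by
      rw [← (hV x hx).1, hxy, (hV y hy).1]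
    set S := V ∩ {z : ℂ | ρ < ‖z‖}.indicator F ⁻¹' W with hS
    have hSm : MeasurableSet S := hVo.measurableSet.inter (hFm hWm)
    have hSV : ∀ z ∈ S, ρ < ‖z‖ := fun z hz => (hV z hz.1).2
    have hSW : F '' S ⊆ W := by
      rintro _ ⟨z, hz, rfl⟩
      have := hz.2
      rwa [mem_preimage, indicator_of_mem (by exact hSV z hz)] at this
    have h1 := lintegral_image_eq_of_injOn hSm
      (fun z hz => hd.differentiableAt (hopen.mem_nhds (hSV z hz)))
      (hinj.mono inter_subset_left) (fun _ => 1)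
    rw [setLIntegral_measure_zero _ _ (measure_mono_null hSW hW0)] at h1
    simp only [mul_one] at h1
    have h2 := (lintegral_eq_zero_iff
      ((measurable_deriv F).norm.pow_const 2).ennreal_ofReal).1 h1.symm
    rw [EventuallyEq, ae_restrict_iff' hSm] at h2
    refine ⟨V ∩ A, inter_mem (mem_nhdsWithin_of_mem_nhds (hVo.mem_nhds hzV)) self_mem_nhdsWithin,
      measure_mono_null (fun z hz => ?_) h2⟩
    have hzS : z ∈ S := ⟨hz.1, by
      rw [mem_preimage, indicator_of_mem (by exact hz.2.1)]
      exact hz.2.2.1⟩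
    have hne := hz.2.2.2
    intro hcon
    have := hcon hzS
    simp [hne] at this
  filter_upwards [measure_eq_zero_iff_ae_notMem.1 hA0, ae_deriv_ne_zero hρ hd hF] with z h1 h2 hz
      hzZ
  exact h1 ⟨hz, hzZ, h2 hz⟩

/-- Intermediate values along the ray through `z₀`, where `‖F‖` grows without bound. -/
theorem exists_norm_eq (hρ : 1 ≤ ρ) (hd : DifferentiableOn ℂ F {z | ρ < ‖z‖})
    (hF : ∀ z, ρ < ‖z‖ → ‖z‖ ≤ ‖F z‖) {z₀ : ℂ} (hz₀ : ρ < ‖z₀‖) {s : ℝ} (hs : ‖F z₀‖ < s) :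
    ∃ z, ρ < ‖z‖ ∧ ‖F z‖ = s := by
  have h0 : 1 < ‖z₀‖ := lt_of_le_of_lt hρ hz₀
  have hs0 : 1 < s := (h0.trans_le (hF z₀ hz₀)).trans hs
  have hn : ∀ τ : ℝ, 1 ≤ τ → ‖(τ : ℂ) * z₀‖ = τ * ‖z₀‖ := fun τ hτ => by
    rw [norm_mul, Complex.norm_real, Real.norm_of_nonneg (by linarith)]
  have hmem : ∀ τ : ℝ, 1 ≤ τ → ρ < ‖(τ : ℂ) * z₀‖ := fun τ hτ => by
    rw [hn τ hτ]; nlinarith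
  have hc : ContinuousOn (fun τ : ℝ => ‖F ((τ : ℂ) * z₀)‖) (Icc 1 s) := by
    refine (hd.continuousOn.comp (by fun_prop) fun τ hτ => hmem τ hτ.1).norm
  obtain ⟨τ, hτ, hτs⟩ := intermediate_value_Icc hs0.le hc
    (show s ∈ Icc _ _ from ⟨by simpa using hs.le, by
      refine le_trans ?_ (hF _ (hmem s hs0.le))
      rw [hn s hs0.le]; nlinarith⟩)
  exact ⟨_, hmem τ hτ.1, hτs⟩

/-- If `|F|` almost surely avoids `Z`, then almost every point beyond a value of `|F|` is
outside `Z`. -/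
theorem ae_notMem_of_ae_norm_comp_notMem (hρ : 1 ≤ ρ) (hd : DifferentiableOn ℂ F {z | ρ < ‖z‖})
    (hF : ∀ z, ρ < ‖z‖ → ‖z‖ ≤ ‖F z‖) {Z : Set ℝ} (hZm : MeasurableSet Z)
    (hZ : ∀ᵐ z : ℂ, ρ < ‖z‖ → ‖F z‖ ∉ Z) {z₀ : ℂ} (hz₀ : ρ < ‖z₀‖) :
    ∀ᵐ s : ℝ, ‖F z₀‖ < s → s ∉ Z := by
  have hopen := isOpen_norm_gt ρ
  have hpre : IsPreconnected {z : ℂ | ρ < ‖z‖} := isPreconnected_norm_gt (by linarith)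
  set A : Set ℂ := {z | ρ < ‖z‖ ∧ ‖F z‖ ∈ Z} with hA
  have hA0 : volume A = 0 := by
    refine measure_mono_null (fun z hz => ?_) hZ
    intro hcon
    exact hcon hz.1 hz.2
  -- Differentiable maps of the plane carry null sets to null sets, so `F '' A` is null.
  have hFA : volume (F '' A) = 0 := by
    refine addHaar_image_eq_zero_of_differentiableOn_of_addHaar_eq_zero _ ?_ hA0
    exact (hd.mono fun z hz => hz.1).restrictScalars ℝ
  set E : Set ℂ := F '' {z | ρ < ‖z‖} with hE
  have hEo : IsOpen E := by
    rcases (hd.analyticOnNhd hopen).is_constant_or_isOpen hpre with h | h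
    · exact absurd h (not_constant_of_le_norm hρ hF)
    · exact h _ Subset.rfl hopen
  have hp : ∀ᵐ w : ℂ, ρ < ‖w‖ → ¬ (w ∈ E ∧ ‖w‖ ∈ Z) := by
    filter_upwards [measure_eq_zero_iff_ae_notMem.1 hFA] with w hw _ hwE
    obtain ⟨⟨z, hz, rfl⟩, hzZ⟩ := hwE
    exact hw ⟨z, ⟨hz, hzZ⟩, rfl⟩
  have hpm : MeasurableSet {w : ℂ | ¬ (w ∈ E ∧ ‖w‖ ∈ Z)} :=
    (hEo.measurableSet.inter (measurable_norm hZm)).compl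
  filter_upwards [ae_polar hρ hpm hp] with s hs hlt hsZ
  have hs1 : ρ < s := (hz₀.trans_le (hF z₀ hz₀)).trans hlt
  have hs0 : 0 < s := by linarith
  obtain ⟨z, hz, hzs⟩ := exists_norm_eq hρ hd hF hz₀ hlt
  have h1 := hs hs1
  set O : Set ℝ := circleMap 0 s ⁻¹' E with hO
  have hOo : IsOpen O := hEo.preimage (continuous_circleMap 0 s)
  obtain ⟨x₀, hx₀, hx₀E⟩ : ∃ x₀ ∈ Ioc 0 (2 * Real.pi), x₀ ∈ O := by
    have : F z ∈ circleMap 0 s '' Ioc 0 (2 * Real.pi) := by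
      rw [image_circleMap_Ioc, abs_of_pos hs0]
      simpa using hzs
    obtain ⟨x₀, hx₀, hx₀E⟩ := this
    exact ⟨x₀, hx₀, by rw [hO, mem_preimage, hx₀E]; exact ⟨z, hz, rfl⟩⟩
  -- The circle of radius `s` meets the open image, hence in angles of positive measure. The closure
  -- covers the case `x₀ = 2π`.
  have hcl : x₀ ∈ closure (Ioo 0 (2 * Real.pi)) := by
    rw [closure_Ioo Real.two_pi_pos.ne]
    exact ⟨hx₀.1.le, hx₀.2⟩
  have hne : (O ∩ Ioo 0 (2 * Real.pi)).Nonempty := mem_closure_iff.1 hcl O hOo hx₀E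
  have hpos := (hOo.inter isOpen_Ioo).measure_pos volume hne
  refine hpos.ne' (measure_mono_null (fun x hx => ?_)
    ((ae_restrict_iff' measurableSet_Ioc).1 h1))
  intro hcon
  refine hcon ⟨hx.2.1, hx.2.2.le⟩ ⟨hx.1, ?_⟩
  rw [norm_circleMap_zero, abs_of_pos hs0]
  exact hsZ

end

/-! ### Weighted moments and the spectrum -/

theorem rpow_le_rpow_abs {M q : ℝ} (hM : 1 ≤ M) (h1 : M⁻¹ ≤ q) (h2 : q ≤ M) (s : ℝ) :
    q ^ s ≤ M ^ |s| := by
  have hM0 : 0 < M := by linarith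
  have hq : 0 < q := (inv_pos.2 hM0).trans_le h1
  rcases le_total 0 s with hs | hs
  · rw [abs_of_nonneg hs]
    exact Real.rpow_le_rpow hq.le h2 hs
  · rw [abs_of_nonpos hs, ← inv_inv q, Real.inv_rpow (inv_pos.2 hq).le,
      ← Real.rpow_neg (inv_pos.2 hq).le]
    exact Real.rpow_le_rpow (inv_pos.2 hq).le (inv_le_of_inv_le₀ hM0 h1) (by linarith)

/-- On this interval `log r / (r - 1)` lies between `(1 + δ)⁻¹` and `1`, so the scaling weight is
dominated by the one defining the spectrum. -/
theorem weight_le {δ r : ℝ} (t β : ℝ) (hr : r ∈ Ioo 1 (1 + δ)) :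
    r ^ (t - 1) * Real.log r ^ (β - 1) ≤
      (1 + δ) ^ |t - 1| * (1 + δ) ^ |β - 1| * (r - 1) ^ (β - 1) := by
  obtain ⟨hr1, hr2⟩ := hr
  have hM : 1 ≤ 1 + δ := by linarith
  have hr0 : 0 < r := by linarith
  have hs : 0 < r - 1 := by linarith
  have h1 : r ^ (t - 1) ≤ (1 + δ) ^ |t - 1| :=
    rpow_le_rpow_abs hM ((inv_le_one_of_one_le₀ hM).trans hr1.le) hr2.le _
  have h2 : (Real.log r / (r - 1)) ^ (β - 1) ≤ (1 + δ) ^ |β - 1| := by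
    refine rpow_le_rpow_abs hM ?_ ?_ _
    · rw [le_div_iff₀ hs]
      refine le_trans ?_ (Real.one_sub_inv_le_log_of_pos hr0)
      have : 1 - r⁻¹ = r⁻¹ * (r - 1) := by field_simp
      rw [this]
      exact mul_le_mul_of_nonneg_right (inv_anti₀ hr0 hr2.le) hs.le
    · rw [div_le_iff₀ hs]
      nlinarith [Real.log_le_sub_one_of_pos hr0]
  have h3 : Real.log r ^ (β - 1) = (Real.log r / (r - 1)) ^ (β - 1) * (r - 1) ^ (β - 1) := by
    rw [← Real.mul_rpow (div_nonneg (Real.log_nonneg hr1.le) hs.le) hs.le,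
      div_mul_cancel₀ _ hs.ne']
  rw [h3, ← mul_assoc]
  have := Real.rpow_nonneg hs.le (β - 1)
  gcongr
  exact Real.rpow_nonneg (div_nonneg (Real.log_nonneg hr1.le) hs.le) _

section

variable {φ l : ℂ → ℂ} {b : ℂ} {k : ℕ} {t β : ℝ} {ν : ℝ → ℝ≥0∞}

theorem IsLogOf.momentTerm_le (h : IsLogOf φ l b) (hk : 2 ≤ k) {C : ℝ≥0∞} (hC : ∀ r, ν r ≤ C)
    (θ : ℕ → UnitAddCircle) {z : ℂ} (hz : z ∈ extDisk) :
    momentTerm l k t ν θ z ≤ C * ‖deriv (snowflake φ k θ) z‖ₑ ^ t := by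
  have h1 : deriv (snowflake φ k θ) z = rootLimDeriv l k 1 θ z := by
    rw [rootLimDeriv_eq h.differentiableOn h.re_nonneg hk le_rfl θ hz]
    refine Filter.EventuallyEq.deriv_eq ?_
    filter_upwards [isOpen_extDisk.mem_nhds hz] with w hw
    exact h.snowflake_eq hk θ hw
  have h2 := le_norm_rootLim h.differentiableOn h.re_nonneg hk le_rfl (norm_rotSeq θ) hz
  have h3 : (ENNReal.ofReal ‖rootLim l k (rotSeq θ) 1 z‖)⁻¹ ≤ 1 := by
    rw [ENNReal.inv_le_one, ENNReal.one_le_ofReal]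
    exact le_trans (le_of_lt hz) h2
  rw [momentTerm, h1]
  gcongr
  calc _ ≤ C * 1 := by gcongr; exact hC _
    _ = C := mul_one C

theorem IsLogOf.momentIntegral_lt_top (h : IsLogOf φ l b) (hk : 2 ≤ k) {C : ℝ≥0∞}
    (hCt : C ≠ ∞) (hC : ∀ r, ν r ≤ C) {δ : ℝ} (hfin : meanIntegral φ k t β δ < ∞) :
    momentIntegral l k t β ν (1 + δ) < ∞ := by
  set K : ℝ≥0∞ := ENNReal.ofReal ((1 + δ) ^ |t - 1| * (1 + δ) ^ |β - 1|) with hK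
  have hle : momentIntegral l k t β ν (1 + δ) ≤ (K * C) * meanIntegral φ k t β δ := by
    rw [meanIntegral, ← lintegral_const_mul' _ _ (ENNReal.mul_ne_top ENNReal.ofReal_ne_top hCt)]
    refine setLIntegral_mono' measurableSet_Ioo fun r hr => ?_
    have h1 : ∫⁻ x in Ioc 0 (2 * Real.pi), moment l k t ν (circleMap 0 r x) ≤
        C * ∫⁻ x in Ioc (0 : ℝ) (2 * Real.pi),
          ∫⁻ θ, ‖deriv (snowflake φ k θ) (circleMap 0 r x)‖ₑ ^ t ∂angleLaw := by
      rw [← lintegral_const_mul' _ _ hCt]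
      refine lintegral_mono fun x => ?_
      rw [moment, ← lintegral_const_mul' _ _ hCt]
      exact lintegral_mono fun θ => h.momentTerm_le hk hC θ (circleMap_mem_extDisk hr.1 x)
    have h2 : ENNReal.ofReal (r ^ (t - 1) * Real.log r ^ (β - 1)) ≤
        K * ENNReal.ofReal ((r - 1) ^ (β - 1)) := by
      rw [hK, ← ENNReal.ofReal_mul' (Real.rpow_nonneg (by linarith [hr.1]) _)]
      exact ENNReal.ofReal_le_ofReal (weight_le t β hr)
    calc _ ≤ (K * ENNReal.ofReal ((r - 1) ^ (β - 1))) * (C * _) := mul_le_mul' h2 h1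
      _ = _ := by ring
  exact hle.trans_lt (ENNReal.mul_lt_top
    (ENNReal.mul_lt_top ENNReal.ofReal_lt_top hCt.lt_top) hfin)

theorem IsLogOf.ae_rootLim_notMem (h : IsLogOf φ l b) (hl : Measurable l) (hk : 2 ≤ k)
    {Z : Set ℝ} (hZm : MeasurableSet Z) (hZ : volume Z = 0) :
    ∀ᵐ s : ℝ, 1 < s → ∀ᵐ x ∂(volume.restrict (Ioc 0 (2 * Real.pi))),
      ∀ᵐ θ ∂angleLaw, ‖rootLim l k (rotSeq θ) 1 (circleMap 0 s x)‖ ∉ Z := by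
  have hm := (measurable_rootLim hl k 1).norm hZm
  have hB : MeasurableSet {p : (ℕ → UnitAddCircle) × ℂ |
      1 < ‖p.2‖ → ‖rootLim l k (rotSeq p.1) 1 p.2‖ ∉ Z} := by
    have h1 : MeasurableSet {p : (ℕ → UnitAddCircle) × ℂ | 1 < ‖p.2‖} :=
      measurableSet_lt measurable_const measurable_snd.norm
    convert (h1.inter hm).compl using 1
    ext p
    simp [not_and]
  have h1 : ∀ᵐ θ ∂angleLaw, ∀ᵐ z : ℂ, 1 < ‖z‖ → ‖rootLim l k (rotSeq θ) 1 z‖ ∉ Z :=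
    Eventually.of_forall fun θ => ae_norm_comp_notMem le_rfl
      (differentiableOn_rootLim h.differentiableOn h.re_nonneg hk le_rfl (norm_rotSeq θ))
      (fun z hz => le_norm_rootLim h.differentiableOn h.re_nonneg hk le_rfl (norm_rotSeq θ) hz)
      hZm hZ
  have h2 := (Measure.ae_ae_comm hB).1 h1
  refine ae_polar le_rfl (p := fun z => ∀ᵐ θ ∂angleLaw, ‖rootLim l k (rotSeq θ) 1 z‖ ∉ Z) ?_ ?_
  · have h3 : Measurable fun z : ℂ => angleLaw {θ | ‖rootLim l k (rotSeq θ) 1 z‖ ∈ Z} :=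
      measurable_measure_prodMk_right hm
    convert h3 (measurableSet_singleton 0) using 1
    ext z
    exact measure_eq_zero_iff_ae_notMem.symm
  · filter_upwards [h2] with z hz hz1
    filter_upwards [hz] with θ hθ using hθ hz1

/-- An a.e. inequality suffices because `|f|` pulls null sets back to null sets, for almost all
points and angles. -/
theorem IsLogOf.momentIntegral_mono_ae (h : IsLogOf φ l b) (hl : Measurable l) (hk : 2 ≤ k)
    {f g : ℝ → ℝ≥0∞} (hf : Measurable f) (hg : Measurable g)
    (hfg : ∀ᵐ r : ℝ, 1 < r → f r ≤ g r) (ρ : ℝ) :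
    momentIntegral l k t β f ρ ≤ momentIntegral l k t β g ρ := by
  have hZm : MeasurableSet {r : ℝ | 1 < r ∧ g r < f r} :=
    (measurableSet_lt measurable_const measurable_id).inter (measurableSet_lt hg hf)
  have hZ : volume {r : ℝ | 1 < r ∧ g r < f r} = 0 := by
    refine measure_eq_zero_iff_ae_notMem.2 ?_
    filter_upwards [hfg] with r hr hcon
    exact absurd (hr hcon.1) (not_le.2 hcon.2)
  refine lintegral_mono_ae ?_
  rw [ae_restrict_iff' measurableSet_Ioo]
  filter_upwards [h.ae_rootLim_notMem hl hk hZm hZ] with r hr hr1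
  gcongr ENNReal.ofReal _ * ?_
  refine lintegral_mono_ae ?_
  filter_upwards [hr hr1.1] with x hx
  refine lintegral_mono_ae ?_
  filter_upwards [hx] with θ hθ
  have h1 : 1 < ‖rootLim l k (rotSeq θ) 1 (circleMap 0 r x)‖ :=
    lt_of_lt_of_le (circleMap_mem_extDisk hr1.1 x)
      (le_norm_rootLim h.differentiableOn h.re_nonneg hk le_rfl (norm_rotSeq θ)
        (circleMap_mem_extDisk hr1.1 x))
  have h2 : f ‖rootLim l k (rotSeq θ) 1 (circleMap 0 r x)‖ ≤
      g ‖rootLim l k (rotSeq θ) 1 (circleMap 0 r x)‖ := by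
    by_contra hcon
    exact hθ ⟨h1, not_le.1 hcon⟩
  rw [momentTerm, momentTerm]
  gcongr

theorem momentIntegral_const_mul {c : ℝ≥0∞} (hc : c ≠ ∞) (ρ : ℝ) :
    momentIntegral l k t β (fun r => c * ν r) ρ = c * momentIntegral l k t β ν ρ := by
  have h1 : ∀ z, moment l k t (fun r => c * ν r) z = c * moment l k t ν z := fun z => by
    rw [moment, moment, ← lintegral_const_mul' _ _ hc]
    simp only [momentTerm, mul_assoc]
  simp only [momentIntegral, h1]
  rw [← lintegral_const_mul' _ _ hc]
  congr 1
  ext r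
  rw [lintegral_const_mul' _ _ hc]
  ring

theorem momentIntegral_mono_right {ρ ρ' : ℝ} (hρ : ρ ≤ ρ') :
    momentIntegral l k t β ν ρ ≤ momentIntegral l k t β ν ρ' :=
  lintegral_mono_set (Ioo_subset_Ioo_right hρ)

/-- A bounded strict subsolution has vanishing moments if the spectral integral converges. -/
theorem IsLogOf.momentIntegral_eq_zero (h : IsLogOf φ l b) (hl : Measurable l)
    (hφ : IsSigmaPrime φ) (hk : 2 ≤ k) (hν : Measurable ν) {C : ℝ≥0∞}
    (hCt : C ≠ ∞) (hC : ∀ r, ν r ≤ C) {δ : ℝ} (hδ : 0 < δ) (hfin : meanIntegral φ k t β δ < ∞)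
    {lam : ℝ} (hlam : (k : ℝ) ^ β < lam)
    (hsub : ∀ᵐ r : ℝ, 1 < r → ENNReal.ofReal lam * ν r ≤ opP φ k t ν r) (ρ : ℝ) :
    momentIntegral l k t β ν ρ = 0 := by
  have hPm := measurable_opPExt hφ (by omega : 1 ≤ k) t hν
  have hkβ : 0 ≤ (k : ℝ) ^ β := by positivity
  have hlam0 : 0 < lam := lt_of_le_of_lt hkβ hlam
  have hmono : ∀ ρ, ENNReal.ofReal lam * momentIntegral l k t β ν ρ ≤
      momentIntegral l k t β (opPExt φ k t ν) ρ := fun ρ => by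
    rw [← momentIntegral_const_mul ENNReal.ofReal_ne_top]
    refine h.momentIntegral_mono_ae hl hk (hν.const_mul _) hPm ?_ ρ
    filter_upwards [hsub] with r hr hr1
    rw [opPExt_apply hr1]
    exact hr hr1
  have hδ1 : 1 < 1 + δ := by linarith
  -- Here `λ I(1 + δ) ≤ k ^ β I(1 + δ)` with `I(1 + δ)` finite and `k ^ β < λ`.
  have h0 : momentIntegral l k t β ν (1 + δ) = 0 := by
    have h1 := (hmono (1 + δ)).trans ((momentIntegral_mono_right
      (le_self_pow₀ hδ1.le (by omega : k ≠ 0))).trans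
        (h.momentIntegral_pow hl hφ hk t β hν hδ1).le)
    by_contra hne
    refine absurd h1 (not_le.2 ?_)
    exact ENNReal.mul_lt_mul_left hne (h.momentIntegral_lt_top hk hCt hC hfin).ne
      ((ENNReal.ofReal_lt_ofReal_iff hlam0).2 hlam)
  -- The scaling carries the vanishing from `ρ` to `ρ ^ k`, hence to arbitrarily large radii.
  have hind : ∀ n : ℕ, momentIntegral l k t β ν ((1 + δ) ^ k ^ n) = 0 := fun n => by
    induction n with
    | zero => simpa using h0
    | succ n ih =>
      have h1 := h.momentIntegral_pow hl hφ hk t β hν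
        (one_lt_pow₀ hδ1 (pow_pos (by omega : 0 < k) n).ne')
      rw [ih, mul_zero, ← pow_mul, ← pow_succ] at h1
      have h2 := hmono ((1 + δ) ^ k ^ (n + 1))
      rw [h1, nonpos_iff_eq_zero, mul_eq_zero] at h2
      exact h2.resolve_left (ENNReal.ofReal_pos.2 hlam0).ne'
  obtain ⟨n, hn⟩ := pow_unbounded_of_one_lt ρ hδ1
  refine le_antisymm ?_ zero_le
  rw [← hind n]
  exact momentIntegral_mono_right (hn.le.trans
    (pow_le_pow_right₀ hδ1.le (Nat.lt_pow_self (by omega : 1 < k)).le))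

/-- Vanishing of all the weighted moments of `ν`. -/
def MomentsVanish (l : ℂ → ℂ) (k : ℕ) (t β : ℝ) (ν : ℝ → ℝ≥0∞) : Prop :=
  ∀ ρ, momentIntegral l k t β ν ρ = 0

theorem IsLogOf.momentsVanish_opPExt (h : IsLogOf φ l b) (hl : Measurable l)
    (hφ : IsSigmaPrime φ) (hk : 2 ≤ k) (hν : Measurable ν) (hN : MomentsVanish l k t β ν) :
    MomentsVanish l k t β (opPExt φ k t ν) := by
  intro ρ
  have h1 : (1 : ℝ) < max ρ 2 := lt_max_of_lt_right one_lt_two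
  have h2 := h.momentIntegral_pow hl hφ hk t β hν h1
  rw [hN, mul_zero] at h2
  refine le_antisymm ?_ zero_le
  rw [← h2]
  exact momentIntegral_mono_right ((le_max_left ρ 2).trans
    (le_self_pow₀ h1.le (by omega : k ≠ 0)))

/-- A vanishing iterated integral of nonnegative terms; all factors except `ν(|f|)` are nonzero
a.e., the derivative because its zeros are isolated. -/
theorem ae_ae_rootLim_eq_zero (h : IsLogOf φ l b) (hl : Measurable l) (hk : 2 ≤ k)
    (hν : Measurable ν) (hN : MomentsVanish l k t β ν) :
    ∀ᵐ θ ∂angleLaw, ∀ᵐ z : ℂ, 1 < ‖z‖ → ν ‖rootLim l k (rotSeq θ) 1 z‖ = 0 := by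
  have hmm := measurable_moment hl k t hν
  have hmt := measurable_momentTerm hl k t hν
  have hcirc : ∀ r : ℝ, Measurable fun x : ℝ => circleMap 0 r x :=
    fun r => (continuous_circleMap 0 r).measurable
  have h1 : ∀ᵐ r : ℝ, 1 < r →
      ∫⁻ x in Ioc 0 (2 * Real.pi), moment l k t ν (circleMap 0 r x) = 0 := by
    have hall : ∀ᵐ r : ℝ, ∀ n : ℕ, r ∈ Ioo (1 : ℝ) n →
        ∫⁻ x in Ioc 0 (2 * Real.pi), moment l k t ν (circleMap 0 r x) = 0 := by
      refine ae_all_iff.2 fun n => ?_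
      have h2 := hN n
      rw [momentIntegral, lintegral_eq_zero_iff, EventuallyEq, ae_restrict_iff' measurableSet_Ioo]
          at h2
      · filter_upwards [h2] with r hr hr1
        have h3 := hr hr1
        simp only [Pi.zero_apply, mul_eq_zero, ENNReal.ofReal_eq_zero] at h3
        refine h3.resolve_left (not_le.2 ?_)
        exact mul_pos (Real.rpow_pos_of_pos (by linarith [hr1.1]) _)
          (Real.rpow_pos_of_pos (Real.log_pos hr1.1) _)
      · refine Measurable.mul (by fun_prop) ?_
        exact Measurable.lintegral_prod_right'
            (f := fun p : ℝ × ℝ => moment l k t ν (circleMap 0 p.1 p.2))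
          (hmm.comp measurable_circleMap)
    filter_upwards [hall] with r hr hr1
    obtain ⟨n, hn⟩ := exists_nat_gt r
    exact hr n ⟨hr1, hn⟩
  have h2 : ∀ᵐ z : ℂ, 1 < ‖z‖ → moment l k t ν z = 0 := by
    refine ae_of_polar le_rfl (hmm (measurableSet_singleton 0)) ?_
    filter_upwards [h1] with r hr hr1
    exact (lintegral_eq_zero_iff (hmm.comp (hcirc r))).1 (hr hr1)
  have hB : MeasurableSet
      {p : ℂ × (ℕ → UnitAddCircle) | 1 < ‖p.1‖ → momentTerm l k t ν p.2 p.1 = 0} := by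
    have h3 : MeasurableSet {p : ℂ × (ℕ → UnitAddCircle) | 1 < ‖p.1‖} :=
      measurableSet_lt measurable_const measurable_fst.norm
    have h4 : MeasurableSet {p : ℂ × (ℕ → UnitAddCircle) | momentTerm l k t ν p.2 p.1 = 0} :=
      (hmt.comp measurable_swap) (measurableSet_singleton 0)
    convert (h3.diff h4).compl using 1
    ext p
    simp
  have h3 : ∀ᵐ z : ℂ, ∀ᵐ θ ∂angleLaw, 1 < ‖z‖ → momentTerm l k t ν θ z = 0 := by
    filter_upwards [h2] with z hz
    by_cases hz1 : 1 < ‖z‖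
    · have h4 := (lintegral_eq_zero_iff (hmt.comp measurable_prodMk_right)).1 (hz hz1)
      filter_upwards [h4] with θ hθ _ using hθ
    · exact Eventually.of_forall fun θ h => absurd h hz1
  filter_upwards [(Measure.ae_ae_comm hB).1 h3] with θ hθ
  have hd := differentiableOn_rootLim h.differentiableOn h.re_nonneg hk le_rfl (norm_rotSeq θ)
  have hle := fun z hz =>
    le_norm_rootLim (z := z) h.differentiableOn h.re_nonneg hk le_rfl (norm_rotSeq θ) hz
  filter_upwards [hθ, ae_deriv_ne_zero le_rfl hd hle] with z hz hz' hz1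
  have h4 := hz hz1
  rw [momentTerm, rootLimDeriv_eq h.differentiableOn h.re_nonneg hk le_rfl θ hz1] at h4
  rw [mul_eq_zero, mul_eq_zero] at h4
  rcases h4 with (h4 | h4) | h4
  · exact h4
  · simp at h4
  · rw [ENNReal.rpow_eq_zero_iff] at h4
    rcases h4 with h4 | h4
    · exact absurd h4.1 (by simpa using hz' hz1)
    · simp at h4

/-- One good sequence of angles suffices: `|f|` attains every value above `|f(2)|`, and `|f(2)|` is
bounded uniformly in the angles. The threshold is thus independent of `ν`. -/
theorem IsLogOf.exists_ae_eq_zero (h : IsLogOf φ l b) (hl : Measurable l) (hk : 2 ≤ k)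
    (t β : ℝ) : ∃ c : ℝ, 1 ≤ c ∧ ∀ ν : ℝ → ℝ≥0∞, Measurable ν → MomentsVanish l k t β ν →
      ∀ᵐ r : ℝ, c < r → ν r = 0 := by
  obtain ⟨A, hA⟩ := exists_norm_rootLim_le h.differentiableOn h.re_nonneg hk le_rfl
    (one_lt_two (α := ℝ))
  refine ⟨max 1 (2 * A), le_max_left _ _, fun ν hν hN => ?_⟩
  obtain ⟨θ, hθ⟩ := (ae_ae_rootLim_eq_zero h hl hk hν hN).exists
  have hd := differentiableOn_rootLim h.differentiableOn h.re_nonneg hk le_rfl (norm_rotSeq θ)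
  have hle := fun z hz =>
    le_norm_rootLim (z := z) h.differentiableOn h.re_nonneg hk le_rfl (norm_rotSeq θ) hz
  have h1 := ae_notMem_of_ae_norm_comp_notMem le_rfl hd hle (Z := {r | ν r ≠ 0})
    (hν (measurableSet_singleton 0)).compl
    (by filter_upwards [hθ] with z hz hz1 hcon using hcon (hz hz1))
    (z₀ := 2) (by norm_num)
  filter_upwards [h1] with r hr hr1
  by_contra hne
  refine hr ?_ hne
  have := hA (rotSeq θ) (norm_rotSeq θ) 2 (by norm_num)
  refine lt_of_le_of_lt (this.trans ?_) hr1
  rw [RCLike.norm_ofNat]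
  exact le_max_right _ _

/-- Pairing `P ν` with the indicator of `(x, ∞)` shows `ν(|φ z|) = 0` for a.e. `z` with `|z| ^ k >
x`; the values of `|φ|` there then fill everything above `‖φ u‖`. -/
theorem IsSigmaPrime.ae_eq_zero_of_opP (hφ : IsSigmaPrime φ) (hk : 2 ≤ k)
    (hν : Measurable ν) {x : ℝ} (hx : 1 ≤ x) (h : ∀ᵐ r : ℝ, x < r → opP φ k t ν r = 0) {u : ℂ}
    (hu : x < ‖u‖ ^ k) : ∀ᵐ r : ℝ, ‖φ u‖ < r → ν r = 0 := by
  have hx0 : 0 < x := by linarith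
  have hk0 : k ≠ 0 := by omega
  have hrt : ∀ z : ℂ, x ^ (1 / (k : ℝ)) < ‖z‖ ↔ x < ‖z‖ ^ k := fun z => by
    have h1 : (x ^ (1 / (k : ℝ))) ^ k = x := by
      rw [one_div, Real.rpow_inv_natCast_pow hx0.le hk0]
    nth_rw 2 [← h1]
    exact (pow_lt_pow_iff_left₀ (Real.rpow_nonneg hx0.le _) (norm_nonneg z) hk0).symm
  have hρ : 1 ≤ x ^ (1 / (k : ℝ)) := Real.one_le_rpow hx (by positivity)
  have hsub : {z : ℂ | x ^ (1 / (k : ℝ)) < ‖z‖} ⊆ extDisk := fun z hz => lt_of_le_of_lt hρ hz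
  have hf : Measurable ((Ioi x).indicator (1 : ℝ → ℝ≥0∞)) :=
      measurable_one.indicator measurableSet_Ioi
  have h1 := lintegral_mul_opP hφ (by omega : 1 ≤ k) t hf hν
  have h2 : ∫⁻ r in Ioi (1 : ℝ), (Ioi x).indicator (1 : ℝ → ℝ≥0∞) r * opP φ k t ν r = 0 := by
    rw [← lintegral_zero (μ := volume.restrict (Ioi (1 : ℝ)))]
    refine lintegral_congr_ae (ae_restrict_of_ae ?_)
    filter_upwards [h] with r hr
    by_cases hxr : x < r
    · simp [hr hxr]
    · simp [hxr]
  rw [h2, ← lintegral_indicator isOpen_extDisk.measurableSet] at h1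
  have h3 := (lintegral_eq_zero_iff (measurable_areaTerm hφ k t hf hν)).1 h1.symm
  have h4 : ∀ᵐ z : ℂ, x ^ (1 / (k : ℝ)) < ‖z‖ → ‖φ z‖ ∉ {r | ν r ≠ 0} := by
    filter_upwards [h3] with z hz hzx hcon
    have hz1 : z ∈ extDisk := hsub hzx
    have hzk : ‖z‖ ^ k ∈ Ioi x := (hrt z).1 hzx
    rw [indicator_of_mem hz1, indicator_of_mem hzk] at hz
    simp only [Pi.one_apply, one_mul, Pi.zero_apply, mul_eq_zero, ENNReal.ofReal_eq_zero] at hz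
    exact hz.elim (not_le.2 (hφ.areaWeight_pos (by omega) hz1)) hcon
  have h5 := ae_notMem_of_ae_norm_comp_notMem hρ (hφ.differentiableOn.mono hsub)
    (fun z hz => hφ.le_norm (hsub hz)) (hν (measurableSet_singleton 0)).compl h4 ((hrt u).2 hu)
  filter_upwards [h5] with r hr hr1
  by_contra hne
  exact hr hr1 hne

end

/-! ### Propagation of zeros of subsolutions -/

/-- `ν` vanishes almost everywhere above `x`. -/
def VanishAbove (ν : ℝ → ℝ≥0∞) (x : ℝ) : Prop := ∀ᵐ r : ℝ, x < r → ν r = 0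

theorem VanishAbove.mono {ν : ℝ → ℝ≥0∞} {x y : ℝ} (h : VanishAbove ν x) (hxy : x ≤ y) :
    VanishAbove ν y := by
  filter_upwards [h] with r hr hyr using hr (hxy.trans_lt hyr)

theorem vanishAbove_sInf {ν : ℝ → ℝ≥0∞} {V : Set ℝ} (hV : V.Nonempty)
    (h : ∀ x ∈ V, VanishAbove ν x) : VanishAbove ν (sInf V) := by
  have h1 : ∀ n : ℕ, VanishAbove ν (sInf V + 1 / ((n : ℝ) + 1)) := fun n => by
    obtain ⟨x, hx, hxn⟩ := exists_lt_of_csInf_lt hV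
      (show sInf V < sInf V + 1 / ((n : ℝ) + 1) by
        linarith [Nat.one_div_pos_of_nat (α := ℝ) (n := n)])
    exact (h x hx).mono hxn.le
  filter_upwards [ae_all_iff.2 h1] with r hr hlt
  obtain ⟨n, hn⟩ := exists_nat_one_div_lt (sub_pos.2 hlt)
  exact hr n (by linarith)

/-- The circle `|u| ^ k = x` is mapped by `φ` outside the disc of radius `x`. -/
def Repels (φ : ℂ → ℂ) (k : ℕ) (x : ℝ) : Prop := ∀ u ∈ extDisk, ‖u‖ ^ k = x → x ≤ ‖φ u‖

section

variable {φ l : ℂ → ℂ} {b : ℂ} {k : ℕ} {t β : ℝ} {ν : ℝ → ℝ≥0∞}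

/-- The infimum is over thresholds valid for all functions with vanishing moments at once, since the
argument applies the threshold to `P ν` in order to improve it for `ν`. A point with `|u| ^ k = a`
and `|φ u| < a` would improve it strictly. -/
theorem exists_repels_vanishAbove (h : IsLogOf φ l b) (hl : Measurable l) (hφ : IsSigmaPrime φ)
    (hk : 2 ≤ k) (t β : ℝ) : ∃ a : ℝ, 1 ≤ a ∧ (1 < a → Repels φ k a) ∧
      ∀ ν : ℝ → ℝ≥0∞, Measurable ν → MomentsVanish l k t β ν → VanishAbove ν a := by
  obtain ⟨c, hc, hcν⟩ := h.exists_ae_eq_zero hl hk t β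
  set V : Set ℝ := {x | 1 ≤ x ∧ ∀ ν : ℝ → ℝ≥0∞, Measurable ν → MomentsVanish l k t β ν →
    VanishAbove ν x} with hV
  have hVne : V.Nonempty := ⟨c, hc, hcν⟩
  have hVb : BddBelow V := ⟨1, fun x hx => hx.1⟩
  have ha1 : 1 ≤ sInf V := le_csInf hVne fun x hx => hx.1
  have haV : ∀ ν : ℝ → ℝ≥0∞, Measurable ν → MomentsVanish l k t β ν → VanishAbove ν (sInf V) :=
    fun ν hν hN => vanishAbove_sInf hVne fun x hx => hx.2 ν hν hN
  refine ⟨sInf V, ha1, fun _ u hu hua => ?_, haV⟩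
  by_contra! hcon
  -- Pushing `u` radially outwards gives the strict inequality `a < |w| ^ k` while keeping `|φ w| <
  -- a`.
  obtain ⟨w, hw1, hw2, hw3⟩ : ∃ w ∈ extDisk, ‖u‖ < ‖w‖ ∧ ‖φ w‖ < sInf V := by
    have hcont : ContinuousAt (fun τ : ℝ => ‖φ ((τ : ℂ) * u)‖) 1 := by
      refine ContinuousAt.norm
          (ContinuousAt.comp (f := fun τ : ℝ => (τ : ℂ) * u) (g := φ) ?_ (by fun_prop))
      simpa using (hφ.differentiableAt hu).continuousAt
    have h1 : ∀ᶠ τ : ℝ in 𝓝[>] 1, ‖φ ((τ : ℂ) * u)‖ < sInf V :=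
      (hcont.eventually_lt_const (by simpa using hcon)).filter_mono nhdsWithin_le_nhds
    obtain ⟨τ, hτ, hτ1⟩ := (h1.and self_mem_nhdsWithin).exists
    have hτ1 : 1 < τ := hτ1
    have hu1 : 1 < ‖u‖ := hu
    have hn : ‖u‖ < ‖(τ : ℂ) * u‖ := by
      rw [norm_mul, Complex.norm_real, Real.norm_of_nonneg (by linarith)]
      nlinarith
    exact ⟨_, hu1.trans hn, hn, hτ⟩
  have hmem : ‖φ w‖ ∈ V := by
    refine ⟨(le_of_lt hw1).trans (hφ.le_norm hw1), fun ν hν hN => ?_⟩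
    refine hφ.ae_eq_zero_of_opP hk hν (t := t) ha1 ?_ (u := w) ?_
    · filter_upwards [haV _ (measurable_opPExt hφ (by omega) t hν)
        (h.momentsVanish_opPExt hl hφ hk hν hN)] with r hr hr1
      rw [← opPExt_apply (lt_of_le_of_lt ha1 hr1)]
      exact hr hr1
    · rw [← hua]
      exact pow_lt_pow_left₀ hw2 (norm_nonneg u) (by omega)
  exact absurd (csInf_le hVb hmem) (not_le.2 hw3)

/-- Maximum principle for `z ^ k / φ(z)` on `ρ < |z|`, `|z| ^ k < a`: the modulus is at most `1` on
the outer circle by hypothesis and at most `ρ ^ (k - 1)` on the inner one because `|φ z| ≥ |z|`.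
Then `ρ` decreases to `1`. -/
theorem Repels.of_le (hφ : IsSigmaPrime φ) (hk : 2 ≤ k) {a x : ℝ} (h : Repels φ k a) (hxa : x ≤ a) :
    Repels φ k x := by
  intro u hu hux
  rcases hxa.eq_or_lt with rfl | hlt
  · exact h u hu hux
  have hu1 : 1 < ‖u‖ := hu
  have hφu : 0 < ‖φ u‖ := by linarith [hφ.le_norm hu]
  set g : ℂ → ℂ := fun z => z ^ k / φ z with hg
  have hgd : DifferentiableOn ℂ g extDisk := by
    refine DifferentiableOn.div (by fun_prop) hφ.differentiableOn fun z hz => ?_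
    exact extDisk_ne_zero (hφ.mapsTo hz)
  have hmain : ∀ ρ ∈ Ioo 1 ‖u‖, ‖g u‖ ≤ ρ ^ (k - 1) := by
    intro ρ hρ
    set U : Set ℂ := {z | ρ < ‖z‖ ∧ ‖z‖ ^ k < a} with hU
    have hUo : IsOpen U :=
      (isOpen_lt continuous_const continuous_norm).inter
        (isOpen_lt (continuous_norm.pow k) continuous_const)
    have hUc : closure U ⊆ {z | ρ ≤ ‖z‖ ∧ ‖z‖ ^ k ≤ a} :=
      closure_minimal (fun z hz => ⟨hz.1.le, hz.2.le⟩)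
        ((isClosed_le continuous_const continuous_norm).inter
          (isClosed_le (continuous_norm.pow k) continuous_const))
    have hUe : closure U ⊆ extDisk := fun z hz => lt_of_lt_of_le hρ.1 (hUc hz).1
    have hUb : IsBounded U := by
      refine (isBounded_iff_forall_norm_le.2 ⟨a, fun z hz => ?_⟩)
      exact (le_self_pow₀ (hρ.1.trans hz.1).le (by omega)).trans hz.2.le
    refine Complex.norm_le_of_forall_mem_frontier_norm_le hUb
      (DifferentiableOn.diffContOnCl (hgd.mono hUe)) (fun z hz => ?_)
      (subset_closure ⟨hρ.2, by rw [hux]; exact hlt⟩)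
    have hze : z ∈ extDisk := hUe hz.1
    have hz1 : 1 < ‖z‖ := hze
    have hφz := hφ.le_norm hze
    have hρ1 : 1 ≤ ρ ^ (k - 1) := one_le_pow₀ hρ.1.le
    rw [hg, norm_div, norm_pow, div_le_iff₀ (by linarith)]
    have hzc := hUc hz.1
    have hznot : z ∉ U := by
      have := hz.2
      rwa [hUo.interior_eq] at this
    rcases hzc.1.eq_or_lt with heq | hgt
    · rw [← heq]
      calc ρ ^ k = ρ ^ (k - 1) * ρ := by rw [← pow_succ]; congr 1; omega
        _ ≤ ρ ^ (k - 1) * ‖φ z‖ := by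
          refine mul_le_mul_of_nonneg_left ?_ (by linarith)
          rwa [heq]
    · have hza : ‖z‖ ^ k = a := le_antisymm hzc.2 (not_lt.1 fun hcon => hznot ⟨hgt, hcon⟩)
      have := h z hze hza
      rw [hza]
      nlinarith [norm_nonneg (φ z)]
  have hlim : Tendsto (fun ρ : ℝ => ρ ^ (k - 1)) (𝓝[>] 1) (𝓝 (1 ^ (k - 1))) :=
    ((continuous_pow (k - 1)).tendsto 1).mono_left nhdsWithin_le_nhds
  have h1 : ‖g u‖ ≤ 1 ^ (k - 1) := by
    refine ge_of_tendsto hlim ?_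
    filter_upwards [Ioo_mem_nhdsGT hu1] with ρ hρ using hmain ρ hρ
  rw [one_pow, hg, norm_div, norm_pow, div_le_one hφu, hux] at h1
  exact h1

theorem IsSigmaPrime.continuousOn_weightP (hφ : IsSigmaPrime φ) (hk : 2 ≤ k) (t : ℝ) :
    ContinuousOn (fun p : ℝ × ℝ => weightP φ k t p.1 p.2) (Ioi 1 ×ˢ univ) := by
  have hpt : ContinuousOn (fun p : ℝ × ℝ => rootPt k p.1 p.2) (Ioi 1 ×ˢ univ) := by
    unfold rootPt circleMap
    have : ContinuousOn (fun p : ℝ × ℝ => p.1 ^ (1 / (k : ℝ))) (Ioi 1 ×ˢ univ) :=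
      continuousOn_fst.rpow_const fun p hp => Or.inl (by have : 1 < p.1 := hp.1; linarith)
    fun_prop
  have hmaps : MapsTo (fun p : ℝ × ℝ => rootPt k p.1 p.2) (Ioi 1 ×ˢ univ) extDisk := fun p hp =>
    rootPt_mem_extDisk (by omega) hp.1 _
  have h1 : ContinuousOn (fun p : ℝ × ℝ => ‖φ (rootPt k p.1 p.2)‖) (Ioi 1 ×ˢ univ) :=
    (hφ.differentiableOn.continuousOn.comp hpt hmaps).norm
  have h2 : ContinuousOn (fun p : ℝ × ℝ => ‖deriv φ (rootPt k p.1 p.2)‖) (Ioi 1 ×ˢ univ) :=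
    ((hφ.differentiableOn.deriv isOpen_extDisk).continuousOn.comp hpt hmaps).norm
  unfold weightP
  refine ((ContinuousOn.rpow_const continuousOn_fst ?_).mul
    ((h2.rpow_const ?_).div h1 ?_)).div_const _
  · exact fun p hp => Or.inl (by have : 1 < p.1 := hp.1; linarith)
  · exact fun p hp => Or.inl (norm_ne_zero_iff.2 (hφ.deriv_ne_zero (hmaps hp)))
  · exact fun p hp => norm_ne_zero_iff.2 (extDisk_ne_zero (hφ.mapsTo (hmaps hp)))

theorem IsSigmaPrime.continuousOn_norm_rootPt (hφ : IsSigmaPrime φ) (hk : 2 ≤ k) :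
    ContinuousOn (fun p : ℝ × ℝ => ‖φ (rootPt k p.1 p.2)‖) (Ioi 1 ×ˢ univ) := by
  have hpt : ContinuousOn (fun p : ℝ × ℝ => rootPt k p.1 p.2) (Ioi 1 ×ˢ univ) := by
    unfold rootPt circleMap
    have : ContinuousOn (fun p : ℝ × ℝ => p.1 ^ (1 / (k : ℝ))) (Ioi 1 ×ˢ univ) :=
      continuousOn_fst.rpow_const fun p hp => Or.inl (by have : 1 < p.1 := hp.1; linarith)
    fun_prop
  exact (hφ.differentiableOn.continuousOn.comp hpt fun p hp =>
    rootPt_mem_extDisk (by omega) hp.1 _).norm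

/-- The total weight of the points of the circle of radius `r^{1/k}` which `φ` sends into the
closed disc of radius `x`. -/
def innerMass (φ : ℂ → ℂ) (k : ℕ) (t x r : ℝ) : ℝ≥0∞ := opP φ k t ((Iic x).indicator 1) r

/-- Semicontinuity of the mass as `r` increases to `x`: an angle whose image lies outside the closed
disc at `r = x` stays outside nearby. -/
theorem IsSigmaPrime.exists_innerMass_le (hφ : IsSigmaPrime φ) (hk : 2 ≤ k) {x : ℝ} (hx : 1 < x)
    {lam : ℝ≥0∞} (hlam : innerMass φ k t x x < lam) :
    ∃ y η, 1 ≤ y ∧ y < x ∧ η < lam ∧ ∀ r ∈ Ioo y x, innerMass φ k t x r ≤ η := by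
  classical
  set S : ℝ → Set ℝ := fun r => {θ | ‖φ (rootPt k r θ)‖ ≤ x} with hS
  set w : ℝ → ℝ → ℝ≥0∞ := fun r θ => ENNReal.ofReal (weightP φ k t r θ) with hw
  have hnc := hφ.continuousOn_norm_rootPt hk
  have hwc := hφ.continuousOn_weightP hk t
  have hmk : ∀ r, 1 < r → MapsTo (fun θ : ℝ => (r, θ)) univ (Ioi (1 : ℝ) ×ˢ (univ : Set ℝ)) :=
    fun r hr θ _ => ⟨hr, mem_univ _⟩
  have hopen : IsOpen (Ioi (1 : ℝ) ×ˢ (univ : Set ℝ)) := isOpen_Ioi.prod isOpen_univ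
  have hmk' : ∀ θ : ℝ, Tendsto (fun r : ℝ => (r, θ)) (𝓝[<] x) (𝓝 (x, θ)) := fun θ =>
    ((continuous_id.prodMk continuous_const).tendsto x).mono_left nhdsWithin_le_nhds
  have hSm : ∀ r, 1 < r → MeasurableSet (S r) := fun r hr => by
    have h1 : Continuous fun θ => ‖φ (rootPt k r θ)‖ :=
      continuousOn_univ.1 (hnc.comp (f := fun θ : ℝ => (r, θ)) (by fun_prop) (hmk r hr))
    exact measurableSet_le h1.measurable measurable_const
  have hwm : ∀ r, 1 < r → Measurable (w r) := fun r hr =>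
    (continuousOn_univ.1 (hwc.comp (f := fun θ : ℝ => (r, θ)) (by fun_prop)
      (hmk r hr))).measurable.ennreal_ofReal
  have heq : ∀ r, innerMass φ k t x r = ∫⁻ θ in Ioc 0 (2 * Real.pi), (S r).indicator (w r) θ := by
    intro r
    rw [innerMass, opP]
    refine lintegral_congr fun θ => ?_
    by_cases hθ : ‖φ (rootPt k r θ)‖ ≤ x
    · rw [indicator_of_mem (by exact hθ), indicator_of_mem (by exact hθ)]
      simp [hw]
    · rw [indicator_of_notMem (by exact hθ), indicator_of_notMem (by exact hθ), mul_zero]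
  obtain ⟨z, hz1, hzx⟩ := exists_between hx
  obtain ⟨M, hM⟩ : ∃ M : ℝ, ∀ r ∈ Icc z x, ∀ θ ∈ Icc 0 (2 * Real.pi), weightP φ k t r θ ≤ M := by
    have hcomp : IsCompact (Icc z x ×ˢ Icc 0 (2 * Real.pi)) := isCompact_Icc.prod isCompact_Icc
    obtain ⟨M, hM⟩ := (hcomp.image_of_continuousOn (hwc.mono
      (prod_mono (fun r hr => lt_of_lt_of_le hz1 hr.1) (subset_univ _)))).bddAbove
    exact ⟨M, fun r hr θ hθ => hM ⟨(r, θ), ⟨hr, hθ⟩, rfl⟩⟩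
  -- Adding `S x` to `S r` makes the dominating integrand converge at every angle, including those
  -- with image exactly on the circle of radius `x`.
  have hlim : Tendsto (fun r => ∫⁻ θ in Ioc 0 (2 * Real.pi), (S r ∪ S x).indicator (w r) θ)
      (𝓝[<] x) (𝓝 (∫⁻ θ in Ioc 0 (2 * Real.pi), (S x).indicator (w x) θ)) := by
    refine tendsto_lintegral_filter_of_dominated_convergence (fun _ => ENNReal.ofReal M) ?_ ?_ ?_ ?_
    · filter_upwards [Ioo_mem_nhdsLT hx] with r hr
      exact (hwm r hr.1).indicator ((hSm r hr.1).union (hSm x hx))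
    · filter_upwards [Ioo_mem_nhdsLT hzx] with r hr
      rw [ae_restrict_iff' measurableSet_Ioc]
      refine Eventually.of_forall fun θ hθ => (indicator_le_self _ _ _).trans ?_
      exact ENNReal.ofReal_le_ofReal (hM r ⟨hr.1.le, hr.2.le⟩ θ ⟨hθ.1.le, hθ.2⟩)
    · rw [setLIntegral_const]
      exact ENNReal.mul_ne_top ENNReal.ofReal_ne_top
        (by rw [Real.volume_Ioc]; exact ENNReal.ofReal_ne_top)
    · refine Eventually.of_forall fun θ => ?_
      have hxm : (x, θ) ∈ Ioi (1 : ℝ) ×ˢ (univ : Set ℝ) := ⟨hx, mem_univ _⟩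
      by_cases hθ : θ ∈ S x
      · have h1 : Tendsto (fun r => w r θ) (𝓝[<] x) (𝓝 (w x θ)) :=
          (ENNReal.continuous_ofReal.tendsto _).comp
            ((hwc.continuousAt (hopen.mem_nhds hxm)).tendsto.comp (hmk' θ))
        rw [indicator_of_mem hθ]
        refine h1.congr fun r => ?_
        rw [indicator_of_mem (mem_union_right _ hθ)]
      · rw [indicator_of_notMem hθ]
        refine tendsto_const_nhds.congr' ?_
        have h1 := ((hnc.continuousAt (hopen.mem_nhds hxm)).tendsto.comp
            (hmk' θ)).eventually_const_lt
          (not_le.1 hθ)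
        filter_upwards [h1] with r hr
        rw [indicator_of_notMem]
        rintro (hcon | hcon)
        · exact absurd hcon (not_le.2 hr)
        · exact hθ hcon
  rw [← heq] at hlim
  obtain ⟨η, hη1, hη2⟩ := exists_between hlam
  obtain ⟨y, hy, hyS⟩ := (mem_nhdsLT_iff_exists_Ioo_subset' hx).1 (hlim.eventually_le_const hη1)
  refine ⟨max 1 y, η, le_max_left _ _, max_lt hx hy, hη2, fun r hr => ?_⟩
  rw [heq]
  refine le_trans (lintegral_mono fun θ => ?_) (hyS ⟨(le_max_right _ _).trans_lt hr.1, hr.2⟩)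
  exact indicator_le_indicator_of_subset subset_union_left (fun _ => zero_le) θ

end

/-! ### The extremal circle -/

section

variable {φ l : ℂ → ℂ} {b : ℂ} {k : ℕ} {t β : ℝ} {ν : ℝ → ℝ≥0∞}

/-- If `|z exp (l z⁻¹)|` is constant on a circle then `l` is constant. -/
theorem IsLogOf.eq_of_norm_eq (h : IsLogOf φ l b) {ρ q : ℝ} (hρ : 1 < ρ)
    (hq : ∀ z : ℂ, ‖z‖ = ρ → ‖φ z‖ = q) : ∀ u ∈ Metric.ball (0 : ℂ) 1, l u = l 0 := by
  have hρ0 : 0 < ρ := by linarith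
  have hρi : ρ⁻¹ < 1 := inv_lt_one_of_one_lt₀ hρ
  have hρp : 0 < ρ⁻¹ := inv_pos.2 hρ0
  have hcl : closure (Metric.ball (0 : ℂ) ρ⁻¹) ⊆ Metric.ball 0 1 := by
    rw [closure_ball _ hρp.ne']
    exact Metric.closedBall_subset_ball hρi
  have hsub : Metric.ball (0 : ℂ) ρ⁻¹ ⊆ Metric.ball 0 1 := subset_closure.trans hcl
  have hbd : ∀ w ∈ frontier (Metric.ball (0 : ℂ) ρ⁻¹), ‖Complex.exp (l w)‖ = q / ρ := by
    intro w hw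
    rw [frontier_ball _ hρp.ne', mem_sphere_zero_iff_norm] at hw
    have hw' : ‖w⁻¹‖ = ρ := by rw [norm_inv, hw, inv_inv]
    have h1 := h.eq_exp w⁻¹ (by rw [extDisk, mem_ofPred_eq, hw']; exact hρ)
    rw [inv_inv] at h1
    have h2 := hq _ hw'
    rw [h1, norm_mul, hw'] at h2
    field_simp
    linarith
  have hd : DifferentiableOn ℂ (fun w => Complex.exp (l w)) (Metric.ball 0 1) :=
    h.differentiableOn.cexp
  have hd' : DifferentiableOn ℂ (fun w => Complex.exp (-l w)) (Metric.ball 0 1) :=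
    h.differentiableOn.neg.cexp
  have hle : ∀ w ∈ Metric.ball (0 : ℂ) ρ⁻¹, ‖Complex.exp (l w)‖ ≤ q / ρ := fun w hw =>
    Complex.norm_le_of_forall_mem_frontier_norm_le Metric.isBounded_ball
      (hd.mono hcl).diffContOnCl (fun z hz => (hbd z hz).le) (subset_closure hw)
  have h0 : (0 : ℂ) ∈ Metric.ball (0 : ℂ) ρ⁻¹ := Metric.mem_ball_self hρp
  have hge : ‖Complex.exp (-l 0)‖ ≤ (q / ρ)⁻¹ :=
    Complex.norm_le_of_forall_mem_frontier_norm_le Metric.isBounded_ball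
      (hd'.mono hcl).diffContOnCl
      (fun z hz => by rw [Complex.exp_neg, norm_inv, hbd z hz]) (subset_closure h0)
  have hge' : q / ρ ≤ ‖Complex.exp (l 0)‖ := by
    rw [Complex.exp_neg, norm_inv] at hge
    have hpos : 0 < ‖Complex.exp (l 0)‖ := norm_pos_iff.2 (Complex.exp_ne_zero _)
    have hqρ : 0 < q / ρ := hpos.trans_le (hle 0 h0)
    exact (inv_le_inv₀ hpos hqρ).1 hge
  -- The bounds for `exp l` and `exp (-l)` show that `‖exp l‖` is maximal at the centre.
  have hconst :=
      Complex.eqOn_of_isPreconnected_of_isMaxOn_norm (convex_ball (0 : ℂ) ρ⁻¹).isPreconnected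
    Metric.isOpen_ball (hd.mono hsub) h0 (fun w hw => (hle w hw).trans hge')
  have hderiv : EqOn (deriv l) 0 (Metric.ball 0 ρ⁻¹) := by
    intro w hw
    have h1 : (fun w => Complex.exp (l w)) =ᶠ[𝓝 w] fun _ => Complex.exp (l 0) := by
      filter_upwards [Metric.isOpen_ball.mem_nhds hw] with v hv using hconst hv
    have h2 := h1.deriv_eq
    rw [deriv_const, deriv_cexp (h.differentiableOn.differentiableAt
      (Metric.isOpen_ball.mem_nhds (hsub hw)))] at h2
    exact (mul_eq_zero.1 h2).resolve_left (Complex.exp_ne_zero _)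
  have hl0 : ∀ w ∈ Metric.ball (0 : ℂ) ρ⁻¹, l w = l 0 := fun w hw =>
    Metric.isOpen_ball.is_const_of_deriv_eq_zero (convex_ball (0 : ℂ) ρ⁻¹).isPreconnected
      (h.differentiableOn.mono hsub) hderiv hw h0
  refine (h.differentiableOn.analyticOnNhd Metric.isOpen_ball).eqOn_of_preconnected_of_eventuallyEq
    (analyticOnNhd_const (v := l 0)) (convex_ball (0 : ℂ) 1).isPreconnected (hsub h0) ?_
  filter_upwards [Metric.isOpen_ball.mem_nhds h0] with v hv using hl0 v hv

/-- `‖φ‖² - q²` is real analytic in the angle, so its zeros are null unless it vanishes identically,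
which forces a constant logarithm. -/
theorem IsLogOf.ae_norm_circleMap_ne (h : IsLogOf φ l b) (hφ : IsSigmaPrime φ) {ρ : ℝ}
    (hρ : 1 < ρ) (q : ℝ) (hne : ¬ ∀ u ∈ Metric.ball (0 : ℂ) 1, l u = l 0) :
    ∀ᵐ x : ℝ, ‖φ (circleMap 0 ρ x)‖ ≠ q := by
  have hρ0 : 0 < ρ := by linarith
  set g : ℝ → ℝ := fun x => ‖φ (circleMap 0 ρ x)‖ ^ 2 - q ^ 2 with hg
  have hgan : AnalyticOnNhd ℝ g univ := by
    intro x _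
    have h1 : AnalyticAt ℝ (fun x => φ (circleMap 0 ρ x)) x := by
      have h2 : AnalyticAt ℝ φ (circleMap 0 ρ x) :=
        (hφ.differentiableOn.analyticAt (isOpen_extDisk.mem_nhds
          (circleMap_mem_extDisk hρ x))).restrictScalars
      have h3 : AnalyticAt ℝ (circleMap 0 ρ) x := analyticOnNhd_circleMap 0 ρ x (mem_univ _)
      exact h2.comp h3
    have h2 : g = fun x => (φ (circleMap 0 ρ x)).re ^ 2 + (φ (circleMap 0 ρ x)).im ^ 2 - q ^ 2 := by
      ext x
      change ‖φ (circleMap 0 ρ x)‖ ^ 2 - q ^ 2 = _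
      rw [← Complex.normSq_eq_norm_sq, Complex.normSq_apply]
      ring
    rw [h2]
    exact (((Complex.reCLM.analyticAt _).comp h1).pow 2 |>.add
      (((Complex.imCLM.analyticAt _).comp h1).pow 2)).sub analyticAt_const
  by_cases hz : ∃ x, g x ≠ 0
  · obtain ⟨x, hx⟩ := hz
    have h1 := ae_restrict_le_codiscreteWithin (μ := (volume : Measure ℝ)) MeasurableSet.univ
      (hgan.preimage_zero_mem_codiscreteWithin hx (mem_univ x) isConnected_univ)
    rw [Measure.restrict_univ] at h1
    filter_upwards [h1] with y hy hcon
    exact hy (by simp [hg, hcon])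
  · push Not at hz
    refine absurd (h.eq_of_norm_eq hρ (q := |q|) fun z hzρ => ?_) hne
    have hmem : z ∈ circleMap 0 ρ '' Ioc 0 (2 * Real.pi) := by
      rw [image_circleMap_Ioc, abs_of_pos hρ0]
      simpa using hzρ
    obtain ⟨x, -, rfl⟩ := hmem
    have := hz x
    rw [hg] at this
    rw [← abs_of_nonneg (norm_nonneg (φ (circleMap 0 ρ x)))]
    exact (sq_eq_sq_iff_abs_eq_abs _ _).1 (by linarith)

/-- Repulsion leaves only angles with `|φ| = x` exactly, a null set unless `φ(z) = c z` with `|c| =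
x^(1-1/k)`. In that case the weight is the uniform density, of mass `1`. -/
theorem IsLogOf.innerMass_lt (h : IsLogOf φ l b) (hφ : IsSigmaPrime φ) (hk : 2 ≤ k) {x : ℝ}
    (hx : 1 < x) (hrep : Repels φ k x) {lam : ℝ≥0∞} (hlam : 0 < lam)
    (hlam1 : (∀ u ∈ Metric.ball (0 : ℂ) 1, l u = l 0) → 1 < lam) : innerMass φ k t x x < lam := by
  have hk1 : 1 ≤ k := by omega
  have hx0 : 0 < x := by linarith
  have hkR : (k : ℝ) ≠ 0 := by positivity
  have hge : ∀ θ, x ≤ ‖φ (rootPt k x θ)‖ := fun θ =>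
    hrep _ (rootPt_mem_extDisk hk1 hx θ) (norm_rootPt_pow hk1 hx0.le θ)
  have hzero : (∀ᵐ θ : ℝ, ‖φ (rootPt k x θ)‖ ≠ x) → innerMass φ k t x x < lam := fun hne => by
    have h1 : innerMass φ k t x x = 0 := by
      rw [innerMass, opP, ← lintegral_zero (μ := volume.restrict (Ioc 0 (2 * Real.pi)))]
      refine lintegral_congr_ae (ae_restrict_of_ae ?_)
      filter_upwards [hne] with θ hθ
      rw [indicator_of_notMem (by rw [mem_Iic, not_le]; exact lt_of_le_of_ne (hge θ) hθ.symm),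
        mul_zero]
    rwa [h1]
  have hρ : 1 < x ^ (1 / (k : ℝ)) := Real.one_lt_rpow hx (by positivity)
  by_cases hlin : ∀ u ∈ Metric.ball (0 : ℂ) 1, l u = l 0
  swap
  · exact hzero (h.ae_norm_circleMap_ne hφ hρ x hlin)
  set c : ℂ := Complex.exp (l 0) with hc
  have hc0 : 0 < ‖c‖ := norm_pos_iff.2 (Complex.exp_ne_zero _)
  have hφc : ∀ z ∈ extDisk, φ z = z * c := fun z hz => by
    rw [h.eq_exp z hz, hlin _ (inv_mem_ball_of_mem_extDisk hz)]
  have hdc : ∀ z ∈ extDisk, deriv φ z = c := fun z hz => by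
    have h1 : φ =ᶠ[𝓝 z] fun w => w * c := by
      filter_upwards [isOpen_extDisk.mem_nhds hz] with w hw using hφc w hw
    rw [h1.deriv_eq, deriv_mul_const_field, deriv_id'', one_mul]
  have hnorm : ∀ θ, ‖φ (rootPt k x θ)‖ = x ^ (1 / (k : ℝ)) * ‖c‖ := fun θ => by
    rw [hφc _ (rootPt_mem_extDisk hk1 hx θ), norm_mul, norm_rootPt hx0.le]
  by_cases heq : x ^ (1 / (k : ℝ)) * ‖c‖ = x
  swap
  · exact hzero (Eventually.of_forall fun θ => by rw [hnorm θ]; exact heq)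
  refine lt_of_le_of_lt ?_ (hlam1 hlin)
  have hcx : ‖c‖ = x ^ (1 - 1 / (k : ℝ)) := by
    rw [Real.rpow_sub hx0, Real.rpow_one, eq_div_iff (by positivity), mul_comm]
    exact heq
  have hwt : ∀ θ, weightP φ k t x θ = 1 / (2 * Real.pi) := fun θ => by
    rw [weightP, hdc _ (rootPt_mem_extDisk hk1 hx θ), hnorm θ, heq, hcx, ← Real.rpow_mul hx0.le,
      ← mul_div_assoc, ← Real.rpow_add hx0]
    have : 1 - ((k : ℝ) - 1) * t / k + (1 - 1 / (k : ℝ)) * t = 1 := by field_simp; ring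
    rw [this, Real.rpow_one, div_self hx0.ne']
  rw [innerMass, opP]
  calc _ ≤ ∫⁻ θ in Ioc 0 (2 * Real.pi), ENNReal.ofReal (1 / (2 * Real.pi)) := by
        refine lintegral_mono fun θ => ?_
        rw [hwt θ]
        calc _ ≤ ENNReal.ofReal (1 / (2 * Real.pi)) * 1 := by
              gcongr
              exact indicator_le_self _ _ _
          _ = _ := mul_one _
    _ = 1 := by
        rw [setLIntegral_const, Real.volume_Ioc, sub_zero,
          ← ENNReal.ofReal_mul (by positivity), one_div, inv_mul_cancel₀ Real.two_pi_pos.ne',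
          ENNReal.ofReal_one]

theorem lintegral_rpow_eq_top {β δ : ℝ} (hδ : 0 < δ) (hβ : β < 0) :
    ∫⁻ r in Ioo (1 : ℝ) (1 + δ), ENNReal.ofReal ((r - 1) ^ (β - 1)) = ∞ := by
  by_contra hne
  have h1 : ¬ IntegrableOn (fun x : ℝ => x ^ (β - 1)) (Ioo 0 δ) := by
    rw [intervalIntegral.integrableOn_Ioo_rpow_iff hδ]
    linarith
  refine h1 ⟨(by fun_prop : Measurable fun x : ℝ => x ^ (β - 1)).aestronglyMeasurable, ?_⟩
  rw [hasFiniteIntegral_iff_ofReal ((ae_restrict_iff' measurableSet_Ioo).2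
    (Eventually.of_forall fun x hx => Real.rpow_nonneg hx.1.le _))]
  refine lt_of_le_of_lt (le_of_eq ?_) (lt_top_iff_ne_top.2 hne)
  have h2 := (measurePreserving_sub_right (volume : Measure ℝ) 1).setLIntegral_comp_preimage
    (s := Ioo 0 δ) measurableSet_Ioo
    (f := fun x => ENNReal.ofReal (x ^ (β - 1))) (by fun_prop)
  rw [← h2]
  congr 2
  ext x
  simp only [mem_preimage, mem_Ioo]
  constructor <;> rintro ⟨h3, h4⟩ <;> constructor <;> linarith

/-- For linear `φ` the snowflake is linear, with `|f'|` bounded above and below uniformly in the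
angles, so the spectral integral diverges when `β < 0`. -/
theorem IsLogOf.nonneg_of_const (h : IsLogOf φ l b) (hk : 2 ≤ k)
    (hlin : ∀ u ∈ Metric.ball (0 : ℂ) 1, l u = l 0) {δ : ℝ} (hδ : 0 < δ)
    (hfin : meanIntegral φ k t β δ < ∞) : 0 ≤ β := by
  by_contra! hβ
  have hcomp : ∀ c : ℕ → ℂ, (∀ n, ‖c n‖ = 1) → ∀ n, ∃ C : ℂ, ∀ z ∈ extDisk,
      rootComp l k c 1 n z = z * C := by
    intro c hc n
    have hmap : ∀ m, 1 ≤ m → ∀ c : ℂ, ‖c‖ = 1 → ∀ z ∈ extDisk,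
        rootMap l m c z = z * Complex.exp (l 0 / m) := fun m hm c hc z hz => by
      rw [rootMap, hlin _ (mul_inv_pow_mem_ball hc hz hm)]
    induction n with
    | zero => exact ⟨_, hmap 1 le_rfl _ (hc 0)⟩
    | succ n ih =>
      obtain ⟨C, hC⟩ := ih
      have hm := one_le_mul_pow (le_refl 1) hk (n + 1)
      refine ⟨Complex.exp (l 0 / ((1 * k ^ (n + 1) : ℕ) : ℂ)) * C, fun z hz => ?_⟩
      have h1 := rootMap_mapsTo h.re_nonneg hm (hc (n + 1)) hz
      rw [rootComp, Function.comp_apply, hC _ h1, hmap _ hm _ (hc (n + 1)) z hz, mul_assoc]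
  have h2 : (2 : ℂ) ∈ extDisk := by simp [extDisk]
  have hlim : ∀ θ, ∀ z ∈ extDisk, rootLim l k (rotSeq θ) 1 z =
      z * (rootLim l k (rotSeq θ) 1 2 / 2) := fun θ z hz => by
    have h1 := tendsto_rootComp h.differentiableOn h.re_nonneg hk le_rfl (norm_rotSeq θ) hz
    have h3 := ((tendsto_rootComp h.differentiableOn h.re_nonneg hk le_rfl (norm_rotSeq θ)
      h2).div_const 2).const_mul z
    refine tendsto_nhds_unique h1 (h3.congr fun n => ?_)
    obtain ⟨C, hC⟩ := hcomp _ (norm_rotSeq θ) n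
    rw [hC z hz, hC 2 h2]
    ring
  obtain ⟨A, hA⟩ := exists_norm_rootLim_le h.differentiableOn h.re_nonneg hk le_rfl
    (one_lt_two (α := ℝ))
  have hderiv : ∀ θ, ∀ z ∈ extDisk, ‖deriv (snowflake φ k θ) z‖ =
      ‖rootLim l k (rotSeq θ) 1 2‖ / 2 := fun θ z hz => by
    have h1 : snowflake φ k θ =ᶠ[𝓝 z] fun w => w * (rootLim l k (rotSeq θ) 1 2 / 2) := by
      filter_upwards [isOpen_extDisk.mem_nhds hz] with w hw
      rw [h.snowflake_eq hk θ hw, hlim θ w hw]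
    rw [h1.deriv_eq, deriv_mul_const_field, deriv_id'', one_mul, norm_div, RCLike.norm_ofNat]
  have hbd : ∀ θ, 1 ≤ ‖rootLim l k (rotSeq θ) 1 2‖ / 2 ∧ ‖rootLim l k (rotSeq θ) 1 2‖ / 2 ≤ A := by
    intro θ
    have h1 := le_norm_rootLim h.differentiableOn h.re_nonneg hk le_rfl (norm_rotSeq θ) h2
    have h3 := hA _ (norm_rotSeq θ) 2 (by norm_num)
    rw [RCLike.norm_ofNat] at h1 h3
    constructor <;> linarith
  have hA1 : 1 ≤ A := (hbd 0).1.trans (hbd 0).2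
  set κ : ℝ≥0∞ := ENNReal.ofReal (A ^ (-|t|)) with hκ
  have hκ0 : κ ≠ 0 := (ENNReal.ofReal_pos.2 (Real.rpow_pos_of_pos (by linarith) _)).ne'
  have hlow : ∀ θ, ∀ z ∈ extDisk, κ ≤ ‖deriv (snowflake φ k θ) z‖ₑ ^ t := fun θ z hz => by
    have h1 := hbd θ
    rw [← hderiv θ z hz] at h1
    rw [enorm_rpow_eq_ofReal (norm_pos_iff.1 (by linarith [h1.1]))]
    refine ENNReal.ofReal_le_ofReal ?_
    have h3 := rpow_le_rpow_abs hA1 (M := A) (q := ‖deriv (snowflake φ k θ) z‖)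
      ((inv_le_one_of_one_le₀ hA1).trans h1.1) h1.2 (-t)
    rw [abs_neg, Real.rpow_neg (norm_nonneg _)] at h3
    rw [Real.rpow_neg (by linarith)]
    exact inv_le_of_inv_le₀ (Real.rpow_pos_of_pos (by linarith [h1.1]) _) h3
  have hcon : (∫⁻ r in Ioo (1 : ℝ) (1 + δ), ENNReal.ofReal ((r - 1) ^ (β - 1))) *
      (κ * volume (Ioc 0 (2 * Real.pi))) ≤ meanIntegral φ k t β δ := by
    rw [meanIntegral, ← lintegral_mul_const _ (by fun_prop)]
    refine setLIntegral_mono' measurableSet_Ioo fun r hr => ?_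
    gcongr
    rw [← setLIntegral_const]
    refine lintegral_mono fun x => ?_
    calc κ = ∫⁻ _, κ ∂angleLaw := by simp
      _ ≤ _ := lintegral_mono fun θ => hlow θ _ (circleMap_mem_extDisk hr.1 x)
  rw [lintegral_rpow_eq_top hδ hβ, ENNReal.top_mul] at hcon
  · exact absurd hfin (not_lt.2 hcon)
  · refine mul_ne_zero hκ0 ?_
    rw [Real.volume_Ioc, sub_zero]
    exact (ENNReal.ofReal_pos.2 Real.two_pi_pos).ne'

/-- `P` ignores null sets for a.e. radius: applied to the function equal to `∞` on the exceptional
set, it integrates to zero by nonsingularity of `|φ|`. -/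
theorem opP_mono_ae (hφ : IsSigmaPrime φ) (hk : 2 ≤ k) {f g : ℝ → ℝ≥0∞} (hf : Measurable f)
    (hg : Measurable g) (hfg : ∀ᵐ r : ℝ, 1 < r → f r ≤ g r) :
    ∀ᵐ r : ℝ, 1 < r → opP φ k t f r ≤ opP φ k t g r := by
  set Z : Set ℝ := {r | 1 < r ∧ g r < f r} with hZ
  have hZm : MeasurableSet Z :=
    (measurableSet_lt measurable_const measurable_id).inter (measurableSet_lt hg hf)
  have hZ0 : volume Z = 0 := by
    refine measure_eq_zero_iff_ae_notMem.2 ?_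
    filter_upwards [hfg] with r hr hcon
    exact absurd (hr hcon.1) (not_le.2 hcon.2)
  have hindm : Measurable (Z.indicator fun _ => (∞ : ℝ≥0∞)) := measurable_const.indicator hZm
  have h1 := lintegral_mul_opP hφ (by omega : 1 ≤ k) t (measurable_const (a := (1 : ℝ≥0∞))) hindm
  have h2 : ∫⁻ z in extDisk, ENNReal.ofReal (areaWeight φ k t z) *
      (1 * Z.indicator (fun _ => (∞ : ℝ≥0∞)) ‖φ z‖) = 0 := by
    rw [← lintegral_zero (μ := volume.restrict extDisk)]
    refine lintegral_congr_ae ((ae_restrict_iff' isOpen_extDisk.measurableSet).2 ?_)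
    filter_upwards [ae_norm_comp_notMem le_rfl hφ.differentiableOn (fun z hz => hφ.le_norm hz)
      hZm hZ0] with z hz hz1
    rw [indicator_of_notMem (hz hz1), mul_zero, mul_zero]
  rw [h2] at h1
  have h3 : ∫⁻ r in Ioi (1 : ℝ), opPExt φ k t (Z.indicator fun _ => (∞ : ℝ≥0∞)) r = 0 := by
    rw [← h1]
    refine setLIntegral_congr_fun measurableSet_Ioi fun r hr => ?_
    rw [opPExt_apply hr, one_mul]
  have h4 := (lintegral_eq_zero_iff (measurable_opPExt hφ (by omega) t hindm)).1 h3
  rw [EventuallyEq, ae_restrict_iff' measurableSet_Ioi] at h4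
  filter_upwards [h4] with r hr hr1
  have h5 := hr hr1
  rw [opPExt_apply hr1] at h5
  calc opP φ k t f r ≤ opP φ k t (fun s => g s + Z.indicator (fun _ => (∞ : ℝ≥0∞)) s) r := by
        refine lintegral_mono fun θ => ?_
        gcongr ENNReal.ofReal _ * ?_
        dsimp only
        by_cases hθ : ‖φ (rootPt k r θ)‖ ∈ Z
        · rw [indicator_of_mem hθ]; simp
        · rw [indicator_of_notMem hθ, add_zero]
          by_contra hcon
          exact hθ ⟨hφ.mapsTo (rootPt_mem_extDisk (by omega) hr1 θ), not_le.1 hcon⟩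
    _ = opP φ k t g r + opP φ k t (Z.indicator fun _ => (∞ : ℝ≥0∞)) r := by
        obtain ⟨W, hW, hWeq⟩ := measurable_weightP_mul hφ (by omega : 1 ≤ k) t hg
        rw [opP, opP, opP, ← lintegral_add_left']
        · simp only [mul_add]
        · have : (fun θ => ENNReal.ofReal (weightP φ k t r θ) * g ‖φ (rootPt k r θ)‖) =
              fun θ => W (r, θ) := funext fun θ => (hWeq r hr1 θ).symm
          rw [this]
          exact (hW.comp measurable_prodMk_left).aemeasurable
    _ = opP φ k t g r := by rw [h5, Pi.zero_apply, add_zero]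

/-- One step of the descent. -/
theorem IsLogOf.exists_lt_vanishAbove (h : IsLogOf φ l b) (hφ : IsSigmaPrime φ) (hk : 2 ≤ k)
    (hν : Measurable ν) {C : ℝ≥0∞} (hCt : C ≠ ∞) (hC : ∀ r, ν r ≤ C) {lam : ℝ≥0∞}
    (hlam : 0 < lam) (hlamt : lam ≠ ∞)
    (hlam1 : (∀ u ∈ Metric.ball (0 : ℂ) 1, l u = l 0) → 1 < lam)
    (hsub : ∀ᵐ r : ℝ, 1 < r → lam * ν r ≤ opP φ k t ν r) {x : ℝ} (hx : 1 < x)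
    (hrep : Repels φ k x) (hva : VanishAbove ν x) : ∃ y, 1 ≤ y ∧ y < x ∧ VanishAbove ν y := by
  obtain ⟨y, η, hy1, hyx, hη, hle⟩ :=
      hφ.exists_innerMass_le hk hx (h.innerMass_lt (t := t) hφ hk hx hrep hlam hlam1)
  refine ⟨y, hy1, hyx, ?_⟩
  have hηt : η ≠ ∞ := (hη.trans_le le_top).ne
  set μ : Measure ℝ := volume.restrict (Ioo y x) with hμ
  set s : ℝ≥0∞ := essSup ν μ with hs
  have hst : s ≠ ∞ := ((essSup_le_of_ae_le C (Eventually.of_forall hC)).trans_lt hCt.lt_top).ne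
  have hνs := (ae_restrict_iff' measurableSet_Ioo).1 (ENNReal.ae_le_essSup (μ := μ) ν)
  have hxne : ∀ᵐ r : ℝ, r ≠ x := by
    refine (measure_eq_zero_iff_ae_notMem (s := {x})).1 (by simp)
  -- A majorant of `ν`: the crude bound up to `y`, the essential supremum on `(y, x)`, and nothing
  -- above `x`.
  set g : ℝ → ℝ≥0∞ := fun r => (Iic y).indicator (fun _ => C) r + s * (Iic x).indicator 1 r with hg
  have hgm : Measurable g := (measurable_const.indicator measurableSet_Iic).add
    ((measurable_one.indicator measurableSet_Iic).const_mul s)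
  have hνg : ∀ᵐ r : ℝ, 1 < r → ν r ≤ g r := by
    filter_upwards [hνs, hva, hxne] with r hr1 hr2 hrx _
    rcases le_or_gt r y with hry | hry
    · rw [hg]
      simp only [indicator_of_mem (mem_Iic.2 hry)]
      exact (hC r).trans le_self_add
    · rcases lt_or_gt_of_ne hrx with hlt | hgt
      · rw [hg]
        simp only [indicator_of_mem (mem_Iic.2 hlt.le), Pi.one_apply, mul_one]
        exact (hr1 ⟨hry, hlt⟩).trans le_add_self
      · rw [hr2 hgt]
        exact zero_le
  have hkey : ∀ᵐ r ∂μ, ν r ≤ η / lam * s := by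
    rw [hμ, ae_restrict_iff' measurableSet_Ioo]
    filter_upwards [hsub, opP_mono_ae (t := t) hφ hk hν hgm hνg] with r hr1 hr2 hr
    have hr0 : 1 < r := lt_of_le_of_lt hy1 hr.1
    have hrepr : Repels φ k r := hrep.of_le hφ hk hr.2.le
    -- Repulsion gives `|φ| ≥ r > y`, so the crude part of `g` is never seen.
    have h1 : opP φ k t g r = s * innerMass φ k t x r := by
      rw [opP, innerMass, opP, ← lintegral_const_mul' _ _ hst]
      refine lintegral_congr fun θ => ?_
      have h2 := hrepr _ (rootPt_mem_extDisk (by omega) hr0 θ)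
          (norm_rootPt_pow (by omega) (by linarith) θ)
      rw [hg]
      simp only
      rw [indicator_of_notMem (s := Iic y) (by rw [mem_Iic, not_le]; exact hr.1.trans_le h2),
          zero_add]
      ring
    have h2 : lam * ν r ≤ s * η := by
      refine (hr1 hr0).trans ((hr2 hr0).trans ?_)
      rw [h1]
      gcongr
      exact hle r hr
    rw [← ENNReal.mul_div_right_comm, ENNReal.le_div_iff_mul_le (Or.inl hlam.ne') (Or.inl hlamt)]
    rw [mul_comm, mul_comm η]
    exact h2
  have hs2 : s ≤ η / lam * s := essSup_le_of_ae_le _ hkey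
  -- The essential supremum is finite and at most `η / λ < 1` times itself.
  have hs0 : s = 0 := by
    by_contra hne
    refine absurd hs2 (not_le.2 ?_)
    calc η / lam * s < 1 * s := by
          refine ENNReal.mul_lt_mul_left hne hst ?_
          exact (ENNReal.div_lt_iff (Or.inl hlam.ne') (Or.inl hlamt)).2 (by rwa [one_mul])
      _ = s := one_mul s
  filter_upwards [hνs, hva, hxne] with r hr1 hr2 hrx hry
  rcases lt_or_gt_of_ne hrx with hlt | hgt
  · have := hr1 ⟨hry, hlt⟩
    rw [← hs, hs0] at this
    exact le_antisymm this zero_le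
  · exact hr2 hgt

/-- A bounded strict subsolution vanishes if the spectral integral converges. -/
theorem IsSigmaPrime.ae_eq_zero_of_subsolution (hφ : IsSigmaPrime φ) (hk : 2 ≤ k)
    (hν : Measurable ν) {C : ℝ≥0∞} (hCt : C ≠ ∞) (hC : ∀ r, ν r ≤ C) {δ : ℝ} (hδ : 0 < δ)
    (hfin : meanIntegral φ k t β δ < ∞) {lam : ℝ} (hlam : (k : ℝ) ^ β < lam)
    (hsub : ∀ᵐ r : ℝ, 1 < r → ENNReal.ofReal lam * ν r ≤ opP φ k t ν r) :
    ∀ᵐ r : ℝ, 1 < r → ν r = 0 := by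
  obtain ⟨l, b, h, hl⟩ := hφ.exists_measurable_isLogOf
  have hkβ : 0 < (k : ℝ) ^ β := Real.rpow_pos_of_pos (by positivity) _
  have hlam1 : (∀ u ∈ Metric.ball (0 : ℂ) 1, l u = l 0) → 1 < ENNReal.ofReal lam := fun hlin => by
    rw [ENNReal.one_lt_ofReal]
    refine lt_of_le_of_lt (Real.one_le_rpow ?_ (h.nonneg_of_const hk hlin hδ hfin)) hlam
    exact_mod_cast (by omega : 1 ≤ k)
  obtain ⟨a, ha1, hrep, hva⟩ := exists_repels_vanishAbove h hl hφ hk t β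
  have hνa := hva ν hν (h.momentIntegral_eq_zero hl hφ hk hν hCt hC hδ hfin hlam hsub)
  set V : Set ℝ := {x | 1 ≤ x ∧ VanishAbove ν x} with hV
  have hVb : BddBelow V := ⟨1, fun x hx => hx.1⟩
  have hVne : V.Nonempty := ⟨a, ha1, hνa⟩
  have h1 : 1 ≤ sInf V := le_csInf hVne fun x hx => hx.1
  have h2 : VanishAbove ν (sInf V) := vanishAbove_sInf hVne fun x hx => hx.2
  rcases h1.eq_or_lt with heq | hlt
  · rwa [← heq] at h2
  have h3 : sInf V ≤ a := csInf_le hVb ⟨ha1, hνa⟩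
  obtain ⟨y, hy1, hyx, hy⟩ := h.exists_lt_vanishAbove hφ hk hν hCt hC
    (ENNReal.ofReal_pos.2 (hkβ.trans hlam)) ENNReal.ofReal_ne_top hlam1 hsub hlt
    ((hrep (hlt.trans_le h3)).of_le hφ hk h3) h2
  exact absurd (csInf_le hVb ⟨hy1, hy⟩) (not_le.2 hyx)

end

/-! ### Lower bounds for the spectrum -/

section

variable {φ : ℂ → ℂ} {k : ℕ} {t R : ℝ}

/-- If the spectral integral converged for some `β < s`, then `k ^ s > k ^ β` and the subsolution
would vanish. -/
theorem IsSigmaPrime.coe_le_avgSpectrum (hφ : IsSigmaPrime φ) (hk : 2 ≤ k) {ν : ℝ → ℝ≥0∞}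
    (hν : Measurable ν) {C : ℝ≥0∞} (hCt : C ≠ ∞) (hC : ∀ r, ν r ≤ C)
    (hne : ¬ ∀ᵐ r : ℝ, 1 < r → ν r = 0) {s : ℝ}
    (hsub : ∀ᵐ r : ℝ, 1 < r → ENNReal.ofReal ((k : ℝ) ^ s) * ν r ≤ opP φ k t ν r) :
    (s : EReal) ≤ avgSpectrum φ k t := by
  refine le_sInf ?_
  rintro _ ⟨β, ⟨δ, hδ, hfin⟩, rfl⟩
  refine EReal.coe_le_coe_iff.2 (not_lt.1 fun hlt => hne ?_)
  have hk1 : (1 : ℝ) < k := by exact_mod_cast (by omega : 1 < k)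
  exact hφ.ae_eq_zero_of_subsolution hk hν hCt hC hδ hfin
    (Real.rpow_lt_rpow_of_exponent_lt hk1 hlt) hsub

theorem ofReal_rpow_le_of_lt_log_div (hk : 2 ≤ k) {s : ℝ} {x : ℝ≥0∞}
    (h : (s : EReal) < ENNReal.log x / (Real.log k : EReal)) :
    ENNReal.ofReal ((k : ℝ) ^ s) ≤ x := by
  have hk1 : (1 : ℝ) < k := by exact_mod_cast (by omega : 1 < k)
  have hk0 : (0 : ℝ) < k := by linarith
  rw [EReal.lt_div_iff (by exact_mod_cast Real.log_pos hk1) (EReal.coe_ne_top _)] at h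
  rw [← ENNReal.log_le_log_iff, ENNReal.log_ofReal_of_pos (Real.rpow_pos_of_pos hk0 s),
    Real.log_rpow hk0, EReal.coe_mul]
  exact h.le

theorem ae_ne (a : ℝ) : ∀ᵐ r : ℝ, r ≠ a :=
  (measure_eq_zero_iff_ae_notMem (s := {a})).1 (by simp)

/-- For a real `s` below the infimum, the extension by zero is a subsolution with factor `k ^ s`;
beyond `R` the inequality is trivial. -/
theorem IsSigmaPrime.iInf_log_le_avgSpectrum (hφ : IsSigmaPrime φ) (hk : 2 ≤ k) (hR : 1 < R)
    {ν : ℝ → ℝ} (hν : Measurable ν) (hpos : ∀ r ∈ Icc 1 R, 0 < ν r) {C : ℝ}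
    (hC : ∀ r ∈ Icc 1 R, ν r ≤ C) :
    (⨅ r ∈ Ioo 1 R,
      ENNReal.log (opP φ k t ((Icc 1 R).indicator fun s => ENNReal.ofReal (ν s)) r /
        ENNReal.ofReal (ν r)) / (Real.log k : EReal)) ≤ avgSpectrum φ k t := by
  by_contra! hcon
  obtain ⟨s, hs1, hs2⟩ := EReal.lt_iff_exists_real_btwn.1 hcon
  refine absurd hs1 (not_lt.2 (hφ.coe_le_avgSpectrum hk
    (ν := (Icc 1 R).indicator fun s => ENNReal.ofReal (ν s))
    (hν.ennreal_ofReal.indicator measurableSet_Icc) (C := ENNReal.ofReal C) ENNReal.ofReal_ne_top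
    (fun r => ?_) (fun hzero => ?_) ?_))
  · exact indicator_le (g := fun _ => ENNReal.ofReal C)
      (fun r hr => ENNReal.ofReal_le_ofReal (hC r hr)) r
  · have h1 : volume (Ioo 1 R) = 0 := by
      refine measure_mono_null (fun r hr => ?_) (ae_iff.1 hzero)
      intro hcon
      have h2 := hcon hr.1
      rw [indicator_of_mem (Ioo_subset_Icc_self hr)] at h2
      exact absurd h2 (ENNReal.ofReal_pos.2 (hpos r (Ioo_subset_Icc_self hr))).ne'
    rw [Real.volume_Ioo, ENNReal.ofReal_eq_zero] at h1
    linarith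
  · filter_upwards [ae_ne R] with r hrR hr1
    rcases lt_or_gt_of_ne hrR with hlt | hgt
    · have hmem : r ∈ Ioo 1 R := ⟨hr1, hlt⟩
      have h1 := ofReal_rpow_le_of_lt_log_div hk (hs2.trans_le (iInf₂_le r hmem))
      rw [indicator_of_mem (Ioo_subset_Icc_self hmem)]
      exact (ENNReal.le_div_iff_mul_le
        (Or.inl (ENNReal.ofReal_pos.2 (hpos r (Ioo_subset_Icc_self hmem))).ne')
        (Or.inl ENNReal.ofReal_ne_top)).1 h1
    · rw [indicator_of_notMem (fun hcon => absurd hcon.2 (not_le.2 hgt)), mul_zero]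
      exact zero_le

theorem enorm_opPC_le {ν : ℝ → ℂ} {r : ℝ} (hr : 0 ≤ r) :
    ‖opPC φ k t ν r‖ₑ ≤ opP φ k t (fun s => ‖ν s‖ₑ) r := by
  refine (enorm_integral_le_lintegral_enorm _).trans (lintegral_mono fun θ => ?_)
  rw [enorm_mul, ← ofReal_norm ((weightP φ k t r θ : ℝ) : ℂ), Complex.norm_real,
    Real.norm_of_nonneg (weightP_nonneg hr θ)]

/-- The kernel of `P` is nonnegative, so the modulus of an eigenfunction is a subsolution with
factor `|λ|`. -/
theorem IsSigmaPrime.log_eigenvalue_le_avgSpectrum (hφ : IsSigmaPrime φ) (hk : 2 ≤ k) {lam : ℂ}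
    (h : IsEigenvalueOn φ k t R lam) :
    ENNReal.log ‖lam‖ₑ / (Real.log k : EReal) ≤ avgSpectrum φ k t := by
  obtain ⟨ν, hν, ⟨C, hC⟩, hne, hev⟩ := h
  by_contra! hcon
  obtain ⟨s, hs1, hs2⟩ := EReal.lt_iff_exists_real_btwn.1 hcon
  have hs3 := ofReal_rpow_le_of_lt_log_div hk hs2
  rw [ae_restrict_iff' measurableSet_Icc] at hne hev
  have hnorm : (fun r => ‖(Icc 1 R).indicator ν r‖ₑ) = (Icc 1 R).indicator fun r => ‖ν r‖ₑ :=
    funext fun r => enorm_indicator_eq_indicator_enorm _ _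
  refine absurd hs1 (not_lt.2 (hφ.coe_le_avgSpectrum hk (ν := fun r => ‖(Icc 1 R).indicator ν r‖ₑ)
    (hν.indicator measurableSet_Icc).enorm (C := ENNReal.ofReal C) ENNReal.ofReal_ne_top
    (fun r => ?_) (fun hzero => hne ?_) ?_))
  · change (fun r => ‖(Icc 1 R).indicator ν r‖ₑ) r ≤ _
    rw [hnorm]
    refine indicator_le (g := fun _ => ENNReal.ofReal C) (fun r hr => ?_) r
    rw [← ofReal_norm]
    exact ENNReal.ofReal_le_ofReal (hC r hr)
  · filter_upwards [hzero, ae_ne 1] with r hr hr1 hrR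
    have h1 := hr (lt_of_le_of_ne hrR.1 hr1.symm)
    rwa [indicator_of_mem hrR, enorm_eq_zero] at h1
  · filter_upwards [hev] with r hr hr1
    by_cases hrR : r ∈ Icc 1 R
    · refine le_trans ?_ (enorm_opPC_le (by linarith))
      rw [hr hrR, enorm_mul, indicator_of_mem hrR]
      exact mul_le_mul_left hs3 _
    · rw [indicator_of_notMem hrR]
      simp

end

end Snowflake

end

theorem mainTheorem6 (φ : ℂ → ℂ) (hφ : Snowflake.IsSigmaPrime φ) (k : ℕ) (hk : 2 ≤ k)
    (t R : ℝ) (hR : 1 < R)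
    (hcover : Snowflake.annulus R ⊆
      (fun z => Snowflake.inv φ z ^ k) ''
        (Snowflake.annulus R ∩ φ '' Snowflake.extDisk)) :
    -- `P` and `Q` are formally adjoint on `[1, ∞)`
    (∀ f ν : ℝ → ℝ≥0∞, Measurable f → Measurable ν →
      ∫⁻ r in Ioi (1 : ℝ), Snowflake.opQ φ k t f r * ν r =
        ∫⁻ r in Ioi (1 : ℝ), f r * Snowflake.opP φ k t ν r) ∧
    -- on `[1, R]`: adjointness for functions extended by zero, and the one-sided inequality
    (∀ f ν : ℝ → ℝ≥0∞, Measurable f → Measurable ν →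
      ∫⁻ r in Icc 1 R, Snowflake.opQ φ k t ((Icc 1 R).indicator f) r * ν r =
        ∫⁻ r in Icc 1 R, f r * Snowflake.opP φ k t ((Icc 1 R).indicator ν) r) ∧
    (∀ f ν : ℝ → ℝ≥0∞, Measurable f → Measurable ν →
      ∫⁻ r in Icc 1 R, f r * Snowflake.opP φ k t ((Icc 1 R).indicator ν) r ≤
        ∫⁻ r in Icc 1 R, Snowflake.opQ φ k t f r * ν r) ∧
    -- if all `k` sheets over `D_R` come from `D_R`, the extension of `ν` is irrelevant
    ((∀ u ∈ Snowflake.extDisk, ‖u‖ ^ k < R → φ u ∈ Snowflake.annulus R) →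
      ∀ ν : ℝ → ℝ≥0∞, ∀ r ∈ Ioo 1 R,
        Snowflake.opP φ k t ((Icc 1 R).indicator ν) r = Snowflake.opP φ k t ν r) ∧
    -- every positive test function gives a lower bound
    (∀ ν : ℝ → ℝ, Measurable ν → (∀ r ∈ Icc 1 R, 0 < ν r) →
      (∃ C : ℝ, ∀ r ∈ Icc 1 R, ν r ≤ C) →
      (⨅ r ∈ Ioo 1 R,
        ENNReal.log (Snowflake.opP φ k t
            ((Icc 1 R).indicator fun s => ENNReal.ofReal (ν s)) r / ENNReal.ofReal (ν r)) /
          (Real.log k : EReal)) ≤ Snowflake.avgSpectrum φ k t) ∧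
    -- every eigenvalue, in particular the maximal one, gives a lower bound
    (∀ lam : ℂ, Snowflake.IsEigenvalueOn φ k t R lam →
      ENNReal.log ‖lam‖ₑ / (Real.log k : EReal) ≤ Snowflake.avgSpectrum φ k t) := by
  have hk1 : 1 ≤ k := by omega
  refine ⟨fun f ν hf hν => Snowflake.opQ_opP_adjoint hφ hk1 t hf hν,
    fun f ν hf hν => Snowflake.opQ_opP_adjoint_indicator hφ hk1 t R hf hν,
    fun f ν hf hν => ?_,
    fun h ν r hr => Snowflake.opP_indicator_eq hk1 h ν hr,
    fun ν hν hpos ⟨C, hC⟩ => hφ.iInf_log_le_avgSpectrum hk hR hν hpos hC,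
    fun lam h => hφ.log_eigenvalue_le_avgSpectrum hk h⟩
  -- Truncating `f` to `[1, R]` can only decrease `Q f`.
  rw [← Snowflake.opQ_opP_adjoint_indicator hφ hk1 t R hf hν]
  gcongr with r
  exact Snowflake.opQ_mono (indicator_le_self _ _) r
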